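/- **Proposition (High dimensional CLT for hyperrectangles).** Let $n\ge 4$ and $p\ge 3$. Let $X_1,\dots,X_n$ be independent random vectors in $\mathbb{R}^p$, $X_i=(X_{i1},\dots,X_{ip})'$, with $\mathrm{E}[X_{ij}]=0$ and $\mathrm{E}[X_{ij}^2]<\infty$ for all $i,j$, and let $Y_1,\dots,Y_n$ be independent Gaussian random vectors with $Y_i\sim N(0,\mathrm{E}[X_iX_i'])$. Put $S_n^X=n^{-1/2}\sum_{i=1}^n X_i$, $S_n^Y=n^{-1/2}\sum_{i=1}^n Y_i$ and $$\rho_n(\mathcal{A}^{\mathrm{re}})=\sup_{A\in\mathcal{A}^{\mathrm{re}}}\left|\Pr(S_n^X\in A)-\Pr(S_n^Y\in A)\right|,$$ where $\mathcal{A}^{\mathrm{re}}$ is the class of all hyperrectangles $\{w\in\mathbb{R}^p: a_j\le w_j\le b_j \text{ for all } j=1,\dots,p\}$ with $-\infty\le a_j\le b_j\le\infty$. Let $b>0$, $q>0$ and $B_n\ge 1$ be constants, and suppose that * (M.1) $n^{-1}\sum_{i=1}^n\mathrm{E}[X_{ij}^2]\ge b$ for all $j=1,\dots,p$; * (M.2)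 $n^{-1}\sum_{i=1}^n\mathrm{E}[|X_{ij}|^{2+k}]\le B_n^k$ for all $j=1,\dots,p$ and $k=1,2$. Define $$D_n^{(1)}=\left(\frac{B_n^2\log^7(pn)}{n}\right)^{1/6},\qquad D_{n,q}^{(2)}=\left(\frac{B_n^2\log^3(pn)}{n^{1-2/q}}\right)^{1/3}.$$ (i) If (E.1) $\mathrm{E}[\exp(|X_{ij}|/B_n)]\le 2$ for all $i=1,\dots,n$ and $j=1,\dots,p$, then $$\rho_n(\mathcal{A}^{\mathrm{re}})\le C\,D_n^{(1)},$$ where the constant $C$ depends only on $b$. (ii) If (E.2) $\mathrm{E}\left[\left(\max_{1\le j\le p}|X_{ij}|/B_n\right)^q\right]\le 2$ for all $i=1,\dots,n$, then $$\rho_n(\mathcal{A}^{\mathrm{re}})\le C\left\{D_n^{(1)}+D_{n,q}^{(2)}\right\},$$ where the constant $C$ depends only on $b$ and $q$. -/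

import Mathlib

open MeasureTheory ProbabilityTheory

noncomputable section

namespace HDCLT

/-- The normalized sum `n^{-1/2} ∑ᵢ Xᵢ` of `n` random vectors in `ℝ^p`. -/
def normalizedSum {Ω : Type*} {n p : ℕ} (X : Fin n → Ω → EuclideanSpace ℝ (Fin p)) :
    Ω → EuclideanSpace ℝ (Fin p) :=
  fun ω => (Real.sqrt n)⁻¹ • ∑ i, X i ω

/-- The second moment matrix `E[Z Z']` of a random vector `Z`
(its covariance matrix when `Z` is centered). -/
def secondMomentMatrix {Ω : Type*} [MeasurableSpace Ω] (P : Measure Ω) {p : ℕ}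
    (Z : Ω → EuclideanSpace ℝ (Fin p)) : Matrix (Fin p) (Fin p) ℝ :=
  Matrix.of fun j k => ∫ ω, Z ω j * Z ω k ∂P

/-- The class of hyperrectangles `{w : a_j ≤ w_j ≤ b_j for all j}` with
`-∞ ≤ a_j ≤ b_j ≤ ∞`. -/
def hyperrectangles (p : ℕ) : Set (Set (EuclideanSpace ℝ (Fin p))) :=
  {A | ∃ a b : Fin p → EReal, (∀ j, a j ≤ b j) ∧
    A = {w | ∀ j, a j ≤ ((w j : ℝ) : EReal) ∧ ((w j : ℝ) : EReal) ≤ b j}}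

/-- `ρ(𝒜) = sup_{A ∈ 𝒜} |Pr(S ∈ A) - Pr(T ∈ A)|`. -/
def rho {Ω Ω' : Type*} [MeasurableSpace Ω] [MeasurableSpace Ω'] (P : Measure Ω)
    (P' : Measure Ω') {p : ℕ} (S : Ω → EuclideanSpace ℝ (Fin p))
    (T : Ω' → EuclideanSpace ℝ (Fin p)) (𝒜 : Set (Set (EuclideanSpace ℝ (Fin p)))) : ℝ :=
  ⨆ A : 𝒜, |P.real {ω | S ω ∈ A.1} - P'.real {ω | T ω ∈ A.1}|

/-- `X₁, …, Xₙ` are independent centered random vectors in `ℝ^p` whose coordinates have finite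
second moments. -/
structure IsIndepCentered {Ω : Type*} [MeasurableSpace Ω] (P : Measure Ω) {n p : ℕ}
    (X : Fin n → Ω → EuclideanSpace ℝ (Fin p)) : Prop where
  measurable : ∀ i, Measurable (X i)
  indep : iIndepFun X P
  memLp_two : ∀ i j, MemLp (fun ω => X i ω j) 2 P
  centered : ∀ i j, ∫ ω, X i ω j ∂P = 0

/-- `Y₁, …, Yₙ` are independent with `Yᵢ ∼ N(0, E[Xᵢ Xᵢ'])`. -/
structure IsGaussianAnalogue {Ω Ω' : Type*} [MeasurableSpace Ω] [MeasurableSpace Ω']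
    (P : Measure Ω) (P' : Measure Ω') {n p : ℕ} (X : Fin n → Ω → EuclideanSpace ℝ (Fin p))
    (Y : Fin n → Ω' → EuclideanSpace ℝ (Fin p)) : Prop where
  indep : iIndepFun Y P'
  hasLaw : ∀ i, HasLaw (Y i) (multivariateGaussian 0 (secondMomentMatrix P (X i))) P'

/-- `n⁻¹ ∑ᵢ E[X_{ij}²] ≥ b` for all `j` (all the expectations are finite when
`IsIndepCentered P X`). -/
def CondM1 {Ω : Type*} [MeasurableSpace Ω] (P : Measure Ω) {n p : ℕ}
    (X : Fin n → Ω → EuclideanSpace ℝ (Fin p)) (b : ℝ) : Prop :=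
  ∀ j, b ≤ (n : ℝ)⁻¹ * ∑ i, ∫ ω, X i ω j ^ 2 ∂P

/-- `n⁻¹ ∑ᵢ E[|X_{ij}|^{2+k}] ≤ B^k` for all `j` and `k = 1, 2`; in particular all these
moments are finite. -/
def CondM2 {Ω : Type*} [MeasurableSpace Ω] (P : Measure Ω) {n p : ℕ}
    (X : Fin n → Ω → EuclideanSpace ℝ (Fin p)) (B : ℝ) : Prop :=
  ∀ j, ∀ k ∈ ({1, 2} : Set ℕ), (∀ i, Integrable (fun ω => |X i ω j| ^ (2 + k)) P) ∧
    (n : ℝ)⁻¹ * ∑ i, ∫ ω, |X i ω j| ^ (2 + k) ∂P ≤ B ^ k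

/-- `E[exp(|X_{ij}| / B)] ≤ 2` for all `i, j`; in particular the expectation is finite. -/
def CondE1 {Ω : Type*} [MeasurableSpace Ω] (P : Measure Ω) {n p : ℕ}
    (X : Fin n → Ω → EuclideanSpace ℝ (Fin p)) (B : ℝ) : Prop :=
  ∀ i j, Integrable (fun ω => Real.exp (|X i ω j| / B)) P ∧
    ∫ ω, Real.exp (|X i ω j| / B) ∂P ≤ 2

/-- `E[(max_j |X_{ij}| / B)^q] ≤ 2` for all `i`; in particular the expectation is finite. -/
def CondE2 {Ω : Type*} [MeasurableSpace Ω] (P : Measure Ω) {n p : ℕ}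
    (X : Fin n → Ω → EuclideanSpace ℝ (Fin p)) (B q : ℝ) : Prop :=
  ∀ i, Integrable (fun ω => (⨆ j, |X i ω j| / B) ^ q) P ∧
    ∫ ω, (⨆ j, |X i ω j| / B) ^ q ∂P ≤ 2

/-- `D⁽¹⁾ = (B² log⁷(pn) / n)^{1/6}`. -/
def D1 (n p : ℕ) (B : ℝ) : ℝ :=
  (B ^ 2 * Real.log ((p : ℝ) * n) ^ 7 / n) ^ (1 / 6 : ℝ)

/-- `D⁽²⁾ = (B² log³(pn) / n^{1-2/q})^{1/3}`. -/
def D2 (n p : ℕ) (B q : ℝ) : ℝ :=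
  (B ^ 2 * Real.log ((p : ℝ) * n) ^ 3 / (n : ℝ) ^ (1 - 2 / q)) ^ (1 / 3 : ℝ)

end HDCLT

end

/-! A hyperrectangle is a lower orthant in the 2p signed coordinates ±w_j, so it suffices to compare
distribution functions of sums. The indicator of {w ≤ y} is replaced by a cutoff of a normalised
log-sum-exp. Its derivatives vanish unless max (w - y) lies in a band of width O(log(pn)), and its
third derivative is dominated by a softmax average of |x_k|³. Softmax weights sum to one, so the
dimension enters only through logarithms.

The X_i are exchanged for the Y_i as in Lindeberg's method, the first two moments cancelling, but
along a random path: each index lies in a subset S independently with probability t. Russo's formula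
(`hasDerivAt_subsetMean`) writes the t-derivative as the mean over S of the sum of all single flips.
For fixed S every flip is controlled by the same quantity, the probability that the mixed sum of S
falls in the band. Let r be the largest distance, over all S and y, between the distribution
function of a mixed sum and that of the Gaussian sum. The band probability is at most its Gaussian
value plus 2r. If the third-moment coefficient is small, this yields r ≤ (main terms) + r/2, and r
is absorbed (`abs_mixedCdf_sub_le`).

The Gaussian band probability is bounded by Nazarov's inequality. Its proof splits by the coordinate
that attains the maximum. Conditionally on the part of the vector independent of that coordinate,
this is an event on a half-line, and disjoint translates of a thin slice show that the slice carries
little mass.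

Scaling: put u = √log(pn) and multiply the summands by s = a u³/(D√n). The third-moment coefficient
is then of order a³ B u⁷/(√n D³), small once D ≥ D⁽¹⁾ and a is a small constant, while the Gaussian
band probability is of order D/(a√b). Summands exceeding 1 after scaling are expanded only to second
order, at the cost `sqTail`. Exponential moments make this cost O(D) automatically; q-th moments do
so once D ≥ D⁽²⁾. -/

set_option linter.unusedSectionVars false

/-! ### Smooth cutoffs and the Taylor remainder -/

namespace HDCLT

/-- A `C³` function decreasing from `1` to `0` on `[0, 1]`, with its first three derivatives. -/
structure SmoothCutoff where
  g : ℝ → ℝ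
  g1 : ℝ → ℝ
  g2 : ℝ → ℝ
  g3 : ℝ → ℝ
  bound : ℝ
  one_le_bound : 1 ≤ bound
  hasDerivAt : ∀ x, HasDerivAt g (g1 x) x
  hasDerivAt1 : ∀ x, HasDerivAt g1 (g2 x) x
  hasDerivAt2 : ∀ x, HasDerivAt g2 (g3 x) x
  nonneg : ∀ x, 0 ≤ g x
  le_one : ∀ x, g x ≤ 1
  eq_one : ∀ x ≤ 0, g x = 1
  eq_zero : ∀ x, 1 ≤ x → g x = 0
  abs_g1_le : ∀ x, |g1 x| ≤ bound
  abs_g2_le : ∀ x, |g2 x| ≤ bound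
  abs_g3_le : ∀ x, |g3 x| ≤ bound
  g1_eq_zero : ∀ x ∉ Set.Icc (0 : ℝ) 1, g1 x = 0
  g2_eq_zero : ∀ x ∉ Set.Icc (0 : ℝ) 1, g2 x = 0
  g3_eq_zero : ∀ x ∉ Set.Icc (0 : ℝ) 1, g3 x = 0

theorem exists_abs_le_of_eq_zero_off_Icc {h : ℝ → ℝ} (hc : Continuous h)
    (h0 : ∀ x ∉ Set.Icc (0 : ℝ) 1, h x = 0) : ∃ C, ∀ x, |h x| ≤ C := by
  obtain ⟨C, hC⟩ := (isCompact_Icc (a := (0 : ℝ)) (b := 1)).exists_bound_of_continuousOn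
    hc.continuousOn
  refine ⟨C, fun x => ?_⟩
  by_cases hx : x ∈ Set.Icc (0 : ℝ) 1
  · exact hC x hx
  · rw [h0 x hx, abs_zero]
    exact (norm_nonneg _).trans (hC 0 ⟨le_rfl, zero_le_one⟩)

theorem deriv_eq_zero_off_Icc {h : ℝ → ℝ} {c d : ℝ} (hl : ∀ x < 0, h x = c)
    (hr : ∀ x, 1 < x → h x = d) : ∀ x ∉ Set.Icc (0 : ℝ) 1, deriv h x = 0 := by
  intro x hx
  rcases lt_or_ge x 0 with h0 | h0
  · have : h =ᶠ[nhds x] fun _ => c := by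
      filter_upwards [Iio_mem_nhds h0] with y hy using hl y hy
    rw [this.deriv_eq, deriv_const]
  · have h1 : 1 < x := by
      by_contra! h1
      exact hx ⟨h0, h1⟩
    have : h =ᶠ[nhds x] fun _ => d := by
      filter_upwards [Ioi_mem_nhds h1] with y hy using hr y hy
    rw [this.deriv_eq, deriv_const]

theorem nonempty_smoothCutoff : Nonempty SmoothCutoff := by
  let g : ℝ → ℝ := fun x => 1 - Real.smoothTransition x
  have hg : ContDiff ℝ (⊤ : ℕ∞) g := contDiff_const.sub Real.smoothTransition.contDiff
  have hg1 : ContDiff ℝ (⊤ : ℕ∞) (deriv g) := hg.iterate_deriv 1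
  have hg2 : ContDiff ℝ (⊤ : ℕ∞) (deriv (deriv g)) := hg.iterate_deriv 2
  have hg3 : ContDiff ℝ (⊤ : ℕ∞) (deriv (deriv (deriv g))) := hg.iterate_deriv 3
  have hl : ∀ x ≤ 0, g x = 1 := fun x hx => by
    simp [g, Real.smoothTransition.zero_of_nonpos hx]
  have hr : ∀ x, 1 ≤ x → g x = 0 := fun x hx => by
    simp [g, Real.smoothTransition.one_of_one_le hx]
  have z1 := deriv_eq_zero_off_Icc (fun x hx => hl x hx.le) (fun x hx => hr x hx.le)
  have z2 := deriv_eq_zero_off_Icc (h := deriv g) (c := 0) (d := 0)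
    (fun x hx => z1 x fun h => absurd h.1 (not_le.2 hx))
    (fun x hx => z1 x fun h => absurd h.2 (not_le.2 hx))
  have z3 := deriv_eq_zero_off_Icc (h := deriv (deriv g)) (c := 0) (d := 0)
    (fun x hx => z2 x fun h => absurd h.1 (not_le.2 hx))
    (fun x hx => z2 x fun h => absurd h.2 (not_le.2 hx))
  obtain ⟨C1, h1⟩ := exists_abs_le_of_eq_zero_off_Icc hg1.continuous z1
  obtain ⟨C2, h2⟩ := exists_abs_le_of_eq_zero_off_Icc hg2.continuous z2
  obtain ⟨C3, h3⟩ := exists_abs_le_of_eq_zero_off_Icc hg3.continuous z3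
  have n0 : (((⊤ : ℕ∞) : WithTop ℕ∞)) ≠ 0 := by simp
  exact ⟨{
    g := g
    g1 := deriv g
    g2 := deriv (deriv g)
    g3 := deriv (deriv (deriv g))
    bound := max 1 (max C1 (max C2 C3))
    one_le_bound := le_max_left _ _
    hasDerivAt := fun x => (hg.differentiable n0 x).hasDerivAt
    hasDerivAt1 := fun x => (hg1.differentiable n0 x).hasDerivAt
    hasDerivAt2 := fun x => (hg2.differentiable n0 x).hasDerivAt
    nonneg := fun x => sub_nonneg.2 (Real.smoothTransition.le_one x)
    le_one := fun x => sub_le_self _ (Real.smoothTransition.nonneg x)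
    eq_one := hl
    eq_zero := hr
    abs_g1_le := fun x => (h1 x).trans (by simp)
    abs_g2_le := fun x => (h2 x).trans (by simp)
    abs_g3_le := fun x => (h3 x).trans (by simp)
    g1_eq_zero := z1
    g2_eq_zero := z2
    g3_eq_zero := z3 }⟩

namespace SmoothCutoff
variable (c : SmoothCutoff)

theorem continuous_g : Continuous c.g :=
  continuous_iff_continuousAt.2 fun x => (c.hasDerivAt x).continuousAt

theorem continuous_g1 : Continuous c.g1 :=
  continuous_iff_continuousAt.2 fun x => (c.hasDerivAt1 x).continuousAt

theorem continuous_g2 : Continuous c.g2 :=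
  continuous_iff_continuousAt.2 fun x => (c.hasDerivAt2 x).continuousAt

end SmoothCutoff

/-- The mean value inequality is applied three times on [0, 1], each time after subtracting the next
Taylor term. The sharp factor 1/6 is not needed. -/
theorem abs_taylor_two_remainder_le {f f1 f2 f3 : ℝ → ℝ} {M : ℝ}
    (h0 : ∀ x, HasDerivAt f (f1 x) x) (h1 : ∀ x, HasDerivAt f1 (f2 x) x)
    (h2 : ∀ x, HasDerivAt f2 (f3 x) x) (hM : ∀ x ∈ Set.Icc (0 : ℝ) 1, |f3 x| ≤ M) :
    |f 1 - f 0 - f1 0 - f2 0 / 2| ≤ M := by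
  have hM0 : 0 ≤ M := (abs_nonneg _).trans (hM 0 ⟨le_rfl, zero_le_one⟩)
  have key : ∀ (u u' : ℝ → ℝ), (∀ x, HasDerivAt u (u' x) x) →
      (∀ x ∈ Set.Icc (0 : ℝ) 1, |u' x| ≤ M) → ∀ x ∈ Set.Icc (0 : ℝ) 1, |u x - u 0| ≤ M := by
    intro u u' hu hb x hx
    have := norm_image_sub_le_of_norm_deriv_le_segment' (f := u) (f' := u') (a := 0) (b := 1)
      (C := M) (fun y _ => (hu y).hasDerivWithinAt)
      (fun y hy => hb y (Set.Ico_subset_Icc_self hy)) x hx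
    rw [sub_zero] at this
    exact this.trans (mul_le_of_le_one_right hM0 hx.2)
  have k2 := key f2 f3 h2 hM
  have k1 := key (fun x => f1 x - x * f2 0) (fun x => f2 x - f2 0)
    (fun x => ((h1 x).sub ((hasDerivAt_id x).mul_const (f2 0))).congr_deriv (by simp)) k2
  have k0 := key (fun x => f x - x * f1 0 - x ^ 2 / 2 * f2 0)
    (fun x => f1 x - x * f2 0 - (f1 0 - 0 * f2 0))
    (fun x => (((h0 x).sub ((hasDerivAt_id x).mul_const (f1 0))).sub
      ((((hasDerivAt_id x).pow 2).div_const 2).mul_const (f2 0))).congr_deriv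
        (by simp; ring)) k1 1 ⟨zero_le_one, le_rfl⟩
  refine le_trans (le_of_eq ?_) k0
  congr 1
  ring

end HDCLT

/-! ### Log-sum-exp smoothing of an orthant -/

namespace HDCLT

noncomputable section

variable {κ : Type*} [Fintype κ]

/-- `∑ₖ exp wₖ`. -/
def expSum (w : κ → ℝ) : ℝ := ∑ k, Real.exp (w k)

/-- The softmax weights `exp wₖ / ∑ₗ exp wₗ`. -/
def softmax (w : κ → ℝ) (k : κ) : ℝ := Real.exp (w k) / expSum w

/-- The `r`-th moment of `x` under the softmax weights at `w`. -/
def softMoment (r : ℕ) (w x : κ → ℝ) : ℝ := ∑ k, softmax w k * x k ^ r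

/-- The normalized log-sum-exp function. -/
def level (L : ℝ) (w : κ → ℝ) : ℝ := (Real.log (expSum w) - Real.log (Fintype.card κ)) / L

/-- The set of `w` at which the level lies within `r / L` of the unit interval. -/
def band (L r : ℝ) : Set (κ → ℝ) :=
  {w | -r ≤ Real.log (expSum w) - Real.log (Fintype.card κ) ∧
    Real.log (expSum w) - Real.log (Fintype.card κ) ≤ L + r}

/-- The softmax weight, cut off outside a band. -/
def bandWeight (L r : ℝ) (k : κ) (w : κ → ℝ) : ℝ := (band L r).indicator (fun w => softmax w k) w

theorem continuous_expSum : Continuous (expSum : (κ → ℝ) → ℝ) := by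
  unfold expSum; fun_prop

theorem expSum_add_le {w x : κ → ℝ} {r : ℝ} (hx : ∀ k, x k ≤ r) :
    expSum (w + x) ≤ Real.exp r * expSum w := by
  unfold expSum
  rw [Finset.mul_sum]
  refine Finset.sum_le_sum fun k _ => ?_
  rw [← Real.exp_add, Pi.add_apply, add_comm]
  exact Real.exp_le_exp.2 (by linarith [hx k])

theorem hasDerivAt_sum_exp_mul_pow (w x : κ → ℝ) (r : ℕ) (s : ℝ) :
    HasDerivAt (fun s : ℝ => ∑ k, Real.exp ((w + s • x) k) * x k ^ r)
      (∑ k, Real.exp ((w + s • x) k) * x k ^ (r + 1)) s := by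
  refine HasDerivAt.fun_sum fun k _ => ?_
  have h : HasDerivAt (fun s : ℝ => (w + s • x) k) (x k) s := by
    simpa using ((hasDerivAt_id s).mul_const (x k)).const_add (w k)
  exact (h.exp.mul_const (x k ^ r)).congr_deriv (by ring)

theorem softMoment_eq_div (r : ℕ) (w x : κ → ℝ) :
    softMoment r w x = (∑ k, Real.exp (w k) * x k ^ r) / expSum w := by
  rw [Finset.sum_div]
  exact Finset.sum_congr rfl fun k _ => by rw [softmax]; ring

/-- The smooth approximation `g (level w)` of the indicator of `{w | ∀ k, w k ≤ 0}`. -/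
def smoothInd (c : SmoothCutoff) (L : ℝ) (w : κ → ℝ) : ℝ := c.g (level L w)

theorem level_notMem_Icc {L : ℝ} (hL : 0 < L) {w : κ → ℝ} (hw : w ∉ band L 0) :
    level L w ∉ Set.Icc (0 : ℝ) 1 := by
  intro h
  have h1 := (le_div_iff₀ hL).1 h.1
  have h2 := (div_le_iff₀ hL).1 h.2
  exact hw ⟨by linarith, by linarith⟩

theorem smoothInd_nonneg (c : SmoothCutoff) (L : ℝ) (w : κ → ℝ) : 0 ≤ smoothInd c L w :=
  c.nonneg _

theorem smoothInd_le_one (c : SmoothCutoff) (L : ℝ) (w : κ → ℝ) : smoothInd c L w ≤ 1 :=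
  c.le_one _

/-- `‖x‖²` cut off to `‖x‖ > 1`. -/
def sqTail (x : κ → ℝ) : ℝ := {x : κ → ℝ | 1 < ‖x‖}.indicator (fun x => ‖x‖ ^ 2) x

theorem sqTail_nonneg (x : κ → ℝ) : 0 ≤ sqTail x :=
  Set.indicator_nonneg (fun _ _ => by positivity) x

section
variable [Nonempty κ]

theorem expSum_pos (w : κ → ℝ) : 0 < expSum w :=
  Finset.sum_pos (fun _ _ => Real.exp_pos _) Finset.univ_nonempty

theorem softmax_nonneg (w : κ → ℝ) (k : κ) : 0 ≤ softmax w k :=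
  div_nonneg (Real.exp_pos _).le (expSum_pos w).le

theorem sum_softmax (w : κ → ℝ) : ∑ k, softmax w k = 1 := by
  simp only [softmax, ← Finset.sum_div]
  exact div_self (expSum_pos w).ne'

theorem softmax_le_one (w : κ → ℝ) (k : κ) : softmax w k ≤ 1 := by
  rw [← sum_softmax w]
  exact Finset.single_le_sum (fun j _ => softmax_nonneg w j) (Finset.mem_univ k)

theorem continuous_softmax (k : κ) : Continuous fun w : κ → ℝ => softmax w k :=
  (by fun_prop : Continuous fun w : κ → ℝ => Real.exp (w k)).div continuous_expSum
    fun w => (expSum_pos w).ne'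

theorem continuous_log_expSum : Continuous fun w : κ → ℝ => Real.log (expSum w) :=
  continuous_expSum.log fun w => (expSum_pos w).ne'

theorem continuous_level (L : ℝ) : Continuous (level L : (κ → ℝ) → ℝ) :=
  (continuous_log_expSum.sub continuous_const).div_const L

theorem measurableSet_band (L r : ℝ) : MeasurableSet (band L r : Set (κ → ℝ)) :=
  ((isClosed_le continuous_const (continuous_log_expSum.sub continuous_const)).inter
    (isClosed_le (continuous_log_expSum.sub continuous_const) continuous_const)).measurableSet

theorem bandWeight_nonneg (L r : ℝ) (k : κ) (w : κ → ℝ) : 0 ≤ bandWeight L r k w :=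
  Set.indicator_nonneg (fun w _ => softmax_nonneg w k) w

theorem bandWeight_le_one (L r : ℝ) (k : κ) (w : κ → ℝ) : bandWeight L r k w ≤ 1 :=
  Set.indicator_apply_le' (fun _ => softmax_le_one w k) fun _ => zero_le_one

theorem measurable_bandWeight (L r : ℝ) (k : κ) : Measurable (bandWeight L r k) :=
  (continuous_softmax k).measurable.indicator (measurableSet_band L r)

theorem sum_bandWeight (L r : ℝ) (w : κ → ℝ) :
    ∑ k, bandWeight L r k w = (band L r).indicator 1 w := by
  by_cases h : w ∈ band L r <;> simp [bandWeight, h, sum_softmax]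

theorem log_expSum_add_le {w x : κ → ℝ} {r : ℝ} (hx : ∀ k, x k ≤ r) :
    Real.log (expSum (w + x)) ≤ Real.log (expSum w) + r := by
  refine (Real.log_le_log (expSum_pos _) (expSum_add_le hx)).trans (le_of_eq ?_)
  rw [Real.log_mul (Real.exp_pos _).ne' (expSum_pos _).ne', Real.log_exp, add_comm]

theorem abs_log_expSum_add_sub_le {w x : κ → ℝ} {r : ℝ} (hx : ‖x‖ ≤ r) :
    |Real.log (expSum (w + x)) - Real.log (expSum w)| ≤ r := by
  have h : ∀ k, |x k| ≤ r := fun k => (norm_le_pi_norm x k).trans hx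
  have h1 := log_expSum_add_le (w := w) (x := x) fun k => (abs_le.1 (h k)).2
  have h2 := log_expSum_add_le (w := w + x) (x := -x) (r := r) fun k => by
    have := (abs_le.1 (h k)).1
    simp only [Pi.neg_apply]; linarith
  rw [add_neg_cancel_right] at h2
  exact abs_le.2 ⟨by linarith, by linarith⟩

/-- The numerator grows by at most exp r and the denominator shrinks by at most exp r. This
multiplicative stability lets derivative bounds along a short segment be frozen at one of its ends.
-/
theorem softmax_add_le {w x : κ → ℝ} {r : ℝ} (hx : ‖x‖ ≤ r) (k : κ) :
    softmax (w + x) k ≤ Real.exp (2 * r) * softmax w k := by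
  have h : ∀ k, |x k| ≤ r := fun k => (norm_le_pi_norm x k).trans hx
  have h2 := expSum_add_le (w := w + x) (x := -x) (r := r) fun k => by
    have := (abs_le.1 (h k)).1
    simp only [Pi.neg_apply]; linarith
  rw [add_neg_cancel_right] at h2
  have h3 : Real.exp ((w + x) k) ≤ Real.exp r * Real.exp (w k) := by
    rw [← Real.exp_add, Pi.add_apply]
    exact Real.exp_le_exp.2 (by linarith [(abs_le.1 (h k)).2])
  unfold softmax
  rw [div_le_iff₀ (expSum_pos _)]
  calc Real.exp ((w + x) k) ≤ Real.exp r * Real.exp (w k) := h3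
    _ = Real.exp r * (Real.exp (w k) / expSum w) * expSum w := by
      field_simp [(expSum_pos w).ne']
    _ ≤ Real.exp r * (Real.exp (w k) / expSum w) * (Real.exp r * expSum (w + x)) := by
      have := div_nonneg (Real.exp_pos (w k)).le (expSum_pos w).le
      gcongr
    _ = _ := by rw [two_mul, Real.exp_add]; ring

theorem band_add {L r s : ℝ} {w x : κ → ℝ} (hx : ‖x‖ ≤ s) (hw : w ∈ band L r) :
    w + x ∈ band L (r + s) := by
  have h := abs_le.1 (abs_log_expSum_add_sub_le (w := w) hx)
  exact ⟨by linarith [hw.1, h.1], by linarith [hw.2, h.2]⟩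

/-- Log-sum-exp is 1-Lipschitz in the sup norm, so a move of length s stays inside the band enlarged
by s; `softmax_add_le` controls the weight. -/
theorem bandWeight_le_add {L r s : ℝ} {w x : κ → ℝ} (hx : ‖x‖ ≤ s) (k : κ) :
    bandWeight L r k w ≤ Real.exp (2 * s) * bandWeight L (r + s) k (w + x) := by
  by_cases hw : w ∈ band L r
  · unfold bandWeight
    rw [Set.indicator_of_mem hw, Set.indicator_of_mem (band_add hx hw)]
    have := softmax_add_le (w := w + x) (x := -x) (r := s) (by rwa [norm_neg]) k
    rwa [add_neg_cancel_right] at this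
  · rw [bandWeight, Set.indicator_of_notMem hw]
    exact mul_nonneg (Real.exp_pos _).le (bandWeight_nonneg _ _ _ _)

/-- The softmax average of `|x| ^ r`. -/
theorem abs_softMoment_le (r : ℕ) (w x : κ → ℝ) :
    |softMoment r w x| ≤ ∑ k, softmax w k * |x k| ^ r := by
  refine (Finset.abs_sum_le_sum_abs _ _).trans (le_of_eq ?_)
  simp [abs_mul, abs_of_nonneg (softmax_nonneg _ _)]

theorem softmax_average_le {w a : κ → ℝ} {M : ℝ} (h : ∀ k, a k ≤ M) :
    ∑ k, softmax w k * a k ≤ M := by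
  calc ∑ k, softmax w k * a k ≤ ∑ k, softmax w k * M :=
        Finset.sum_le_sum fun k _ => mul_le_mul_of_nonneg_left (h k) (softmax_nonneg w k)
    _ = M := by rw [← Finset.sum_mul, sum_softmax, one_mul]

theorem hasDerivAt_expSum (w x : κ → ℝ) (s : ℝ) :
    HasDerivAt (fun s : ℝ => expSum (w + s • x)) (∑ k, Real.exp ((w + s • x) k) * x k) s := by
  simpa [expSum] using hasDerivAt_sum_exp_mul_pow w x 0 s

/-- Moving w along x tilts the softmax measure exponentially, so the derivative of a mean is a
covariance with x. -/
theorem hasDerivAt_softMoment (r : ℕ) (w x : κ → ℝ) (s : ℝ) :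
    HasDerivAt (fun s : ℝ => softMoment r (w + s • x) x)
      (softMoment (r + 1) (w + s • x) x - softMoment r (w + s • x) x * softMoment 1 (w + s • x) x)
      s := by
  have hE := (expSum_pos (w + s • x)).ne'
  simp only [softMoment_eq_div]
  refine ((hasDerivAt_sum_exp_mul_pow w x r s).div (hasDerivAt_expSum w x s) hE).congr_deriv ?_
  simp only [pow_one]
  field_simp

theorem hasDerivAt_level (L : ℝ) (w x : κ → ℝ) (s : ℝ) :
    HasDerivAt (fun s : ℝ => level L (w + s • x)) (softMoment 1 (w + s • x) x / L) s := by
  refine ((((hasDerivAt_expSum w x s).log (expSum_pos _).ne').sub_const _).div_const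
    L).congr_deriv ?_
  simp [softMoment_eq_div]

/-- The first directional derivative of `smoothInd`. -/
def smoothInd1 (c : SmoothCutoff) (L : ℝ) (w x : κ → ℝ) : ℝ :=
  c.g1 (level L w) * (softMoment 1 w x / L)

/-- The second directional derivative of `smoothInd`. -/
def smoothInd2 (c : SmoothCutoff) (L : ℝ) (w x : κ → ℝ) : ℝ :=
  c.g2 (level L w) * (softMoment 1 w x / L) ^ 2 +
    c.g1 (level L w) * ((softMoment 2 w x - softMoment 1 w x ^ 2) / L)

/-- The third directional derivative of `smoothInd`. -/
def smoothInd3 (c : SmoothCutoff) (L : ℝ) (w x : κ → ℝ) : ℝ :=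
  c.g3 (level L w) * (softMoment 1 w x / L) ^ 3 +
    3 * (c.g2 (level L w) * (softMoment 1 w x / L) *
      ((softMoment 2 w x - softMoment 1 w x ^ 2) / L)) +
    c.g1 (level L w) *
      ((softMoment 3 w x - 3 * softMoment 1 w x * softMoment 2 w x +
        2 * softMoment 1 w x ^ 3) / L)

theorem hasDerivAt_smoothInd (c : SmoothCutoff) (L : ℝ) (w x : κ → ℝ) (s : ℝ) :
    HasDerivAt (fun s : ℝ => smoothInd c L (w + s • x)) (smoothInd1 c L (w + s • x) x) s :=
  (c.hasDerivAt _).comp s (hasDerivAt_level L w x s)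

theorem hasDerivAt_smoothInd1 (c : SmoothCutoff) (L : ℝ) (w x : κ → ℝ) (s : ℝ) :
    HasDerivAt (fun s : ℝ => smoothInd1 c L (w + s • x) x) (smoothInd2 c L (w + s • x) x) s := by
  refine (((c.hasDerivAt1 _).comp s (hasDerivAt_level L w x s)).mul
    ((hasDerivAt_softMoment 1 w x s).div_const L)).congr_deriv ?_
  simp only [smoothInd2, Function.comp]
  ring

theorem hasDerivAt_smoothInd2 (c : SmoothCutoff) (L : ℝ) (w x : κ → ℝ) (s : ℝ) :
    HasDerivAt (fun s : ℝ => smoothInd2 c L (w + s • x) x) (smoothInd3 c L (w + s • x) x) s := by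
  have hm1 := hasDerivAt_softMoment 1 w x s
  have hm2 := hasDerivAt_softMoment 2 w x s
  have hl := hasDerivAt_level L w x s
  refine ((((c.hasDerivAt2 _).comp s hl).mul ((hm1.div_const L).pow 2)).add
    (((c.hasDerivAt1 _).comp s hl).mul ((hm2.sub (hm1.pow 2)).div_const L))).congr_deriv ?_
  simp only [smoothInd3, Function.comp, Pi.pow_apply, Pi.sub_apply]
  push_cast
  ring

theorem abs_softMoment_le_of_norm_le (r : ℕ) (w x : κ → ℝ) : |softMoment r w x| ≤ ‖x‖ ^ r :=
  (abs_softMoment_le r w x).trans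
    (softmax_average_le fun k => pow_le_pow_left₀ (abs_nonneg _) (norm_le_pi_norm x k) r)

theorem abs_smoothInd1_le (c : SmoothCutoff) {L : ℝ} (hL : 1 ≤ L) (w x : κ → ℝ) :
    |smoothInd1 c L w x| ≤ c.bound * ‖x‖ := by
  have hL0 : 0 < L := by linarith
  have hb := c.one_le_bound
  have h1 := abs_softMoment_le_of_norm_le 1 w x
  rw [pow_one] at h1
  rw [smoothInd1, abs_mul, abs_div, abs_of_pos hL0]
  exact mul_le_mul (c.abs_g1_le _) ((div_le_self (abs_nonneg _) hL).trans h1)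
    (by positivity) (by positivity)

theorem abs_smoothInd2_le (c : SmoothCutoff) {L : ℝ} (hL : 1 ≤ L) (w x : κ → ℝ) :
    |smoothInd2 c L w x| ≤ 3 * c.bound * ‖x‖ ^ 2 := by
  have hL0 : 0 < L := by linarith
  have hb := c.one_le_bound
  have h1 := abs_softMoment_le_of_norm_le 1 w x
  have h2 := abs_softMoment_le_of_norm_le 2 w x
  rw [pow_one] at h1
  have h1L : |softMoment 1 w x / L| ≤ ‖x‖ := by
    rw [abs_div, abs_of_pos hL0]
    exact (div_le_self (abs_nonneg _) hL).trans h1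
  have h3 : |softMoment 2 w x - softMoment 1 w x ^ 2| ≤ 2 * ‖x‖ ^ 2 := by
    refine (abs_sub _ _).trans ?_
    rw [abs_pow]
    have := pow_le_pow_left₀ (abs_nonneg _) h1 2
    linarith
  have h4 : |(softMoment 2 w x - softMoment 1 w x ^ 2) / L| ≤ 2 * ‖x‖ ^ 2 := by
    rw [abs_div, abs_of_pos hL0]
    exact (div_le_self (abs_nonneg _) hL).trans h3
  have h5 : |(softMoment 1 w x / L) ^ 2| ≤ ‖x‖ ^ 2 := by
    rw [abs_pow]; exact pow_le_pow_left₀ (abs_nonneg _) h1L 2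
  refine (abs_add_le _ _).trans ?_
  rw [abs_mul, abs_mul]
  have a := mul_le_mul (c.abs_g2_le (level L w)) h5 (abs_nonneg _) (by positivity)
  have b := mul_le_mul (c.abs_g1_le (level L w)) h4 (abs_nonneg _) (by positivity)
  linarith

/-- Every term is of degree three in the softmax moments of x and carries at least one factor 1/L.
Jensen and Cauchy-Schwarz bound each by the softmax mean of |x|³; the coefficients add up to 1 + 6 +
6 = 13. Keeping the softmax weights, instead of passing to ‖x‖³, avoids the expectation of a maximum
over coordinates. -/
theorem abs_smoothInd3_le (c : SmoothCutoff) {L : ℝ} (hL : 1 ≤ L) (w x : κ → ℝ) :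
    |smoothInd3 c L w x| ≤ 13 * c.bound / L * ∑ k, bandWeight L 0 k w * |x k| ^ 3 := by
  have hL0 : 0 < L := by linarith
  have hb := c.one_le_bound
  by_cases hw : w ∈ band L 0
  swap
  · have h := level_notMem_Icc hL0 hw
    rw [smoothInd3, c.g1_eq_zero _ h, c.g2_eq_zero _ h, c.g3_eq_zero _ h]
    have : 0 ≤ 13 * c.bound / L * ∑ k, bandWeight L 0 k w * |x k| ^ 3 :=
      mul_nonneg (by positivity)
        (Finset.sum_nonneg fun k _ => mul_nonneg (bandWeight_nonneg _ _ _ _) (by positivity))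
    simpa using this
  have hU : ∀ k, bandWeight L 0 k w = softmax w k := fun k => Set.indicator_of_mem hw _
  simp only [hU]
  set A : ℕ → ℝ := fun r => ∑ k, softmax w k * |x k| ^ r with hA
  have hA0 : ∀ r, 0 ≤ A r := fun r =>
    Finset.sum_nonneg fun k _ => mul_nonneg (softmax_nonneg _ _) (by positivity)
  have hm : ∀ r, |softMoment r w x| ≤ A r := fun r => abs_softMoment_le r w x
  have j1 : A 1 ^ 3 ≤ A 3 := by
    have := Real.pow_arith_mean_le_arith_mean_pow Finset.univ (softmax w) (fun k => |x k|)
      (fun k _ => softmax_nonneg w k) (sum_softmax w) (fun k _ => abs_nonneg _) 3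
    simpa [hA] using this
  -- Combine A 2 ² ≤ A 1 · A 3 with A 1 ³ ≤ A 3.
  have j2 : A 1 * A 2 ≤ A 3 := by
    have cs : A 2 ^ 2 ≤ A 1 * A 3 := by
      have := Finset.sum_mul_sq_le_sq_mul_sq Finset.univ
        (fun k => Real.sqrt (softmax w k * |x k|)) (fun k => Real.sqrt (softmax w k * |x k| ^ 3))
      have e1 : ∀ k, Real.sqrt (softmax w k * |x k|) ^ 2 = softmax w k * |x k| ^ 1 := fun k => by
        rw [Real.sq_sqrt (mul_nonneg (softmax_nonneg _ _) (abs_nonneg _)), pow_one]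
      have e2 : ∀ k, Real.sqrt (softmax w k * |x k| ^ 3) ^ 2 = softmax w k * |x k| ^ 3 :=
        fun k => Real.sq_sqrt (mul_nonneg (softmax_nonneg _ _) (by positivity))
      have e3 : ∀ k, Real.sqrt (softmax w k * |x k|) * Real.sqrt (softmax w k * |x k| ^ 3) =
          softmax w k * |x k| ^ 2 := fun k => by
        rw [← Real.sqrt_mul (mul_nonneg (softmax_nonneg _ _) (abs_nonneg _)),
          show softmax w k * |x k| * (softmax w k * |x k| ^ 3) = (softmax w k * |x k| ^ 2) ^ 2 by
            ring, Real.sqrt_sq (mul_nonneg (softmax_nonneg _ _) (by positivity))]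
      simp only [e1, e2, e3] at this
      exact this
    have a1 := hA0 1
    have a2 := hA0 2
    have a3 := hA0 3
    have : (A 1 * A 2) ^ 2 ≤ A 3 ^ 2 :=
      calc (A 1 * A 2) ^ 2 = A 1 ^ 2 * A 2 ^ 2 := by ring
        _ ≤ A 1 ^ 2 * (A 1 * A 3) := by gcongr
        _ = A 1 ^ 3 * A 3 := by ring
        _ ≤ A 3 * A 3 := by gcongr
        _ = A 3 ^ 2 := by ring
    exact (pow_le_pow_iff_left₀ (mul_nonneg a1 a2) a3 two_ne_zero).1 this
  set m1 := softMoment 1 w x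
  set m2 := softMoment 2 w x
  set m3 := softMoment 3 w x
  have k1 : |m1| ^ 3 ≤ A 3 := (pow_le_pow_left₀ (abs_nonneg _) (hm 1) 3).trans j1
  have k2 : |m1| * |m2| ≤ A 3 :=
    (mul_le_mul (hm 1) (hm 2) (abs_nonneg _) (hA0 1)).trans j2
  have t1 : |(m1 / L) ^ 3| ≤ A 3 / L := by
    rw [abs_pow, abs_div, abs_of_pos hL0, div_pow]
    exact div_le_div₀ (hA0 3) k1 hL0 (le_self_pow₀ hL three_ne_zero)
  have t2 : |m1 / L * ((m2 - m1 ^ 2) / L)| ≤ 2 * A 3 / L := by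
    rw [div_mul_div_comm, abs_div, abs_of_pos (mul_pos hL0 hL0)]
    refine div_le_div₀ (by linarith [hA0 3]) ?_ hL0 (le_mul_of_one_le_left hL0.le hL)
    calc |m1 * (m2 - m1 ^ 2)| = |m1 * m2 - m1 ^ 3| := by ring_nf
      _ ≤ |m1 * m2| + |m1 ^ 3| := abs_sub _ _
      _ ≤ 2 * A 3 := by rw [abs_mul, abs_pow]; linarith
  have t3 : |(m3 - 3 * m1 * m2 + 2 * m1 ^ 3) / L| ≤ 6 * A 3 / L := by
    rw [abs_div, abs_of_pos hL0]
    refine div_le_div_of_nonneg_right ?_ hL0.le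
    calc |m3 - 3 * m1 * m2 + 2 * m1 ^ 3| ≤ |m3| + |3 * m1 * m2| + |2 * m1 ^ 3| :=
          (abs_add_le _ _).trans (add_le_add_left (abs_sub _ _) _)
      _ = |m3| + 3 * (|m1| * |m2|) + 2 * |m1| ^ 3 := by
          simp only [abs_mul, abs_pow]; norm_num; ring
      _ ≤ 6 * A 3 := by linarith [hm 3]
  have b0 : 0 ≤ c.bound := by linarith
  calc |smoothInd3 c L w x|
      ≤ |c.g3 (level L w) * (m1 / L) ^ 3| +
        |3 * (c.g2 (level L w) * (m1 / L) * ((m2 - m1 ^ 2) / L))| +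
        |c.g1 (level L w) * ((m3 - 3 * m1 * m2 + 2 * m1 ^ 3) / L)| :=
        (abs_add_le _ _).trans (add_le_add_left (abs_add_le _ _) _)
    _ = |c.g3 (level L w)| * |(m1 / L) ^ 3| +
        3 * (|c.g2 (level L w)| * |m1 / L * ((m2 - m1 ^ 2) / L)|) +
        |c.g1 (level L w)| * |(m3 - 3 * m1 * m2 + 2 * m1 ^ 3) / L| := by
        rw [abs_mul, abs_mul 3, mul_assoc (c.g2 _), abs_mul (c.g2 _), abs_mul (c.g1 _)]
        norm_num
    _ ≤ c.bound * (A 3 / L) + 3 * (c.bound * (2 * A 3 / L)) + c.bound * (6 * A 3 / L) := by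
        gcongr
        · exact c.abs_g3_le _
        · exact c.abs_g2_le _
        · exact c.abs_g1_le _
    _ = 13 * c.bound / L * A 3 := by ring

/-- The second order Taylor remainder of `smoothInd`. -/
def smoothIndRem (c : SmoothCutoff) (L : ℝ) (w x : κ → ℝ) : ℝ :=
  smoothInd c L (w + x) - smoothInd c L w - smoothInd1 c L w x - smoothInd2 c L w x / 2

/-- For ‖x‖ ≤ 1 the third derivative along the segment is compared with the weights at w, over a
band wider by 1. For ‖x‖ > 1 each term of the remainder is bounded separately, and 1 + ‖x‖ + 3‖x‖²/2
≤ 4‖x‖². -/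
theorem abs_smoothIndRem_le (c : SmoothCutoff) {L : ℝ} (hL : 1 ≤ L) (w x : κ → ℝ) :
    |smoothIndRem c L w x| ≤
      13 * c.bound * Real.exp 2 / L * ∑ k, bandWeight L 1 k w * |x k| ^ 3 +
        4 * c.bound * sqTail x := by
  have hL0 : 0 < L := by linarith
  have hb := c.one_le_bound
  have hS : 0 ≤ ∑ k, bandWeight L 1 k w * |x k| ^ 3 :=
    Finset.sum_nonneg fun k _ => mul_nonneg (bandWeight_nonneg _ _ _ _) (by positivity)
  rcases le_or_gt ‖x‖ 1 with hx | hx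
  · have hT : sqTail x = 0 := Set.indicator_of_notMem (by simpa using hx) _
    rw [hT, mul_zero, add_zero]
    have := abs_taylor_two_remainder_le (M := 13 * c.bound * Real.exp 2 / L *
      ∑ k, bandWeight L 1 k w * |x k| ^ 3)
      (hasDerivAt_smoothInd c L w x) (hasDerivAt_smoothInd1 c L w x)
      (hasDerivAt_smoothInd2 c L w x) ?_
    · simpa [smoothIndRem] using this
    · intro s hs
      refine (abs_smoothInd3_le c hL _ x).trans ?_
      have hsx : ‖-(s • x)‖ ≤ 1 := by
        rw [norm_neg, norm_smul, Real.norm_of_nonneg hs.1]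
        exact mul_le_one₀ hs.2 (norm_nonneg _) hx
      have hk : ∀ k, bandWeight L 0 k (w + s • x) ≤ Real.exp 2 * bandWeight L 1 k w := fun k => by
        simpa using bandWeight_le_add (L := L) (r := 0) (w := w + s • x) hsx k
      calc 13 * c.bound / L * ∑ k, bandWeight L 0 k (w + s • x) * |x k| ^ 3
          ≤ 13 * c.bound / L * ∑ k, Real.exp 2 * bandWeight L 1 k w * |x k| ^ 3 := by
            gcongr with k _
            exact hk k
        _ = _ := by simp only [mul_assoc, ← Finset.mul_sum]; ring
  · have hT : sqTail x = ‖x‖ ^ 2 := Set.indicator_of_mem (by simpa using hx) _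
    rw [hT]
    have h1 := abs_smoothInd1_le c hL w x
    have h2 := abs_smoothInd2_le c hL w x
    have h0 : |smoothInd c L (w + x) - smoothInd c L w| ≤ 1 :=
      abs_sub_le_iff.2 ⟨by linarith [smoothInd_le_one c L (w + x), smoothInd_nonneg c L w],
        by linarith [smoothInd_le_one c L w, smoothInd_nonneg c L (w + x)]⟩
    have h3 : |smoothIndRem c L w x| ≤ 1 + c.bound * ‖x‖ + 3 * c.bound * ‖x‖ ^ 2 / 2 := by
      unfold smoothIndRem
      refine (abs_sub _ _).trans (add_le_add ((abs_sub _ _).trans (add_le_add h0 h1)) ?_)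
      rw [abs_div, abs_two]
      linarith
    have h4 : 0 ≤ 13 * c.bound * Real.exp 2 / L * ∑ k, bandWeight L 1 k w * |x k| ^ 3 := by
      positivity
    have h5 : ‖x‖ ≤ ‖x‖ ^ 2 := le_self_pow₀ hx.le two_ne_zero
    nlinarith [mul_le_mul_of_nonneg_left h5 (by linarith : (0 : ℝ) ≤ c.bound)]

theorem smoothInd_eq_one (c : SmoothCutoff) {L : ℝ} (hL : 1 ≤ L) {w : κ → ℝ}
    (hw : ∀ k, w k ≤ 0) : smoothInd c L w = 1 := by
  refine c.eq_one _ (div_nonpos_of_nonpos_of_nonneg (sub_nonpos.2 ?_) (by linarith))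
  refine Real.log_le_log (expSum_pos w) ?_
  calc expSum w ≤ ∑ _k : κ, (1 : ℝ) :=
        Finset.sum_le_sum fun k _ => Real.exp_le_one_iff.2 (hw k)
    _ = Fintype.card κ := by simp

theorem le_log_expSum (w : κ → ℝ) (k : κ) : w k ≤ Real.log (expSum w) := by
  rw [Real.le_log_iff_exp_le (expSum_pos w)]
  exact Finset.single_le_sum (f := fun k => Real.exp (w k)) (fun _ _ => (Real.exp_pos _).le)
    (Finset.mem_univ k)

/-- Log-sum-exp dominates every coordinate. Once some w k exceeds 2L, subtracting log |κ| ≤ L leaves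
more than L, so the level exceeds 1 and the cutoff vanishes. -/
theorem smoothInd_le_indicator (c : SmoothCutoff) {L : ℝ} (hL : 1 ≤ L)
    (hLκ : Real.log (Fintype.card κ) ≤ L) (w : κ → ℝ) :
    smoothInd c L w ≤ {w : κ → ℝ | ∀ k, w k ≤ 2 * L}.indicator 1 w := by
  refine Set.le_indicator_apply (fun _ => smoothInd_le_one c L w) fun h => ?_
  rw [Set.mem_ofPred_eq] at h
  push Not at h
  obtain ⟨k, hk⟩ := h
  refine (c.eq_zero _ ?_).le
  rw [level, le_div_iff₀ (by linarith)]
  linarith [le_log_expSum w k]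

/-- Log-sum-exp lies between the maximum and the maximum plus log |κ|, so the band is a shell around
the boundary of the orthant. -/
theorem mem_band_one {L r : ℝ} (hLκ : Real.log (Fintype.card κ) ≤ L) {w : κ → ℝ}
    (hw : w ∈ band L r) : (∀ k, w k ≤ 2 * L + r) ∧ ∃ k, -r ≤ w k := by
  refine ⟨fun k => by linarith [le_log_expSum w k, hw.2], ?_⟩
  by_contra! h
  have h0 : Real.log (expSum w) < Real.log (Fintype.card κ) - r := by
    have e : expSum w < Real.exp (-r) * Fintype.card κ := by
      calc expSum w < ∑ _k : κ, Real.exp (-r) :=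
            Finset.sum_lt_sum_of_nonempty Finset.univ_nonempty
              fun k _ => Real.exp_lt_exp.2 (h k)
        _ = _ := by simp [mul_comm]
    have := Real.log_lt_log (expSum_pos w) e
    rw [Real.log_mul (Real.exp_pos _).ne' (by simp), Real.log_exp] at this
    linarith
  linarith [hw.1]

end

end

end HDCLT

/-! ### Exchanging one independent summand -/

namespace HDCLT

noncomputable section

variable {κ : Type*} [Fintype κ] [Nonempty κ]

/-- The partial derivatives of `smoothInd`. -/
def smoothIndGrad (c : SmoothCutoff) (L : ℝ) (k : κ) (w : κ → ℝ) : ℝ :=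
  c.g1 (level L w) / L * softmax w k

open Classical in
/-- The second partial derivatives of `smoothInd`. -/
def smoothIndHess (c : SmoothCutoff) (L : ℝ) (k l : κ) (w : κ → ℝ) : ℝ :=
  (c.g2 (level L w) / L ^ 2 - c.g1 (level L w) / L) * (softmax w k * softmax w l) +
    if k = l then c.g1 (level L w) / L * softmax w k else 0

theorem smoothInd1_eq_sum (c : SmoothCutoff) (L : ℝ) (w x : κ → ℝ) :
    smoothInd1 c L w x = ∑ k, smoothIndGrad c L k w * x k := by
  simp only [smoothInd1, softMoment, smoothIndGrad, pow_one, Finset.sum_div, Finset.mul_sum]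
  exact Finset.sum_congr rfl fun k _ => by ring

/-- As a quadratic form in x, the second-order term factors under independence into mean Hessian
entries times second moments of the summand, which agree for the two families. -/
theorem smoothInd2_eq_sum (c : SmoothCutoff) (L : ℝ) (w x : κ → ℝ) :
    smoothInd2 c L w x = ∑ k, ∑ l, smoothIndHess c L k l w * (x k * x l) := by
  have h1 : ∑ k, ∑ l, smoothIndHess c L k l w * (x k * x l) =
      (c.g2 (level L w) / L ^ 2 - c.g1 (level L w) / L) * softMoment 1 w x ^ 2 +
        c.g1 (level L w) / L * softMoment 2 w x := by
    simp only [smoothIndHess, add_mul, Finset.sum_add_distrib, ite_mul, zero_mul]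
    congr 1
    · rw [pow_two (softMoment 1 w x), softMoment, Finset.sum_mul_sum, Finset.mul_sum]
      refine Finset.sum_congr rfl fun k _ => ?_
      rw [Finset.mul_sum]
      exact Finset.sum_congr rfl fun l _ => by ring
    · rw [softMoment, Finset.mul_sum]
      refine Finset.sum_congr rfl fun k _ => ?_
      rw [Finset.sum_eq_single k (fun l _ hl => if_neg hl.symm)
        fun h => absurd (Finset.mem_univ k) h, if_pos rfl]
      ring
  rw [h1, smoothInd2]
  ring

theorem continuous_smoothInd (c : SmoothCutoff) (L : ℝ) :
    Continuous (smoothInd c L : (κ → ℝ) → ℝ) :=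
  c.continuous_g.comp (continuous_level L)

theorem continuous_smoothIndGrad (c : SmoothCutoff) (L : ℝ) (k : κ) :
    Continuous (smoothIndGrad c L k) :=
  ((c.continuous_g1.comp (continuous_level L)).div_const L).mul (continuous_softmax k)

theorem continuous_smoothIndHess (c : SmoothCutoff) (L : ℝ) (k l : κ) :
    Continuous (smoothIndHess c L k l) := by
  have h1 := c.continuous_g1.comp (continuous_level (κ := κ) L)
  have h2 := c.continuous_g2.comp (continuous_level (κ := κ) L)
  unfold smoothIndHess
  refine ((((h2.div_const _).sub (h1.div_const _))).mul
    ((continuous_softmax k).mul (continuous_softmax l))).add ?_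
  split_ifs
  · exact (h1.div_const L).mul (continuous_softmax k)
  · exact continuous_const

theorem abs_div_le_of_one_le {a b L : ℝ} (hL : 1 ≤ L) (h : |a| ≤ b) : |a / L| ≤ b := by
  rw [abs_div, abs_of_pos (by linarith : 0 < L)]
  exact (div_le_self (abs_nonneg _) hL).trans h

theorem abs_smoothIndGrad_le (c : SmoothCutoff) {L : ℝ} (hL : 1 ≤ L) (k : κ) (w : κ → ℝ) :
    |smoothIndGrad c L k w| ≤ c.bound := by
  have hb := c.one_le_bound
  rw [smoothIndGrad, abs_mul, abs_of_nonneg (softmax_nonneg w k)]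
  have := mul_le_mul (abs_div_le_of_one_le hL (c.abs_g1_le (level L w))) (softmax_le_one w k)
    (softmax_nonneg w k) (by linarith)
  linarith

theorem abs_smoothIndHess_le (c : SmoothCutoff) {L : ℝ} (hL : 1 ≤ L) (k l : κ) (w : κ → ℝ) :
    |smoothIndHess c L k l w| ≤ 3 * c.bound := by
  have hb := c.one_le_bound
  have h1 := abs_div_le_of_one_le hL (c.abs_g1_le (level L w))
  have h2 := abs_div_le_of_one_le (one_le_pow₀ hL (n := 2)) (c.abs_g2_le (level L w))
  have h3 : |c.g2 (level L w) / L ^ 2 - c.g1 (level L w) / L| ≤ 2 * c.bound :=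
    (abs_sub _ _).trans (by linarith)
  have h4 := mul_le_mul h3 (mul_le_one₀ (softmax_le_one w k) (softmax_nonneg w l)
    (softmax_le_one w l)) (mul_nonneg (softmax_nonneg w k) (softmax_nonneg w l)) (by linarith)
  have h5 := abs_smoothIndGrad_le c hL k w
  rw [smoothIndGrad] at h5
  rw [smoothIndHess]
  refine (abs_add_le _ _).trans ?_
  rw [abs_mul, abs_of_nonneg (mul_nonneg (softmax_nonneg w k) (softmax_nonneg w l))]
  split_ifs
  · linarith
  · rw [abs_zero]; linarith

section prob

variable {Ω : Type*} [MeasurableSpace Ω] {P : Measure Ω} [IsProbabilityMeasure P]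
  {V ξ η : Ω → κ → ℝ}

theorem integrable_of_bounded {f : Ω → ℝ} (hf : Measurable f) {C : ℝ} (h : ∀ ω, |f ω| ≤ C) :
    Integrable f P :=
  Integrable.of_bound hf.aestronglyMeasurable C (Filter.Eventually.of_forall h)

theorem integrable_eval_of_memLp (h3 : ∀ k, MemLp (fun ω => ξ ω k) 3 P) (k : κ) :
    Integrable (fun ω => ξ ω k) P :=
  (h3 k).integrable (by norm_num)

theorem integrable_mul_eval_of_memLp (h3 : ∀ k, MemLp (fun ω => ξ ω k) 3 P) (k l : κ) :
    Integrable (fun ω => ξ ω k * ξ ω l) P :=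
  MemLp.integrable_mul (p := 2) (q := 2) ((h3 k).mono_exponent (by norm_num))
    ((h3 l).mono_exponent (by norm_num))

theorem integrable_abs_pow_three_of_memLp (h3 : ∀ k, MemLp (fun ω => ξ ω k) 3 P) (k : κ) :
    Integrable (fun ω => |ξ ω k| ^ 3) P := by
  simpa using (h3 k).integrable_norm_pow (p := 3) (by norm_num)

theorem measurable_sqTail : Measurable (sqTail : (κ → ℝ) → ℝ) :=
  (by fun_prop : Measurable fun x : κ → ℝ => ‖x‖ ^ 2).indicator
    (measurableSet_lt measurable_const measurable_norm)

theorem sqTail_le_sum_sq (x : κ → ℝ) : sqTail x ≤ ∑ k, x k * x k := by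
  have h0 : 0 ≤ ∑ k, x k * x k := Finset.sum_nonneg fun k _ => mul_self_nonneg _
  refine Set.indicator_apply_le' (fun _ => ?_) fun _ => h0
  have : ‖x‖ ≤ Real.sqrt (∑ k, x k * x k) :=
    (pi_norm_le_iff_of_nonneg (Real.sqrt_nonneg _)).2 fun k => Real.le_sqrt_of_sq_le (by
      rw [Real.norm_eq_abs, sq_abs, pow_two]
      exact Finset.single_le_sum (f := fun k => x k * x k) (fun k _ => mul_self_nonneg _)
        (Finset.mem_univ k))
  calc ‖x‖ ^ 2 ≤ Real.sqrt (∑ k, x k * x k) ^ 2 := pow_le_pow_left₀ (norm_nonneg _) this 2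
    _ = _ := Real.sq_sqrt h0

theorem integrable_sqTail (hξ : Measurable ξ) (h3 : ∀ k, MemLp (fun ω => ξ ω k) 3 P) :
    Integrable (fun ω => sqTail (ξ ω)) P := by
  refine Integrable.mono' (integrable_finsetSum Finset.univ fun k _ =>
    integrable_mul_eval_of_memLp h3 k k) (measurable_sqTail.comp hξ).aestronglyMeasurable
    (Filter.Eventually.of_forall fun ω => ?_)
  rw [Real.norm_of_nonneg (sqTail_nonneg _)]
  exact sqTail_le_sum_sq _

theorem integrable_bdd_mul {f h : Ω → ℝ} (hf : Measurable f) {C : ℝ} (hC : ∀ ω, |f ω| ≤ C)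
    (hh : Integrable h P) : Integrable (fun ω => f ω * h ω) P :=
  hh.bdd_mul hf.aestronglyMeasurable (Filter.Eventually.of_forall hC)

theorem integral_comp_mul_comp_of_indepFun (hV : Measurable V) (hξ : Measurable ξ)
    (hind : IndepFun V ξ P) {a b : (κ → ℝ) → ℝ} (ha : Measurable a) (hb : Measurable b) :
    ∫ ω, a (V ω) * b (ξ ω) ∂P = (∫ ω, a (V ω) ∂P) * ∫ ω, b (ξ ω) ∂P :=
  hind.integral_fun_comp_mul_comp hV.aemeasurable hξ.aemeasurable ha.aestronglyMeasurable
    hb.aestronglyMeasurable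

theorem integrable_smoothInd1 (c : SmoothCutoff) {L : ℝ} (hL : 1 ≤ L) (hV : Measurable V)
    (h3 : ∀ k, MemLp (fun ω => ξ ω k) 3 P) :
    Integrable (fun ω => smoothInd1 c L (V ω) (ξ ω)) P := by
  simp only [smoothInd1_eq_sum]
  exact integrable_finsetSum _ fun k _ => integrable_bdd_mul
    ((continuous_smoothIndGrad c L k).measurable.comp hV) (fun ω => abs_smoothIndGrad_le c hL k _)
    (integrable_eval_of_memLp h3 k)

theorem integral_smoothInd1 (c : SmoothCutoff) {L : ℝ} (hL : 1 ≤ L) (hV : Measurable V)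
    (hξ : Measurable ξ) (hind : IndepFun V ξ P) (h3 : ∀ k, MemLp (fun ω => ξ ω k) 3 P) :
    ∫ ω, smoothInd1 c L (V ω) (ξ ω) ∂P =
      ∑ k, (∫ ω, smoothIndGrad c L k (V ω) ∂P) * ∫ ω, ξ ω k ∂P := by
  have hi : ∀ k, Integrable (fun ω => smoothIndGrad c L k (V ω) * ξ ω k) P := fun k =>
    integrable_bdd_mul ((continuous_smoothIndGrad c L k).measurable.comp hV)
      (fun ω => abs_smoothIndGrad_le c hL k _) (integrable_eval_of_memLp h3 k)
  simp only [smoothInd1_eq_sum]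
  rw [integral_finsetSum _ fun k _ => hi k]
  exact Finset.sum_congr rfl fun k _ => integral_comp_mul_comp_of_indepFun hV hξ hind
    (continuous_smoothIndGrad c L k).measurable (measurable_pi_apply k)

theorem integrable_smoothInd2 (c : SmoothCutoff) {L : ℝ} (hL : 1 ≤ L) (hV : Measurable V)
    (h3 : ∀ k, MemLp (fun ω => ξ ω k) 3 P) :
    Integrable (fun ω => smoothInd2 c L (V ω) (ξ ω)) P := by
  simp only [smoothInd2_eq_sum]
  exact integrable_finsetSum _ fun k _ => integrable_finsetSum _ fun l _ => integrable_bdd_mul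
    ((continuous_smoothIndHess c L k l).measurable.comp hV)
    (fun ω => abs_smoothIndHess_le c hL k l _) (integrable_mul_eval_of_memLp h3 k l)

theorem integral_smoothInd2 (c : SmoothCutoff) {L : ℝ} (hL : 1 ≤ L) (hV : Measurable V)
    (hξ : Measurable ξ) (hind : IndepFun V ξ P) (h3 : ∀ k, MemLp (fun ω => ξ ω k) 3 P) :
    ∫ ω, smoothInd2 c L (V ω) (ξ ω) ∂P =
      ∑ k, ∑ l, (∫ ω, smoothIndHess c L k l (V ω) ∂P) * ∫ ω, ξ ω k * ξ ω l ∂P := by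
  have hi : ∀ k l, Integrable (fun ω => smoothIndHess c L k l (V ω) * (ξ ω k * ξ ω l)) P :=
    fun k l => integrable_bdd_mul ((continuous_smoothIndHess c L k l).measurable.comp hV)
      (fun ω => abs_smoothIndHess_le c hL k l _) (integrable_mul_eval_of_memLp h3 k l)
  simp only [smoothInd2_eq_sum]
  rw [integral_finsetSum _ fun k _ => integrable_finsetSum _ fun l _ => hi k l]
  refine Finset.sum_congr rfl fun k _ => ?_
  rw [integral_finsetSum _ fun l _ => hi k l]
  exact Finset.sum_congr rfl fun l _ => integral_comp_mul_comp_of_indepFun hV hξ hind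
    (continuous_smoothIndHess c L k l).measurable
    ((measurable_pi_apply k).mul (measurable_pi_apply l))

theorem integrable_smoothInd (c : SmoothCutoff) (L : ℝ) {W : Ω → κ → ℝ} (hW : Measurable W) :
    Integrable (fun ω => smoothInd c L (W ω)) P :=
  integrable_of_bounded ((continuous_smoothInd c L).measurable.comp hW) (C := 1) fun ω => by
    rw [abs_of_nonneg (smoothInd_nonneg c L _)]
    exact smoothInd_le_one c L _

theorem integrable_smoothIndRem (c : SmoothCutoff) {L : ℝ} (hL : 1 ≤ L) (hV : Measurable V)
    (hξ : Measurable ξ) (h3 : ∀ k, MemLp (fun ω => ξ ω k) 3 P) :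
    Integrable (fun ω => smoothIndRem c L (V ω) (ξ ω)) P :=
  (((integrable_smoothInd c L (hV.add hξ)).sub (integrable_smoothInd c L hV)).sub
    (integrable_smoothInd1 c hL hV h3)).sub ((integrable_smoothInd2 c hL hV h3).div_const 2)

theorem integral_smoothInd_add (c : SmoothCutoff) {L : ℝ} (hL : 1 ≤ L) (hV : Measurable V)
    (hξ : Measurable ξ) (h3 : ∀ k, MemLp (fun ω => ξ ω k) 3 P) :
    ∫ ω, smoothInd c L (V ω + ξ ω) ∂P = ∫ ω, smoothInd c L (V ω) ∂P +
      ∫ ω, smoothInd1 c L (V ω) (ξ ω) ∂P + (∫ ω, smoothInd2 c L (V ω) (ξ ω) ∂P) / 2 +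
      ∫ ω, smoothIndRem c L (V ω) (ξ ω) ∂P := by
  have i0 := integrable_smoothInd (P := P) c L hV
  have i1 := integrable_smoothInd1 c hL hV h3
  have i2 := (integrable_smoothInd2 c hL hV h3).div_const 2
  have i3 := integrable_smoothIndRem c hL hV hξ h3
  have e1 := integral_add i0 i1
  have e2 : ∫ ω, smoothInd c L (V ω) + smoothInd1 c L (V ω) (ξ ω) +
      smoothInd2 c L (V ω) (ξ ω) / 2 ∂P = _ := integral_add (i0.add i1) i2
  have e3 : ∫ ω, smoothInd c L (V ω) + smoothInd1 c L (V ω) (ξ ω) +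
      smoothInd2 c L (V ω) (ξ ω) / 2 + smoothIndRem c L (V ω) (ξ ω) ∂P = _ :=
    integral_add ((i0.add i1).add i2) i3
  rw [← integral_div, ← e1, ← e2, ← e3]
  refine integral_congr_ae (Filter.Eventually.of_forall fun ω => ?_)
  simp only [smoothIndRem]
  ring

theorem integrable_bandWeight (L r : ℝ) (k : κ) {W : Ω → κ → ℝ} (hW : Measurable W) :
    Integrable (fun ω => bandWeight L r k (W ω)) P :=
  integrable_of_bounded ((measurable_bandWeight L r k).comp hW) (C := 1) fun ω => by
    rw [abs_of_nonneg (bandWeight_nonneg L r k _)]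
    exact bandWeight_le_one L r k _

/-- The weight depends on V only and the cube on ξ only, so independence separates them coordinate
by coordinate. -/
theorem integral_abs_smoothIndRem_le (c : SmoothCutoff) {L : ℝ} (hL : 1 ≤ L) (hV : Measurable V)
    (hξ : Measurable ξ) (hind : IndepFun V ξ P) (h3 : ∀ k, MemLp (fun ω => ξ ω k) 3 P) :
    |∫ ω, smoothIndRem c L (V ω) (ξ ω) ∂P| ≤
      13 * c.bound * Real.exp 2 / L *
        ∑ k, (∫ ω, bandWeight L 1 k (V ω) ∂P) * ∫ ω, |ξ ω k| ^ 3 ∂P +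
        4 * c.bound * ∫ ω, sqTail (ξ ω) ∂P := by
  have hi : ∀ k, Integrable (fun ω => bandWeight L 1 k (V ω) * |ξ ω k| ^ 3) P := fun k =>
    integrable_bdd_mul ((measurable_bandWeight L 1 k).comp hV) (C := 1)
      (fun ω => by rw [abs_of_nonneg (bandWeight_nonneg L 1 k _)]; exact bandWeight_le_one L 1 k _)
      (integrable_abs_pow_three_of_memLp h3 k)
  have hs := integrable_finsetSum Finset.univ fun k _ => hi k
  have hT := integrable_sqTail hξ h3
  refine abs_integral_le_integral_abs.trans ((integral_mono
    (integrable_smoothIndRem c hL hV hξ h3).abs ((hs.const_mul _).add (hT.const_mul _))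
    fun ω => abs_smoothIndRem_le c hL (V ω) (ξ ω)).trans (le_of_eq ?_))
  simp only [Pi.add_apply]
  rw [integral_add (hs.const_mul _) (hT.const_mul _), integral_const_mul, integral_const_mul,
    integral_finsetSum _ fun k _ => hi k]
  congr 2
  exact Finset.sum_congr rfl fun k _ => integral_comp_mul_comp_of_indepFun hV hξ hind
    (measurable_bandWeight L 1 k) ((measurable_pi_apply k).abs.pow_const 3)

/-- Restores the omitted summand. The event ‖ξ‖ ≤ 1 is independent of V and has probability at least
1/2, whence the factor 2. On it, adding ξ costs a factor exp 2 and widens the band from 1 to 2. -/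
theorem integral_bandWeight_le (L : ℝ) (k : κ) (hV : Measurable V) (hξ : Measurable ξ)
    (hind : IndepFun V ξ P) (h3 : ∀ k, MemLp (fun ω => ξ ω k) 3 P)
    (hT : ∫ ω, sqTail (ξ ω) ∂P ≤ 1 / 2) :
    ∫ ω, bandWeight L 1 k (V ω) ∂P ≤
      2 * Real.exp 2 * ∫ ω, bandWeight L 2 k (V ω + ξ ω) ∂P := by
  set I : (κ → ℝ) → ℝ := {x : κ → ℝ | ‖x‖ ≤ 1}.indicator 1 with hI
  have hIm : Measurable I :=
    measurable_one.indicator (measurableSet_le measurable_norm measurable_const)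
  have hI0 : ∀ x, 0 ≤ I x := fun x => Set.indicator_nonneg (fun _ _ => zero_le_one) x
  have hI1 : ∀ x, I x ≤ 1 := fun x => Set.indicator_apply_le' (fun _ => le_rfl) fun _ => zero_le_one
  have hIi : Integrable (fun ω => I (ξ ω)) P := integrable_of_bounded (hIm.comp hξ) (C := 1)
    fun ω => by rw [abs_of_nonneg (hI0 _)]; exact hI1 _
  -- Markov's inequality in the pointwise form 1 - `sqTail` x ≤ I x.
  have hhalf : 1 / 2 ≤ ∫ ω, I (ξ ω) ∂P := by
    have h1 : ∀ x, 1 - sqTail x ≤ I x := fun x => by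
      rcases le_or_gt ‖x‖ 1 with hx | hx
      · have : I x = 1 := Set.indicator_of_mem (by simpa using hx) _
        rw [this]; linarith [sqTail_nonneg x]
      · have : sqTail x = ‖x‖ ^ 2 := Set.indicator_of_mem (by simpa using hx) _
        have := one_le_pow₀ hx.le (n := 2)
        linarith [hI0 x]
    have := integral_mono ((integrable_const 1).sub (integrable_sqTail hξ h3)) hIi
      fun ω => h1 (ξ ω)
    simp only [Pi.sub_apply] at this
    rw [integral_sub (integrable_const 1) (integrable_sqTail hξ h3)] at this
    simp at this
    linarith
  have hU := integrable_bandWeight (P := P) L 1 k hV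
  have hU0 : 0 ≤ ∫ ω, bandWeight L 1 k (V ω) ∂P :=
    integral_nonneg fun ω => bandWeight_nonneg _ _ _ _
  have hmul := integral_comp_mul_comp_of_indepFun hV hξ hind (measurable_bandWeight L 1 k) hIm
  have hle : ∫ ω, bandWeight L 1 k (V ω) * I (ξ ω) ∂P ≤
      ∫ ω, Real.exp 2 * bandWeight L 2 k (V ω + ξ ω) ∂P := by
    refine integral_mono (integrable_bdd_mul ((measurable_bandWeight L 1 k).comp hV) (C := 1)
      (fun ω => by rw [abs_of_nonneg (bandWeight_nonneg L 1 k _)]; exact bandWeight_le_one L 1 k _)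
      hIi) ((integrable_bandWeight L 2 k (hV.add hξ)).const_mul _) fun ω => ?_
    by_cases hx : ‖ξ ω‖ ≤ 1
    · have : I (ξ ω) = 1 := Set.indicator_of_mem (by simpa using hx) _
      have h := bandWeight_le_add (L := L) (r := 1) (w := V ω) hx k
      simp only [this, mul_one]
      norm_num at h
      exact h
    · have : I (ξ ω) = 0 := Set.indicator_of_notMem (by simpa using hx) _
      simp only [this, mul_zero]
      exact mul_nonneg (Real.exp_pos _).le (bandWeight_nonneg _ _ _ _)
  rw [integral_const_mul, hmul] at hle
  nlinarith [mul_le_mul_of_nonneg_left hhalf hU0]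

/-- Replacing one independent summand by another with the same first two moments. -/
theorem abs_integral_smoothInd_sub_le (c : SmoothCutoff) {L : ℝ} (hL : 1 ≤ L) {ζ : Ω → κ → ℝ}
    (hV : Measurable V) (hξ : Measurable ξ) (hη : Measurable η) (hζ : ζ = ξ ∨ ζ = η)
    (hVξ : IndepFun V ξ P) (hVη : IndepFun V η P)
    (hξ3 : ∀ k, MemLp (fun ω => ξ ω k) 3 P) (hη3 : ∀ k, MemLp (fun ω => η ω k) 3 P)
    (hmean : ∀ k, ∫ ω, ξ ω k ∂P = ∫ ω, η ω k ∂P)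
    (hcov : ∀ k l, ∫ ω, ξ ω k * ξ ω l ∂P = ∫ ω, η ω k * η ω l ∂P)
    (hξT : ∫ ω, sqTail (ξ ω) ∂P ≤ 1 / 2) (hηT : ∫ ω, sqTail (η ω) ∂P ≤ 1 / 2) :
    |∫ ω, smoothInd c L (V ω + ξ ω) ∂P - ∫ ω, smoothInd c L (V ω + η ω) ∂P| ≤
      26 * c.bound * Real.exp 4 / L * ∑ k, (∫ ω, bandWeight L 2 k (V ω + ζ ω) ∂P) *
        (∫ ω, |ξ ω k| ^ 3 ∂P + ∫ ω, |η ω k| ^ 3 ∂P) +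
      4 * c.bound * (∫ ω, sqTail (ξ ω) ∂P + ∫ ω, sqTail (η ω) ∂P) := by
  have hb := c.one_le_bound
  have hL0 : 0 < L := by linarith
  -- ζ may be either summand, so the bound can be stated in terms of the sum containing whichever
  -- one is convenient.
  have hU : ∀ k, ∫ ω, bandWeight L 1 k (V ω) ∂P ≤
      2 * Real.exp 2 * ∫ ω, bandWeight L 2 k (V ω + ζ ω) ∂P := by
    rcases hζ with rfl | rfl
    · exact fun k => integral_bandWeight_le L k hV hξ hVξ hξ3 hξT
    · exact fun k => integral_bandWeight_le L k hV hη hVη hη3 hηT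
  have rξ := integral_abs_smoothIndRem_le c hL hV hξ hVξ hξ3
  have rη := integral_abs_smoothIndRem_le c hL hV hη hVη hη3
  rw [integral_smoothInd_add c hL hV hξ hξ3, integral_smoothInd_add c hL hV hη hη3,
    integral_smoothInd1 c hL hV hξ hVξ hξ3, integral_smoothInd1 c hL hV hη hVη hη3,
    integral_smoothInd2 c hL hV hξ hVξ hξ3, integral_smoothInd2 c hL hV hη hVη hη3]
  -- The terms of order zero, one and two are now identical on both sides; only the remainders
  -- survive.
  simp only [hmean, hcov]
  rw [add_sub_add_left_eq_sub]
  refine ((abs_sub _ _).trans (add_le_add rξ rη)).trans ?_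
  have key : ∑ k, (∫ ω, bandWeight L 1 k (V ω) ∂P) *
        (∫ ω, |ξ ω k| ^ 3 ∂P + ∫ ω, |η ω k| ^ 3 ∂P) ≤
      2 * Real.exp 2 * ∑ k, (∫ ω, bandWeight L 2 k (V ω + ζ ω) ∂P) *
        (∫ ω, |ξ ω k| ^ 3 ∂P + ∫ ω, |η ω k| ^ 3 ∂P) := by
    rw [Finset.mul_sum]
    refine Finset.sum_le_sum fun k _ => ?_
    rw [← mul_assoc]
    refine mul_le_mul_of_nonneg_right (hU k) (add_nonneg ?_ ?_) <;>
      exact integral_nonneg fun ω => by positivity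
  -- One factor exp 2 comes from the Taylor segment, the other from restoring the summand.
  have e4 : Real.exp 4 = Real.exp 2 * Real.exp 2 := by rw [← Real.exp_add]; norm_num
  have hA : 0 ≤ 13 * c.bound * Real.exp 2 / L := by positivity
  have := mul_le_mul_of_nonneg_left key hA
  simp only [mul_add, Finset.sum_add_distrib] at this ⊢
  rw [e4]
  refine le_trans (le_of_eq ?_) ((add_le_add_left this
    (4 * c.bound * ∫ ω, sqTail (ξ ω) ∂P + 4 * c.bound * ∫ ω, sqTail (η ω) ∂P)).trans
      (le_of_eq ?_)) <;> ring

end prob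

end

end HDCLT

/-! ### Interpolation along random subsets and the self-bounding comparison -/

namespace HDCLT

noncomputable section

section mixture

variable {ι : Type*} [DecidableEq ι]

/-- The mean of `Φ S` over the random subset `S` of `s` that contains each element independently
with probability `t`. -/
def subsetMean (s : Finset ι) (t : ℝ) (Φ : Finset ι → ℝ) : ℝ :=
  ∑ S ∈ s.powerset, (∏ i ∈ s, if i ∈ S then t else 1 - t) * Φ S

theorem subsetMean_empty (t : ℝ) (Φ : Finset ι → ℝ) : subsetMean ∅ t Φ = Φ ∅ := by
  simp [subsetMean]

/-- Conditioning on whether a belongs to the random subset; all later facts about `subsetMean`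
follow by induction from this. -/
theorem subsetMean_insert {a : ι} {s : Finset ι} (ha : a ∉ s) (t : ℝ) (Φ : Finset ι → ℝ) :
    subsetMean (insert a s) t Φ =
      (1 - t) * subsetMean s t Φ + t * subsetMean s t fun S => Φ (insert a S) := by
  have hS : ∀ S ∈ s.powerset, a ∉ S := fun S hS h => ha (Finset.mem_powerset.1 hS h)
  unfold subsetMean
  rw [Finset.sum_powerset_insert ha, Finset.mul_sum, Finset.mul_sum]
  congr 1 <;> refine Finset.sum_congr rfl fun S h => ?_ <;> rw [Finset.prod_insert ha]
  · rw [if_neg (hS S h), mul_assoc]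
  · rw [if_pos (Finset.mem_insert_self a S), mul_assoc]
    congr 2
    refine Finset.prod_congr rfl fun i hi => ?_
    have : i ≠ a := fun e => ha (e ▸ hi)
    simp [this]

theorem subsetMean_sub (s : Finset ι) (t : ℝ) (Φ Ψ : Finset ι → ℝ) :
    subsetMean s t (fun S => Φ S - Ψ S) = subsetMean s t Φ - subsetMean s t Ψ := by
  simp only [subsetMean, mul_sub, Finset.sum_sub_distrib]

theorem subsetMean_sum (s u : Finset ι) (t : ℝ) (Φ : ι → Finset ι → ℝ) :
    subsetMean s t (fun S => ∑ i ∈ u, Φ i S) = ∑ i ∈ u, subsetMean s t (Φ i) := by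
  simp only [subsetMean, Finset.mul_sum]
  exact Finset.sum_comm

theorem subsetMean_congr {s : Finset ι} {t : ℝ} {Φ Ψ : Finset ι → ℝ} (h : ∀ S ⊆ s, Φ S = Ψ S) :
    subsetMean s t Φ = subsetMean s t Ψ :=
  Finset.sum_congr rfl fun S hS => by rw [h S (Finset.mem_powerset.1 hS)]

theorem abs_subsetMean_le {K t : ℝ} (ht : t ∈ Set.Icc (0 : ℝ) 1) (s : Finset ι) :
    ∀ Φ : Finset ι → ℝ, (∀ S, |Φ S| ≤ K) → |subsetMean s t Φ| ≤ K := by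
  induction s using Finset.induction_on with
  | empty => exact fun Φ h => by rw [subsetMean_empty]; exact h ∅
  | insert a s ha ih =>
    intro Φ h
    rw [subsetMean_insert ha]
    refine (abs_add_le _ _).trans ?_
    rw [abs_mul, abs_mul, abs_of_nonneg ht.1, abs_of_nonneg (sub_nonneg.2 ht.2)]
    have h1 := mul_le_mul_of_nonneg_left (ih Φ h) (sub_nonneg.2 ht.2)
    have h2 := mul_le_mul_of_nonneg_left (ih (fun S => Φ (insert a S)) fun S => h _) ht.1
    linarith

theorem subsetMean_zero (s : Finset ι) : ∀ Φ : Finset ι → ℝ, subsetMean s 0 Φ = Φ ∅ := by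
  induction s using Finset.induction_on with
  | empty => exact fun Φ => subsetMean_empty 0 Φ
  | insert a s ha ih => exact fun Φ => by rw [subsetMean_insert ha, ih]; ring

theorem subsetMean_one (s : Finset ι) : ∀ Φ : Finset ι → ℝ, subsetMean s 1 Φ = Φ s := by
  induction s using Finset.induction_on with
  | empty => exact fun Φ => subsetMean_empty 1 Φ
  | insert a s ha ih => exact fun Φ => by rw [subsetMean_insert ha, ih, ih]; ring

/-- Russo's formula: the mean is multilinear in the inclusion probabilities, and its partial
derivative in the i-th one is the mean effect of flipping i. -/
theorem hasDerivAt_subsetMean (s : Finset ι) (t : ℝ) : ∀ Φ : Finset ι → ℝ,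
    HasDerivAt (fun t => subsetMean s t Φ)
      (∑ i ∈ s, subsetMean s t fun S => Φ (insert i S) - Φ (S.erase i)) t := by
  induction s using Finset.induction_on with
  | empty =>
    intro Φ
    simp only [subsetMean_empty, Finset.sum_empty]
    exact hasDerivAt_const t (Φ ∅)
  | insert a s ha ih =>
    intro Φ
    simp only [subsetMean_insert ha]
    have h1 := (((hasDerivAt_id t).const_sub 1).mul (ih Φ)).add
      ((hasDerivAt_id t).mul (ih fun S => Φ (insert a S)))
    refine h1.congr_deriv ?_
    rw [Finset.sum_insert ha, Finset.sum_add_distrib, ← Finset.mul_sum, ← Finset.mul_sum]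
    have e1 : subsetMean s t (fun S => Φ (insert a S) - Φ (S.erase a)) =
        subsetMean s t (fun S => Φ (insert a S)) - subsetMean s t Φ := by
      rw [← subsetMean_sub]
      exact subsetMean_congr fun S hS => by rw [Finset.erase_eq_of_notMem fun h => ha (hS h)]
    have e2 : subsetMean s t (fun S => Φ (insert a (insert a S)) - Φ ((insert a S).erase a)) =
        subsetMean s t (fun S => Φ (insert a S)) - subsetMean s t Φ := by
      rw [← subsetMean_sub]
      exact subsetMean_congr fun S hS => by
        rw [Finset.insert_idem, Finset.erase_insert fun h => ha (hS h)]
    have e3 : ∑ i ∈ s, subsetMean s t (fun S => Φ (insert a (insert i S)) -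
          Φ (insert a (S.erase i))) =
        ∑ i ∈ s, subsetMean s t (fun S => Φ (insert i (insert a S)) -
          Φ ((insert a S).erase i)) := by
      refine Finset.sum_congr rfl fun i hi => congrArg _ (funext fun S => ?_)
      have : a ≠ i := fun e => ha (e ▸ hi)
      rw [Finset.insert_comm, Finset.erase_insert_of_ne this]
    rw [e1, e2, e3]
    simp only [id]
    ring

/-- As t runs from 0 to 1 the mean passes from Φ ∅ to Φ s. Unlike in a fixed-order replacement, all
flips are summed around one and the same S, so the hypothesis can use a band probability that does
not depend on i. -/
theorem abs_sub_le_of_sum_abs_flip_le {K : ℝ} (Φ : Finset ι → ℝ) (s : Finset ι)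
    (h : ∀ S, ∑ i ∈ s, |Φ (insert i S) - Φ (S.erase i)| ≤ K) : |Φ s - Φ ∅| ≤ K := by
  have hd : ∀ t ∈ Set.Icc (0 : ℝ) 1,
      |∑ i ∈ s, subsetMean s t fun S => Φ (insert i S) - Φ (S.erase i)| ≤ K := fun t ht => by
    rw [← subsetMean_sum]
    exact abs_subsetMean_le ht s _ fun S => (Finset.abs_sum_le_sum_abs _ _).trans (h S)
  have := norm_image_sub_le_of_norm_deriv_le_segment' (a := (0 : ℝ)) (b := 1) (C := K)
    (fun t _ => (hasDerivAt_subsetMean s t Φ).hasDerivWithinAt)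
    (fun t ht => hd t (Set.Ico_subset_Icc_self ht)) 1 ⟨zero_le_one, le_rfl⟩
  rw [subsetMean_zero, subsetMean_one] at this
  simpa using this

end mixture

section comparison

variable {κ : Type*} [Fintype κ] [Nonempty κ] {ι : Type*} [Fintype ι] [DecidableEq ι]
  {Ω : Type*} [MeasurableSpace Ω] {P : Measure Ω} [IsProbabilityMeasure P]
  {ξ : ι × Bool → Ω → κ → ℝ}

/-- The sum in which the indices of `S` take the first and the others take the second family. -/
def mixedSum (ξ : ι × Bool → Ω → κ → ℝ) (S : Finset ι) (ω : Ω) : κ → ℝ :=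
  ∑ i, ξ (i, decide (i ∈ S)) ω

/-- `mixedSum` without the summand of index `i`. -/
def mixedSumErase (ξ : ι × Bool → Ω → κ → ℝ) (i : ι) (S : Finset ι) (ω : Ω) : κ → ℝ :=
  ∑ j ∈ Finset.univ.erase i, ξ (j, decide (j ∈ S)) ω

theorem mixedSum_eq_add (i : ι) (S : Finset ι) (ω : Ω) :
    mixedSum ξ S ω = mixedSumErase ξ i S ω + ξ (i, decide (i ∈ S)) ω :=
  (Finset.sum_erase_add _ _ (Finset.mem_univ i)).symm

theorem mixedSumErase_insert (i : ι) (S : Finset ι) (ω : Ω) :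
    mixedSumErase ξ i (insert i S) ω = mixedSumErase ξ i S ω :=
  Finset.sum_congr rfl fun j hj => by simp [Finset.ne_of_mem_erase hj]

theorem mixedSumErase_erase (i : ι) (S : Finset ι) (ω : Ω) :
    mixedSumErase ξ i (S.erase i) ω = mixedSumErase ξ i S ω :=
  Finset.sum_congr rfl fun j hj => by simp [Finset.ne_of_mem_erase hj]

theorem measurable_mixedSum (hm : ∀ a, Measurable (ξ a)) (S : Finset ι) :
    Measurable (mixedSum ξ S) :=
  Finset.measurable_fun_sum _ fun _ _ => hm _

theorem measurable_mixedSumErase (hm : ∀ a, Measurable (ξ a)) (i : ι) (S : Finset ι) :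
    Measurable (mixedSumErase ξ i S) :=
  Finset.measurable_fun_sum _ fun _ _ => hm _

/-- The selection of one family per index is altered at i to pick b. This leaves the erased sum
unchanged and makes ξ (i, b) a member of the selected independent family. -/
theorem indepFun_mixedSumErase (hm : ∀ a, Measurable (ξ a)) (hind : iIndepFun ξ P) (i : ι)
    (S : Finset ι) (b : Bool) : IndepFun (mixedSumErase ξ i S) (ξ (i, b)) P := by
  have hinj : Function.Injective fun j : ι => (j, if j = i then b else decide (j ∈ S)) :=
    fun _ _ h => (Prod.ext_iff.1 h).1
  have h := (hind.precomp hinj).indepFun_finsetSum_of_notMem (fun j => hm _)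
    (Finset.notMem_erase i Finset.univ)
  simp only [if_pos] at h
  convert h using 1
  funext ω
  rw [mixedSumErase, Finset.sum_apply]
  exact Finset.sum_congr rfl fun j hj => by simp [Finset.ne_of_mem_erase hj]

/-- The distribution function of `mixedSum`. -/
def mixedCdf (P : Measure Ω) (ξ : ι × Bool → Ω → κ → ℝ) (S : Finset ι) (y : κ → ℝ) : ℝ :=
  P.real {ω | ∀ k, mixedSum ξ S ω k ≤ y k}

theorem measurableSet_mixedSum_le (hm : ∀ a, Measurable (ξ a)) (S : Finset ι) (y : κ → ℝ) :
    MeasurableSet {ω | ∀ k, mixedSum ξ S ω k ≤ y k} :=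
  measurableSet_le (measurable_mixedSum hm S) measurable_const

theorem mixedCdf_le_integral (c : SmoothCutoff) {L : ℝ} (hL : 1 ≤ L)
    (hm : ∀ a, Measurable (ξ a)) (S : Finset ι) (y : κ → ℝ) :
    mixedCdf P ξ S y ≤ ∫ ω, smoothInd c L (mixedSum ξ S ω - y) ∂P := by
  rw [mixedCdf, ← integral_indicator_one (measurableSet_mixedSum_le hm S y)]
  refine integral_mono ((integrable_const 1).indicator (measurableSet_mixedSum_le hm S y))
    (integrable_smoothInd c L ((measurable_mixedSum hm S).sub_const y)) fun ω => ?_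
  refine Set.indicator_apply_le' (fun h => ?_) fun _ => smoothInd_nonneg c L _
  exact (smoothInd_eq_one c hL (w := mixedSum ξ S ω - y) fun k => sub_nonpos.2 (h k)).ge

theorem integral_le_mixedCdf (c : SmoothCutoff) {L : ℝ} (hL : 1 ≤ L)
    (hLκ : Real.log (Fintype.card κ) ≤ L) (hm : ∀ a, Measurable (ξ a)) (S : Finset ι)
    (y : κ → ℝ) : ∫ ω, smoothInd c L (mixedSum ξ S ω - y) ∂P ≤
      mixedCdf P ξ S fun k => y k + 2 * L := by
  rw [mixedCdf, ← integral_indicator_one (measurableSet_mixedSum_le hm S _)]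
  refine integral_mono (integrable_smoothInd c L ((measurable_mixedSum hm S).sub_const y))
    ((integrable_const 1).indicator (measurableSet_mixedSum_le hm S _)) fun ω => ?_
  refine (smoothInd_le_indicator c hL hLκ _).trans (le_of_eq ?_)
  have : (∀ k, (mixedSum ξ S ω - y) k ≤ 2 * L) ↔ ∀ k, mixedSum ξ S ω k ≤ y k + 2 * L :=
    forall_congr' fun k => by rw [Pi.sub_apply, sub_le_iff_le_add']
  by_cases h : ∀ k, mixedSum ξ S ω k ≤ y k + 2 * L
  · rw [Set.indicator_of_mem (s := {w : κ → ℝ | ∀ k, w k ≤ 2 * L}) (this.2 h),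
      Set.indicator_of_mem (s := {ω | ∀ k, mixedSum ξ S ω k ≤ y k + 2 * L}) h]
    rfl
  · rw [Set.indicator_of_notMem (s := {w : κ → ℝ | ∀ k, w k ≤ 2 * L}) fun h' => h (this.1 h'),
      Set.indicator_of_notMem (s := {ω | ∀ k, mixedSum ξ S ω k ≤ y k + 2 * L}) h]

/-- In the band of radius 2 the maximum of the shifted sum lies in [-2, 2L + 2]. Since L ≥ 1, this
is inside (-4L, 4L]. -/
theorem integral_band_le {L : ℝ} (hL : 1 ≤ L)
    (hLκ : Real.log (Fintype.card κ) ≤ L) (hm : ∀ a, Measurable (ξ a)) (S : Finset ι)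
    (y : κ → ℝ) : ∫ ω, (band L 2).indicator 1 (mixedSum ξ S ω - y) ∂P ≤
      mixedCdf P ξ S (fun k => y k + 4 * L) - mixedCdf P ξ S fun k => y k - 4 * L := by
  have m1 := measurableSet_mixedSum_le hm S fun k => y k + 4 * L
  have m2 := measurableSet_mixedSum_le hm S fun k => y k - 4 * L
  have i1 : Integrable ({ω | ∀ k, mixedSum ξ S ω k ≤ y k + 4 * L}.indicator (1 : Ω → ℝ)) P :=
    (integrable_const 1).indicator m1
  have i2 : Integrable ({ω | ∀ k, mixedSum ξ S ω k ≤ y k - 4 * L}.indicator (1 : Ω → ℝ)) P :=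
    (integrable_const 1).indicator m2
  rw [mixedCdf, mixedCdf, ← integral_indicator_one m1, ← integral_indicator_one m2,
    ← integral_sub i1 i2]
  refine integral_mono (integrable_of_bounded ((measurable_one.indicator
    (measurableSet_band L 2)).comp ((measurable_mixedSum hm S).sub_const y)) (C := 1)
    fun ω => ?_) (i1.sub i2) fun ω => ?_
  · by_cases h : mixedSum ξ S ω - y ∈ band L 2 <;> simp [h]
  · refine Set.indicator_apply_le' (fun h => ?_) fun _ => ?_
    · obtain ⟨h1, k, hk⟩ := mem_band_one hLκ h
      have a1 : ω ∈ {ω | ∀ k, mixedSum ξ S ω k ≤ y k + 4 * L} := fun k => by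
        have := h1 k
        rw [Pi.sub_apply] at this
        linarith
      have a2 : ω ∉ {ω | ∀ k, mixedSum ξ S ω k ≤ y k - 4 * L} := fun h => by
        have := h k
        rw [Pi.sub_apply] at hk
        linarith
      rw [Set.indicator_of_mem a1, Set.indicator_of_notMem a2]
      simp
    · refine sub_nonneg.2 (Set.indicator_le_indicator_of_subset (fun ω h k => ?_)
        (fun _ => zero_le_one) ω)
      have := h k
      linarith

/-- Two families of random vectors that are jointly independent, with finite third moments and the
same first and second moments. -/
structure IsMatched (P : Measure Ω) (ξ : ι × Bool → Ω → κ → ℝ) : Prop where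
  measurable : ∀ a, Measurable (ξ a)
  indep : iIndepFun ξ P
  memLp : ∀ a k, MemLp (fun ω => ξ a ω k) 3 P
  mean : ∀ i k, ∫ ω, ξ (i, true) ω k ∂P = ∫ ω, ξ (i, false) ω k ∂P
  cov : ∀ i k l, ∫ ω, ξ (i, true) ω k * ξ (i, true) ω l ∂P =
    ∫ ω, ξ (i, false) ω k * ξ (i, false) ω l ∂P

/-- ζ is taken to be the summand that S actually selects at i, so the bound involves the law of
`mixedSum ξ S` itself, the same for every i. -/
theorem abs_integral_smoothInd_flip_le (c : SmoothCutoff) {L : ℝ} (hL : 1 ≤ L)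
    (h : IsMatched P ξ) (hT : ∀ a, ∫ ω, sqTail (ξ a ω) ∂P ≤ 1 / 2) (i : ι) (S : Finset ι)
    (y : κ → ℝ) :
    |∫ ω, smoothInd c L (mixedSum ξ (insert i S) ω - y) ∂P -
      ∫ ω, smoothInd c L (mixedSum ξ (S.erase i) ω - y) ∂P| ≤
      26 * c.bound * Real.exp 4 / L *
        ∑ k, (∫ ω, bandWeight L 2 k (mixedSum ξ S ω - y) ∂P) *
          (∫ ω, |ξ (i, true) ω k| ^ 3 ∂P + ∫ ω, |ξ (i, false) ω k| ^ 3 ∂P) +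
      4 * c.bound * (∫ ω, sqTail (ξ (i, true) ω) ∂P + ∫ ω, sqTail (ξ (i, false) ω) ∂P) := by
  have hV : Measurable fun ω => mixedSumErase ξ i S ω - y :=
    (measurable_mixedSumErase h.measurable i S).sub_const y
  have hI : ∀ b, IndepFun (fun ω => mixedSumErase ξ i S ω - y) (ξ (i, b)) P := fun b =>
    (indepFun_mixedSumErase h.measurable h.indep i S b).comp
      (measurable_id.sub_const y) measurable_id
  have key := abs_integral_smoothInd_sub_le c hL (ζ := ξ (i, decide (i ∈ S))) hV
    (h.measurable _) (h.measurable _) (by by_cases hi : i ∈ S <;> simp [hi]) (hI true) (hI false)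
    (h.memLp _) (h.memLp _) (h.mean i) (h.cov i) (hT _) (hT _)
  have e1 : ∀ ω, mixedSum ξ (insert i S) ω - y =
      mixedSumErase ξ i S ω - y + ξ (i, true) ω := fun ω => by
    rw [mixedSum_eq_add i, mixedSumErase_insert]
    simp only [Finset.mem_insert_self, decide_true]
    abel
  have e2 : ∀ ω, mixedSum ξ (S.erase i) ω - y =
      mixedSumErase ξ i S ω - y + ξ (i, false) ω := fun ω => by
    rw [mixedSum_eq_add i, mixedSumErase_erase]
    simp only [Finset.notMem_erase, decide_false]
    abel
  have e3 : ∀ ω, mixedSum ξ S ω - y =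
      mixedSumErase ξ i S ω - y + ξ (i, decide (i ∈ S)) ω := fun ω => by
    rw [mixedSum_eq_add i]
    abel
  simp only [e1, e2, e3]
  exact key

/-- Because the weights do not depend on i, the third moments can be summed over i first, for each
coordinate k. The weights then add up over k to the band probability, so Λ is a maximum over
coordinates and not a sum. -/
theorem sum_abs_integral_smoothInd_flip_le (c : SmoothCutoff) {L Λ τ : ℝ} (hL : 1 ≤ L)
    (hLκ : Real.log (Fintype.card κ) ≤ L) (h : IsMatched P ξ)
    (hT : ∀ a, ∫ ω, sqTail (ξ a ω) ∂P ≤ 1 / 2)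
    (hΛ : ∀ k, ∑ i, (∫ ω, |ξ (i, true) ω k| ^ 3 ∂P + ∫ ω, |ξ (i, false) ω k| ^ 3 ∂P) ≤ Λ)
    (hτ : ∑ i, (∫ ω, sqTail (ξ (i, true) ω) ∂P + ∫ ω, sqTail (ξ (i, false) ω) ∂P) ≤ τ)
    (s S : Finset ι) (y : κ → ℝ) :
    ∑ i ∈ s, |∫ ω, smoothInd c L (mixedSum ξ (insert i S) ω - y) ∂P -
      ∫ ω, smoothInd c L (mixedSum ξ (S.erase i) ω - y) ∂P| ≤
      26 * c.bound * Real.exp 4 / L * (Λ * (mixedCdf P ξ S (fun k => y k + 4 * L) -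
        mixedCdf P ξ S fun k => y k - 4 * L)) + 4 * c.bound * τ := by
  have hb := c.one_le_bound
  have hL0 : 0 < L := by linarith
  have hA : 0 ≤ 26 * c.bound * Real.exp 4 / L := by positivity
  set e : ι → κ → ℝ := fun i k =>
    ∫ ω, |ξ (i, true) ω k| ^ 3 ∂P + ∫ ω, |ξ (i, false) ω k| ^ 3 ∂P with he
  set u : κ → ℝ := fun k => ∫ ω, bandWeight L 2 k (mixedSum ξ S ω - y) ∂P with hu
  have hu0 : ∀ k, 0 ≤ u k := fun k => integral_nonneg fun ω => bandWeight_nonneg _ _ _ _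
  have he0 : ∀ i k, 0 ≤ e i k := fun i k =>
    add_nonneg (integral_nonneg fun ω => by positivity) (integral_nonneg fun ω => by positivity)
  have hΛ0 : 0 ≤ Λ :=
    (Finset.sum_nonneg fun i _ => he0 i (Classical.arbitrary κ)).trans (hΛ _)
  have husum : ∑ k, u k = ∫ ω, (band L 2).indicator 1 (mixedSum ξ S ω - y) ∂P := by
    rw [hu, ← integral_finsetSum _ fun k _ => integrable_bandWeight L 2 k
      ((measurable_mixedSum h.measurable S).sub_const y)]
    simp only [sum_bandWeight]
  calc ∑ i ∈ s, |∫ ω, smoothInd c L (mixedSum ξ (insert i S) ω - y) ∂P -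
      ∫ ω, smoothInd c L (mixedSum ξ (S.erase i) ω - y) ∂P|
      ≤ ∑ i, |∫ ω, smoothInd c L (mixedSum ξ (insert i S) ω - y) ∂P -
      ∫ ω, smoothInd c L (mixedSum ξ (S.erase i) ω - y) ∂P| :=
        Finset.sum_le_sum_of_subset_of_nonneg (Finset.subset_univ s) fun _ _ _ => abs_nonneg _
    _ ≤ ∑ i, (26 * c.bound * Real.exp 4 / L * ∑ k, u k * e i k + 4 * c.bound *
          (∫ ω, sqTail (ξ (i, true) ω) ∂P + ∫ ω, sqTail (ξ (i, false) ω) ∂P)) :=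
        Finset.sum_le_sum fun i _ => abs_integral_smoothInd_flip_le c hL h hT i S y
    _ = 26 * c.bound * Real.exp 4 / L * ∑ k, u k * ∑ i, e i k + 4 * c.bound *
          ∑ i, (∫ ω, sqTail (ξ (i, true) ω) ∂P + ∫ ω, sqTail (ξ (i, false) ω) ∂P) := by
        rw [Finset.sum_add_distrib, ← Finset.mul_sum, ← Finset.mul_sum, Finset.sum_comm]
        simp only [Finset.mul_sum]
    _ ≤ 26 * c.bound * Real.exp 4 / L * ∑ k, u k * Λ + 4 * c.bound * τ := by
        have := hu0
        gcongr with k _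
        · exact hu0 k
        · exact hΛ k
    _ ≤ _ := by
        rw [← Finset.sum_mul, husum, mul_comm _ Λ]
        have := integral_band_le (P := P) hL hLκ h.measurable S y
        gcongr

/-- If a third moment bound is small and the second family has an anti-concentrated sum, then the
distribution functions of the sums of the two families are uniformly close. -/
theorem abs_mixedCdf_sub_le (c : SmoothCutoff) {L Λ τ N : ℝ} (hL : 1 ≤ L)
    (hLκ : Real.log (Fintype.card κ) ≤ L) (h : IsMatched P ξ)
    (hΛ : ∀ k, ∑ i, (∫ ω, |ξ (i, true) ω k| ^ 3 ∂P + ∫ ω, |ξ (i, false) ω k| ^ 3 ∂P) ≤ Λ)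
    (hτ : ∑ i, (∫ ω, sqTail (ξ (i, true) ω) ∂P + ∫ ω, sqTail (ξ (i, false) ω) ∂P) ≤ τ)
    (hτ2 : τ ≤ 1 / 2) (hΛL : 26 * c.bound * Real.exp 4 / L * Λ ≤ 1 / 4)
    (hN : ∀ (y : κ → ℝ) (ε : ℝ), 0 < ε →
      mixedCdf P ξ ∅ (fun k => y k + ε) - mixedCdf P ξ ∅ y ≤ N * ε)
    (S : Finset ι) (y : κ → ℝ) :
    |mixedCdf P ξ S y - mixedCdf P ξ ∅ y| ≤ 12 * L * N + 8 * c.bound * τ := by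
  have hb := c.one_le_bound
  have hL0 : 0 < L := by linarith
  have hT0 : ∀ a, 0 ≤ ∫ ω, sqTail (ξ a ω) ∂P := fun a =>
    integral_nonneg fun ω => sqTail_nonneg _
  have hT : ∀ a, ∫ ω, sqTail (ξ a ω) ∂P ≤ 1 / 2 := by
    rintro ⟨i, b⟩
    have h1 := Finset.single_le_sum (f := fun i => ∫ ω, sqTail (ξ (i, true) ω) ∂P +
      ∫ ω, sqTail (ξ (i, false) ω) ∂P) (fun i _ => add_nonneg (hT0 _) (hT0 _))
      (Finset.mem_univ i)
    cases b
    · linarith [hT0 (i, true)]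
    · linarith [hT0 (i, false)]
  have hΛ0 : 0 ≤ Λ := (Finset.sum_nonneg fun i _ => add_nonneg
    (integral_nonneg fun ω => by positivity) (integral_nonneg fun ω => by positivity)).trans
      (hΛ (Classical.arbitrary κ))
  set A := 26 * c.bound * Real.exp 4 / L * Λ with hA
  have hA0 : 0 ≤ A := by positivity
  set F := mixedCdf P ξ with hF
  have hF0 : ∀ S y, 0 ≤ F S y := fun S y => measureReal_nonneg
  have hF1 : ∀ S y, F S y ≤ 1 := fun S y => measureReal_le_one
  have hbdd : BddAbove (Set.range fun a : Finset ι × (κ → ℝ) => |F a.1 a.2 - F ∅ a.2|) := by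
    refine ⟨1, ?_⟩
    rintro _ ⟨a, rfl⟩
    exact abs_sub_le_iff.2 ⟨by linarith [hF0 ∅ a.2, hF1 a.1 a.2],
      by linarith [hF0 a.1 a.2, hF1 ∅ a.2]⟩
  -- The supremum runs over all subsets, because the flip bound at S involves the distribution
  -- function of the mixed sum of S.
  set r := ⨆ a : Finset ι × (κ → ℝ), |F a.1 a.2 - F ∅ a.2| with hr
  have hle : ∀ S y, |F S y - F ∅ y| ≤ r := fun S y => le_ciSup hbdd (S, y)
  set K := A * (8 * L * N + 2 * r) + 4 * c.bound * τ with hK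
  have hsmooth : ∀ S y, |∫ ω, smoothInd c L (mixedSum ξ S ω - y) ∂P -
      ∫ ω, smoothInd c L (mixedSum ξ ∅ ω - y) ∂P| ≤ K := by
    intro s y
    refine abs_sub_le_of_sum_abs_flip_le
      (fun S => ∫ ω, smoothInd c L (mixedSum ξ S ω - y) ∂P) s fun S => ?_
    refine (sum_abs_integral_smoothInd_flip_le c hL hLκ h hT hΛ hτ s S y).trans ?_
    rw [← mul_assoc, ← hA, hK]
    gcongr
    -- Replacing S by ∅ at both ends of the band costs 2r; the family at ∅ then pays N times the
    -- width 8L.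
    have h1 := abs_le.1 (hle S fun k => y k + 4 * L)
    have h2 := abs_le.1 (hle S fun k => y k - 4 * L)
    have h3 := hN (fun k => y k - 4 * L) (8 * L) (by linarith)
    have e : (fun k => y k - 4 * L + 8 * L) = fun k => y k + 4 * L := by funext k; ring
    rw [e] at h3
    linarith [h1.2, h2.1]
  -- The smooth function lies between the orthants at y and at y + 2L. Smoothing at y gives the
  -- upper bound, smoothing at y - 2L the lower one.
  have hmain : ∀ S y, |F S y - F ∅ y| ≤ 2 * L * N + K := by
    intro S y
    have u1 := mixedCdf_le_integral (P := P) c hL h.measurable S y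
    have u2 := integral_le_mixedCdf (P := P) c hL hLκ h.measurable ∅ y
    have u3 := (abs_le.1 (hsmooth S y)).2
    have u4 := hN y (2 * L) (by linarith)
    have v1 := integral_le_mixedCdf (P := P) c hL hLκ h.measurable S fun k => y k - 2 * L
    have v2 := mixedCdf_le_integral (P := P) c hL h.measurable ∅ fun k => y k - 2 * L
    have v3 := (abs_le.1 (hsmooth S fun k => y k - 2 * L)).1
    have v4 := hN (fun k => y k - 2 * L) (2 * L) (by linarith)
    have e : (fun k => y k - 2 * L + 2 * L) = y := by funext k; ring
    rw [e] at v1 v4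
    exact abs_sub_le_iff.2 ⟨by linarith, by linarith⟩
  have hr2 : r ≤ 2 * L * N + K := ciSup_le fun a => hmain a.1 a.2
  have hr0 : 0 ≤ r := (abs_nonneg _).trans (hle ∅ y)
  have hN0 : 0 ≤ N := by
    have h1 := hN y 1 one_pos
    have h2 : F ∅ y ≤ F ∅ fun k => y k + 1 :=
      measureReal_mono (fun ω hω k => (hω k).trans (by linarith)) (measure_ne_top _ _)
    linarith
  -- Here r enters with total coefficient 1/2, so it can be moved to the left of `hr2`.
  have hK2 : K ≤ 1 / 4 * (8 * L * N + 2 * r) + 4 * c.bound * τ := by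
    rw [hK]
    gcongr
  have hLN := mul_nonneg hL0.le hN0
  refine (hle S y).trans ?_
  linarith

end comparison

end

end HDCLT

/-! ### Nazarov's anti-concentration inequality -/

namespace HDCLT

noncomputable section

/-- The density ratio is exp(-xv - v²/2). On S one has xv ≤ 1, and v ≤ 1. -/
theorem gaussianReal_le_shift {S : Set ℝ} (hS : MeasurableSet S) {H v : ℝ} (hH : 0 ≤ H)
    (hSH : ∀ x ∈ S, x ≤ H + 1) (hv : 0 ≤ v) (hvH : v * (H + 1) ≤ 1) :
    ENNReal.ofReal (Real.exp (-(3 / 2))) * gaussianReal 0 1 S ≤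
      gaussianReal 0 1 ((fun x => x - v) ⁻¹' S) := by
  rw [← Measure.map_apply (by fun_prop) hS, gaussianReal_map_sub_const,
    gaussianReal_apply _ one_ne_zero, gaussianReal_apply _ one_ne_zero,
    ← lintegral_const_mul _ (measurable_gaussianPDF 0 1)]
  refine setLIntegral_mono' hS fun x hx => ?_
  rw [gaussianPDF, gaussianPDF, ← ENNReal.ofReal_mul (Real.exp_pos _).le]
  refine ENNReal.ofReal_le_ofReal ?_
  simp only [gaussianPDFReal]
  rw [mul_left_comm, ← Real.exp_add]
  refine mul_le_mul_of_nonneg_left (Real.exp_le_exp.2 ?_) (by positivity)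
  have hx' := mul_le_mul_of_nonneg_left (hSH x hx) hv
  have hv1 : v ≤ 1 := by nlinarith
  have hv2 : v ^ 2 ≤ 1 := pow_le_one₀ hv hv1
  simp only [NNReal.coe_one]
  nlinarith

/-- The translates of the slice by kδ are disjoint and, U being an up-set, stay in U ∩ (y, ∞). There
are at least 1/((H+1)δ) of them with kδ(H+1) ≤ 1, and each keeps a fraction exp(-3/2) of the mass of
the slice. -/
theorem gaussianReal_upset_inter_Ioc_le {U : Set ℝ} (hU : MeasurableSet U)
    (hup : ∀ x ∈ U, ∀ x', x ≤ x' → x' ∈ U) {y H δ : ℝ} (hH : 0 ≤ H) (hy : y ≤ H) (hδ : 0 < δ)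
    (hδH : δ * (H + 1) ≤ 1) :
    gaussianReal 0 1 (U ∩ Set.Ioc y (y + δ)) ≤
      ENNReal.ofReal (Real.exp (3 / 2) * ((H + 1) * δ)) * gaussianReal 0 1 (U ∩ Set.Ioi y) := by
  set S := U ∩ Set.Ioc y (y + δ) with hS
  have hSm : MeasurableSet S := hU.inter measurableSet_Ioc
  set a := (H + 1) * δ with ha
  have ha0 : 0 < a := mul_pos (by linarith) hδ
  set m := ⌈1 / a⌉₊ with hm
  have hδ1 : δ ≤ 1 := by nlinarith
  have hshift : ∀ k ∈ Finset.range m, ENNReal.ofReal (Real.exp (-(3 / 2))) * gaussianReal 0 1 S ≤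
      gaussianReal 0 1 ((fun x => x - k * δ) ⁻¹' S) := by
    intro k hk
    refine gaussianReal_le_shift hSm hH (fun x hx => by linarith [hx.2.2])
      (by positivity) ?_
    have := (Nat.lt_ceil.1 (Finset.mem_range.1 hk)).le
    rw [le_div_iff₀ ha0] at this
    linarith
  have hdisj : Set.PairwiseDisjoint (Finset.range m : Set ℕ)
      fun k : ℕ => (fun x : ℝ => x - k * δ) ⁻¹' S := by
    have key : ∀ k l : ℕ, k < l → ∀ x : ℝ, x - k * δ ∈ S → x - l * δ ∉ S := by
      intro k l hkl x hk hl
      have h1 := hk.2.2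
      have h2 := hl.2.1
      have : (k : ℝ) + 1 ≤ l := by exact_mod_cast hkl
      nlinarith
    intro k _ l _ hkl
    refine Set.disjoint_left.2 fun x hx hx' => ?_
    rcases lt_or_gt_of_ne hkl with h | h
    · exact key k l h x hx hx'
    · exact key l k h x hx' hx
  have hsub : (⋃ k ∈ Finset.range m, (fun x : ℝ => x - k * δ) ⁻¹' S) ⊆ U ∩ Set.Ioi y := by
    refine Set.iUnion₂_subset fun k _ x hx => ?_
    have hk : 0 ≤ (k : ℝ) * δ := by positivity
    refine ⟨hup _ hx.1 _ (by linarith), ?_⟩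
    have := hx.2.1
    exact Set.mem_Ioi.2 (by linarith)
  have h1 : (m : ENNReal) * (ENNReal.ofReal (Real.exp (-(3 / 2))) * gaussianReal 0 1 S) ≤
      gaussianReal 0 1 (U ∩ Set.Ioi y) := by
    calc _ = ∑ _k ∈ Finset.range m,
          ENNReal.ofReal (Real.exp (-(3 / 2))) * gaussianReal 0 1 S := by
          rw [Finset.sum_const, Finset.card_range, nsmul_eq_mul]
      _ ≤ ∑ k ∈ Finset.range m, gaussianReal 0 1 ((fun x : ℝ => x - k * δ) ⁻¹' S) :=
          Finset.sum_le_sum hshift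
      _ = gaussianReal 0 1 (⋃ k ∈ Finset.range m, (fun x : ℝ => x - k * δ) ⁻¹' S) :=
          (measure_biUnion_finset hdisj fun k _ =>
            (by fun_prop : Measurable fun x : ℝ => x - k * δ) hSm).symm
      _ ≤ _ := measure_mono hsub
  have h2 : ENNReal.ofReal (1 / a) ≤ m := by
    rw [← ENNReal.ofReal_natCast]
    exact ENNReal.ofReal_le_ofReal (Nat.le_ceil _)
  calc gaussianReal 0 1 S
      = ENNReal.ofReal (Real.exp (3 / 2) * a) *
          (ENNReal.ofReal (1 / a) * (ENNReal.ofReal (Real.exp (-(3 / 2))) *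
            gaussianReal 0 1 S)) := by
        rw [← mul_assoc, ← mul_assoc, ← ENNReal.ofReal_mul (by positivity),
          ← ENNReal.ofReal_mul (by positivity)]
        have : Real.exp (3 / 2) * a * (1 / a) * Real.exp (-(3 / 2)) = 1 := by
          rw [mul_assoc (Real.exp (3 / 2)), mul_one_div_cancel ha0.ne', mul_one, ← Real.exp_add]
          simp
        rw [this, ENNReal.ofReal_one, one_mul]
    _ ≤ _ := by
        gcongr
        exact (mul_le_mul_left h2 _).trans h1

theorem gaussianReal_Ioc_le {H y δ : ℝ} (hH : 0 ≤ H) (hy : H ≤ y) (hδ : 0 ≤ δ) :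
    gaussianReal 0 1 (Set.Ioc y (y + δ)) ≤ ENNReal.ofReal (δ * Real.exp (-(H ^ 2 / 2))) := by
  rw [gaussianReal_apply _ one_ne_zero]
  calc ∫⁻ x in Set.Ioc y (y + δ), gaussianPDF 0 1 x
      ≤ ∫⁻ _x in Set.Ioc y (y + δ), ENNReal.ofReal (Real.exp (-(H ^ 2 / 2))) := by
        refine setLIntegral_mono' measurableSet_Ioc fun x hx => ENNReal.ofReal_le_ofReal ?_
        have hxH : H ≤ x := hy.trans hx.1.le
        have h1 : (Real.sqrt (2 * Real.pi * (1 : NNReal)))⁻¹ ≤ 1 := by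
          refine inv_le_one_of_one_le₀ ?_
          rw [Real.one_le_sqrt]
          simp only [NNReal.coe_one]
          linarith [Real.pi_gt_three]
        simp only [gaussianPDFReal]
        refine (mul_le_mul_of_nonneg_right h1 (Real.exp_pos _).le).trans ?_
        rw [one_mul]
        refine Real.exp_le_exp.2 ?_
        simp only [NNReal.coe_one]
        nlinarith
    _ = _ := by
        rw [setLIntegral_const, Real.volume_Ioc, mul_comm, ← ENNReal.ofReal_mul (by linarith)]
        congr 1
        ring

section nazarov

variable {κ : Type*} [Fintype κ]

/-- The points at which the coordinate `j` is the first to attain the maximum of `w - y`. -/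
def firstArgmax (y : κ → ℝ) (j : κ) : Set (κ → ℝ) :=
  {w | ∀ k, w k - y k ≤ w j - y j ∧
    (Fintype.equivFin κ k < Fintype.equivFin κ j → w k - y k < w j - y j)}

theorem measurableSet_firstArgmax (y : κ → ℝ) (j : κ) : MeasurableSet (firstArgmax y j) := by
  have : firstArgmax y j = ⋂ k, ({w | w k - y k ≤ w j - y j} ∩
      {w | Fintype.equivFin κ k < Fintype.equivFin κ j → w k - y k < w j - y j}) := by
    ext w
    simp [firstArgmax]
  rw [this]
  refine MeasurableSet.iInter fun k => (measurableSet_le (by fun_prop) (by fun_prop)).inter ?_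
  by_cases h : Fintype.equivFin κ k < Fintype.equivFin κ j
  · simp only [h, true_imp_iff]
    exact measurableSet_lt (by fun_prop) (by fun_prop)
  · simp [h]

/-- Ties can have positive probability, since the covariance may be singular; breaking them by index
gives exact disjointness. -/
theorem disjoint_firstArgmax (y : κ → ℝ) {i j : κ} (h : i ≠ j) :
    Disjoint (firstArgmax y i) (firstArgmax y j) := by
  refine Set.disjoint_left.2 fun w hi hj => ?_
  rcases lt_or_gt_of_ne fun e => h ((Fintype.equivFin κ).injective e) with h' | h'
  · exact absurd ((hj i).2 h') (not_lt.2 (hi j).1)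
  · exact absurd ((hi j).2 h') (not_lt.2 (hj i).1)

theorem exists_mem_firstArgmax [Nonempty κ] (y w : κ → ℝ) : ∃ j, w ∈ firstArgmax y j := by
  classical
  obtain ⟨j0, -, hj0⟩ := Finset.exists_max_image Finset.univ (fun k => w k - y k)
    Finset.univ_nonempty
  obtain ⟨j, hj, hmin⟩ := Finset.exists_min_image
    (Finset.univ.filter fun k => w j0 - y j0 ≤ w k - y k) (Fintype.equivFin κ)
    ⟨j0, by simp⟩
  rw [Finset.mem_filter] at hj
  refine ⟨j, fun k => ⟨(hj0 k (Finset.mem_univ k)).trans hj.2, fun hlt => ?_⟩⟩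
  by_contra! hge
  exact absurd hlt (not_lt.2 (hmin k
    (Finset.mem_filter.2 ⟨Finset.mem_univ k, hj.2.trans hge⟩)))

variable {μ : Measure (κ → ℝ)} [IsGaussian μ]

theorem memLp_eval_of_isGaussian (k : κ) : MemLp (fun x : κ → ℝ => x k) 2 μ := by
  have h : HasGaussianLaw (fun x : κ → ℝ => x) μ := IsGaussian.hasGaussianLaw_id
  exact (h.eval k).memLp_two

/-- Expand Var(x_k - x_j) ≥ 0. -/
theorem covariance_le_one_of_variance_eq_one (hvar : ∀ k, Var[fun x : κ → ℝ => x k; μ] = 1)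
    (j k : κ) : cov[fun x : κ → ℝ => x k, fun x => x j; μ] ≤ 1 := by
  have h := variance_fun_sub (memLp_eval_of_isGaussian (μ := μ) k)
    (memLp_eval_of_isGaussian (μ := μ) j)
  have h0 := variance_nonneg (fun x : κ → ℝ => x k - x j) μ
  rw [h, hvar, hvar] at h0
  linarith

theorem map_eval_eq_gaussianReal (hmean : ∀ k, ∫ x, x k ∂μ = 0)
    (hvar : ∀ k, Var[fun x : κ → ℝ => x k; μ] = 1) (j : κ) :
    μ.map (fun x => x j) = gaussianReal 0 1 := by
  have h : HasGaussianLaw (fun x : κ → ℝ => x) μ := IsGaussian.hasGaussianLaw_id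
  rw [(h.eval j).map_eq_gaussianReal, hmean, hvar, Real.toNNReal_one]

/-- Decomposition of a Gaussian vector into a coordinate and an independent remainder. -/
theorem map_eval_prodMk_residual (hmean : ∀ k, ∫ x, x k ∂μ = 0)
    (hvar : ∀ k, Var[fun x : κ → ℝ => x k; μ] = 1) (j : κ) :
    μ.map (fun x => (x j, fun k => x k - cov[fun x : κ → ℝ => x k, fun x => x j; μ] * x j)) =
      (gaussianReal 0 1).prod
        (μ.map fun x k => x k - cov[fun x : κ → ℝ => x k, fun x => x j; μ] * x j) := by
  set c : κ → ℝ := fun k => cov[fun x : κ → ℝ => x k, fun x => x j; μ] with hc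
  have h : HasGaussianLaw (fun x : κ → ℝ => x) μ := IsGaussian.hasGaussianLaw_id
  let A : (κ → ℝ) →L[ℝ] (Unit → ℝ) × (κ → ℝ) :=
    (ContinuousLinearMap.pi fun _ => ContinuousLinearMap.proj j).prod
      (ContinuousLinearMap.pi fun k =>
        ContinuousLinearMap.proj k - c k • ContinuousLinearMap.proj j)
  have hA : HasGaussianLaw (fun x : κ → ℝ => ((fun _ : Unit => x j), fun k => x k - c k * x j))
      μ := h.map_fun A
  have hind := hA.indepFun_of_covariance_eval fun _ k => by
    have mk := memLp_eval_of_isGaussian (μ := μ) k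
    have mj := memLp_eval_of_isGaussian (μ := μ) j
    rw [covariance_comm, covariance_fun_sub_left mk (mj.const_mul _) mj,
      covariance_const_mul_left, covariance_self (measurable_pi_apply j).aemeasurable, hvar]
    simp [hc]
  have hind2 : IndepFun (fun x : κ → ℝ => x j) (fun x k => x k - c k * x j) μ :=
    hind.comp (measurable_pi_apply ()) measurable_id
  rw [(indepFun_iff_map_prod_eq_prod_map_map (measurable_pi_apply j).aemeasurable
    (by fun_prop : Measurable fun (x : κ → ℝ) k => x k - c k * x j).aemeasurable).1 hind2,
    map_eval_eq_gaussianReal hmean hvar j]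

/-- Fix the residual, which is independent of x_j. Raising x_j raises every other x_k by c_k ≤ 1
times as much, so j remains the first argmax: the fibre is an up-set and the one-dimensional bound
applies. Unit variances are what gives c_k ≤ 1. -/
theorem measure_firstArgmax_inter_Ioc_le (hmean : ∀ k, ∫ x, x k ∂μ = 0)
    (hvar : ∀ k, Var[fun x : κ → ℝ => x k; μ] = 1) (y : κ → ℝ) (j : κ) {H δ : ℝ} (hH : 0 ≤ H)
    (hy : y j ≤ H) (hδ : 0 < δ) (hδH : δ * (H + 1) ≤ 1) :
    μ (firstArgmax y j ∩ {x | x j ∈ Set.Ioc (y j) (y j + δ)}) ≤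
      ENNReal.ofReal (Real.exp (3 / 2) * ((H + 1) * δ)) *
        μ (firstArgmax y j ∩ {x | x j ∈ Set.Ioi (y j)}) := by
  set c : κ → ℝ := fun k => cov[fun x : κ → ℝ => x k, fun x => x j; μ] with hc
  have hc1 : ∀ k, c k ≤ 1 := covariance_le_one_of_variance_eq_one hvar j
  have hcj : c j = 1 := by rw [hc]; simp only; rw [covariance_self (measurable_pi_apply j).aemeasurable, hvar]
  set G : Set (ℝ × (κ → ℝ)) := {q | (fun k => q.2 k + c k * q.1) ∈ firstArgmax y j} with hG
  have hGm : MeasurableSet G :=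
    (by fun_prop : Measurable fun q : ℝ × (κ → ℝ) => fun k => q.2 k + c k * q.1)
      (measurableSet_firstArgmax y j)
  have hup : ∀ v : κ → ℝ, ∀ z ∈ (fun z => (z, v)) ⁻¹' G, ∀ z', z ≤ z' →
      z' ∈ (fun z => (z, v)) ⁻¹' G := by
    intro v z hz z' hzz k
    have h1 := hz k
    have h2 : c k * (z' - z) ≤ z' - z := mul_le_of_le_one_left (by linarith) (hc1 k)
    simp only [hcj] at h1 ⊢
    exact ⟨by linarith [h1.1], fun h => by linarith [h1.2 h]⟩
  set F : (κ → ℝ) → ℝ × (κ → ℝ) := fun x => (x j, fun k => x k - c k * x j) with hF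
  have hFm : Measurable F := by fun_prop
  have hmap : μ.map F = (gaussianReal 0 1).prod (μ.map fun x k => x k - c k * x j) :=
    map_eval_prodMk_residual hmean hvar j
  have hpre : ∀ I : Set ℝ, firstArgmax y j ∩ {x | x j ∈ I} = F ⁻¹' (G ∩ Prod.fst ⁻¹' I) := by
    intro I
    ext x
    simp [hF, hG]
  have hval : ∀ I : Set ℝ, MeasurableSet I → μ (firstArgmax y j ∩ {x | x j ∈ I}) =
      ∫⁻ v, gaussianReal 0 1 ((fun z => (z, v)) ⁻¹' G ∩ I)
        ∂(μ.map fun x k => x k - c k * x j) := by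
    intro I hI
    have hm : MeasurableSet (G ∩ Prod.fst ⁻¹' I) := hGm.inter (measurable_fst hI)
    have : SFinite (μ.map fun x k => x k - c k * x j) := inferInstance
    rw [hpre, ← Measure.map_apply hFm hm, hmap, Measure.prod_apply_symm hm]
    rfl
  rw [hval _ measurableSet_Ioc, hval _ measurableSet_Ioi, ← lintegral_const_mul']
  · refine lintegral_mono fun v => gaussianReal_upset_inter_Ioc_le
      ((by fun_prop : Measurable fun z : ℝ => (z, v)) hGm) (hup v) hH hy hδ hδH
  · exact ENNReal.ofReal_ne_top

/-- Nazarov's inequality for unit variances. -/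
theorem nazarov_of_variance_eq_one [Nonempty κ] (hmean : ∀ k, ∫ x, x k ∂μ = 0)
    (hvar : ∀ k, Var[fun x : κ → ℝ => x k; μ] = 1) {H : ℝ} (hH : 0 ≤ H)
    (hκ : Fintype.card κ * Real.exp (-(H ^ 2 / 2)) ≤ 1) (y : κ → ℝ) {δ : ℝ} (hδ : 0 < δ) :
    μ.real {x | ∀ k, x k ≤ y k + δ} - μ.real {x | ∀ k, x k ≤ y k} ≤ 6 * (H + 1) * δ := by
  classical
  -- For δ(H + 1) > 1 the right side exceeds 1.
  rcases lt_or_ge 1 (δ * (H + 1)) with hbig | hsmall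
  · have h1 : μ.real {x | ∀ k, x k ≤ y k + δ} ≤ 1 := measureReal_le_one
    have h2 : 0 ≤ μ.real {x | ∀ k, x k ≤ y k} := measureReal_nonneg
    nlinarith
  have hm : ∀ y : κ → ℝ, MeasurableSet {x : κ → ℝ | ∀ k, x k ≤ y k} := fun y =>
    measurableSet_le measurable_id measurable_const
  set E := {x : κ → ℝ | ∀ k, x k ≤ y k + δ} \ {x | ∀ k, x k ≤ y k} with hE
  have hdiff : μ.real {x | ∀ k, x k ≤ y k + δ} - μ.real {x | ∀ k, x k ≤ y k} = μ.real E := by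
    rw [hE, measureReal_sdiff (fun x hx k => (hx k).trans (by linarith)) (hm y)]
  rw [hdiff]
  set K := Real.exp (3 / 2) * ((H + 1) * δ) with hK
  have hK0 : 0 ≤ K := by positivity
  set J := Finset.univ.filter fun j => y j ≤ H with hJ
  -- Coordinates with threshold at most H are handled by the disjoint argmax sets, whose masses add
  -- up to at most one. Those with a higher threshold need only a union bound, since the density
  -- there is at most exp(-H²/2).
  have hcover : E ⊆ (⋃ j ∈ J, firstArgmax y j ∩ {x | x j ∈ Set.Ioc (y j) (y j + δ)}) ∪
      ⋃ j ∈ Finset.univ \ J, {x | x j ∈ Set.Ioc (y j) (y j + δ)} := by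
    intro x hx
    obtain ⟨j, hj⟩ := exists_mem_firstArgmax y x
    have hlt : y j < x j := by
      by_contra! hle
      exact hx.2 fun k => by linarith [(hj k).1]
    have hI : x j ∈ Set.Ioc (y j) (y j + δ) := ⟨hlt, hx.1 j⟩
    by_cases hjJ : j ∈ J
    · exact Or.inl (Set.mem_biUnion hjJ ⟨hj, hI⟩)
    · exact Or.inr (Set.mem_biUnion (Finset.mem_sdiff.2 ⟨Finset.mem_univ j, hjJ⟩) hI)
  have hmI : ∀ j : κ, ∀ I : Set ℝ, MeasurableSet I → MeasurableSet {x : κ → ℝ | x j ∈ I} :=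
    fun j I hI => measurable_pi_apply j hI
  have h1 : μ (⋃ j ∈ J, firstArgmax y j ∩ {x | x j ∈ Set.Ioc (y j) (y j + δ)}) ≤
      ENNReal.ofReal K := by
    refine (measure_biUnion_finset_le J _).trans ?_
    calc ∑ j ∈ J, μ (firstArgmax y j ∩ {x | x j ∈ Set.Ioc (y j) (y j + δ)})
        ≤ ∑ j ∈ J, ENNReal.ofReal K * μ (firstArgmax y j ∩ {x | x j ∈ Set.Ioi (y j)}) :=
          Finset.sum_le_sum fun j hj => measure_firstArgmax_inter_Ioc_le hmean hvar y j hH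
            (Finset.mem_filter.1 hj).2 hδ hsmall
      _ = ENNReal.ofReal K * μ (⋃ j ∈ J, firstArgmax y j ∩ {x | x j ∈ Set.Ioi (y j)}) := by
          rw [← Finset.mul_sum, measure_biUnion_finset]
          · exact fun i _ j _ hij => (disjoint_firstArgmax y hij).mono Set.inter_subset_left
              Set.inter_subset_left
          · exact fun j _ => (measurableSet_firstArgmax y j).inter (hmI j _ measurableSet_Ioi)
      _ ≤ ENNReal.ofReal K * 1 := by gcongr; exact prob_le_one
      _ = _ := mul_one _
  have h2 : μ (⋃ j ∈ Finset.univ \ J, {x | x j ∈ Set.Ioc (y j) (y j + δ)}) ≤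
      ENNReal.ofReal δ := by
    refine (measure_biUnion_finset_le _ _).trans ?_
    calc ∑ j ∈ Finset.univ \ J, μ {x | x j ∈ Set.Ioc (y j) (y j + δ)}
        ≤ ∑ _j ∈ Finset.univ \ J, ENNReal.ofReal (δ * Real.exp (-(H ^ 2 / 2))) := by
          refine Finset.sum_le_sum fun j hj => ?_
          have hyj : H ≤ y j := by
            have := (Finset.mem_sdiff.1 hj).2
            rw [hJ, Finset.mem_filter] at this
            push Not at this
            exact (this (Finset.mem_univ j)).le
          have := gaussianReal_Ioc_le hH hyj hδ.le
          rwa [← map_eval_eq_gaussianReal hmean hvar j,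
            Measure.map_apply (measurable_pi_apply j) measurableSet_Ioc] at this
      _ ≤ ∑ _j : κ, ENNReal.ofReal (δ * Real.exp (-(H ^ 2 / 2))) :=
          Finset.sum_le_sum_of_subset Finset.sdiff_subset
      _ = ENNReal.ofReal (δ * (Fintype.card κ * Real.exp (-(H ^ 2 / 2)))) := by
          rw [Finset.sum_const, Finset.card_univ, nsmul_eq_mul, ← ENNReal.ofReal_natCast,
            ← ENNReal.ofReal_mul (by positivity)]
          congr 1
          ring
      _ ≤ _ := ENNReal.ofReal_le_ofReal (mul_le_of_le_one_right hδ.le hκ)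
  have h3 : μ E ≤ ENNReal.ofReal (K + δ) := by
    rw [ENNReal.ofReal_add hK0 hδ.le]
    exact (measure_mono hcover).trans ((measure_union_le _ _).trans (add_le_add h1 h2))
  have h4 : μ.real E ≤ K + δ := ENNReal.toReal_le_of_le_ofReal (by positivity) h3
  -- The constant 6 is 5 from the low thresholds plus 1 from the high ones.
  have h5 : Real.exp (3 / 2) ≤ 5 := by
    have e1 := Real.exp_one_lt_d9
    have : Real.exp (3 / 2) ^ 2 = Real.exp 1 ^ 3 := by
      rw [← Real.exp_nat_mul, ← Real.exp_nat_mul]; norm_num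
    have h3 : Real.exp 1 ^ 3 ≤ 2.72 ^ 3 :=
      pow_le_pow_left₀ (Real.exp_pos _).le (by linarith) 3
    nlinarith [Real.exp_pos (3 / 2)]
  have h6 : 0 ≤ (H + 1) * δ := by positivity
  have h7 : K ≤ 5 * ((H + 1) * δ) := mul_le_mul_of_nonneg_right h5 h6
  nlinarith

/-- Nazarov's inequality: a Gaussian vector whose coordinates have variance at least `b` is
anti-concentrated. -/
theorem nazarov [Nonempty κ] (hmean : ∀ k, ∫ x, x k ∂μ = 0) {b : ℝ} (hb : 0 < b)
    (hvar : ∀ k, b ≤ Var[fun x : κ → ℝ => x k; μ]) {H : ℝ} (hH : 0 ≤ H)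
    (hκ : Fintype.card κ * Real.exp (-(H ^ 2 / 2)) ≤ 1) (y : κ → ℝ) {δ : ℝ} (hδ : 0 < δ) :
    μ.real {x | ∀ k, x k ≤ y k + δ} - μ.real {x | ∀ k, x k ≤ y k} ≤
      6 * (H + 1) * (δ / Real.sqrt b) := by
  -- Standardising coordinate k turns the shift δ into δ/σ_k ≤ δ/√b.
  set σ : κ → ℝ := fun k => Real.sqrt Var[fun x : κ → ℝ => x k; μ] with hσ
  have hσb : ∀ k, Real.sqrt b ≤ σ k := fun k => Real.sqrt_le_sqrt (hvar k)
  have hb0 : 0 < Real.sqrt b := Real.sqrt_pos.2 hb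
  have hσ0 : ∀ k, 0 < σ k := fun k => hb0.trans_le (hσb k)
  let A : (κ → ℝ) →L[ℝ] (κ → ℝ) :=
    ContinuousLinearMap.pi fun k => (σ k)⁻¹ • ContinuousLinearMap.proj k
  have hA : ∀ x k, A x k = (σ k)⁻¹ * x k := fun x k => rfl
  have hAm : Measurable A := A.measurable
  have : IsGaussian (μ.map A) := inferInstance
  have hmean' : ∀ k, ∫ x, x k ∂(μ.map A) = 0 := fun k => by
    rw [integral_map hAm.aemeasurable (measurable_pi_apply k).aestronglyMeasurable]
    simp only [hA]
    rw [integral_const_mul, hmean, mul_zero]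
  have hvar' : ∀ k, Var[fun x : κ → ℝ => x k; μ.map A] = 1 := fun k => by
    rw [variance_map (measurable_pi_apply k).aemeasurable hAm.aemeasurable]
    have : (fun x : κ → ℝ => x k) ∘ A = fun x => (σ k)⁻¹ * x k := rfl
    rw [this, variance_const_mul, inv_pow, Real.sq_sqrt (variance_nonneg _ _)]
    exact inv_mul_cancel₀ (lt_of_lt_of_le hb (hvar k)).ne'
  have hN := nazarov_of_variance_eq_one hmean' hvar' hH hκ (fun k => (σ k)⁻¹ * y k)
    (div_pos hδ hb0)
  have hm : ∀ y : κ → ℝ, MeasurableSet {x : κ → ℝ | ∀ k, x k ≤ y k} := fun y =>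
    measurableSet_le measurable_id measurable_const
  rw [map_measureReal_apply hAm (hm _), map_measureReal_apply hAm (hm _)] at hN
  have e1 : A ⁻¹' {x | ∀ k, x k ≤ (σ k)⁻¹ * y k} = {x | ∀ k, x k ≤ y k} := by
    ext x
    exact forall_congr' fun k => by
      rw [hA]
      exact mul_le_mul_iff_right₀ (inv_pos.2 (hσ0 k))
  have e2 : {x : κ → ℝ | ∀ k, x k ≤ y k + δ} ⊆
      A ⁻¹' {x | ∀ k, x k ≤ (σ k)⁻¹ * y k + δ / Real.sqrt b} := by
    intro x hx k
    have h1 : (σ k)⁻¹ * x k ≤ (σ k)⁻¹ * (y k + δ) :=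
      mul_le_mul_of_nonneg_left (hx k) (inv_pos.2 (hσ0 k)).le
    have h2 : (σ k)⁻¹ * δ ≤ δ / Real.sqrt b := by
      rw [inv_mul_eq_div]
      exact div_le_div_of_nonneg_left hδ.le hb0 (hσb k)
    rw [hA]
    linarith
  rw [e1] at hN
  have := measureReal_mono (μ := μ) e2
  linarith

end nazarov

end

end HDCLT

/-! ### Passing to a common space; rectangles as orthants -/

namespace HDCLT

noncomputable section

section transfer

variable {Ω₁ Ω₂ E : Type*} [MeasurableSpace Ω₁] [MeasurableSpace Ω₂] [MeasurableSpace E]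
  {P₁ : Measure Ω₁} {P₂ : Measure Ω₂} {m : Measure E} {Z₁ : Ω₁ → E} {Z₂ : Ω₂ → E}

theorem integral_comp_eq_of_hasLaw (h₁ : HasLaw Z₁ m P₁) (h₂ : HasLaw Z₂ m P₂) {g : E → ℝ}
    (hg : Measurable g) : ∫ ω, g (Z₁ ω) ∂P₁ = ∫ ω, g (Z₂ ω) ∂P₂ :=
  (h₁.integral_comp hg.aestronglyMeasurable).trans
    (h₂.integral_comp hg.aestronglyMeasurable).symm

theorem memLp_comp_iff_of_hasLaw (h₁ : HasLaw Z₁ m P₁) (h₂ : HasLaw Z₂ m P₂) {g : E → ℝ}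
    (hg : Measurable g) (q : ENNReal) :
    MemLp (fun ω => g (Z₁ ω)) q P₁ ↔ MemLp (fun ω => g (Z₂ ω)) q P₂ := by
  have e₁ := memLp_map_measure_iff (p := q) (μ := P₁) (f := Z₁) (g := g)
    hg.aestronglyMeasurable h₁.aemeasurable
  have e₂ := memLp_map_measure_iff (p := q) (μ := P₂) (f := Z₂) (g := g)
    hg.aestronglyMeasurable h₂.aemeasurable
  rw [h₁.map_eq] at e₁
  rw [h₂.map_eq] at e₂
  exact e₁.symm.trans e₂

theorem measureReal_eq_of_hasLaw (h₁ : HasLaw Z₁ m P₁) (h₂ : HasLaw Z₂ m P₂) {s : Set E}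
    (hs : MeasurableSet s) : P₁.real {ω | Z₁ ω ∈ s} = P₂.real {ω | Z₂ ω ∈ s} :=
  (h₁.measureReal_eq (p := fun x => x ∈ s) hs).trans
    (h₂.measureReal_eq (p := fun x => x ∈ s) hs).symm

end transfer

section comparison

variable {κ : Type*} [Fintype κ] [Nonempty κ] {ι : Type*} [Fintype ι] [DecidableEq ι]
  {Ω Ω' : Type*} [MeasurableSpace Ω] [MeasurableSpace Ω'] {P : Measure Ω} {P' : Measure Ω'}
  [IsProbabilityMeasure P] [IsProbabilityMeasure P'] {X : ι → Ω → κ → ℝ} {Y : ι → Ω' → κ → ℝ}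

/-- Comparison of the distribution functions of two sums of independent random vectors with the
same first and second moments. -/
theorem abs_cdf_sum_sub_le (c : SmoothCutoff) {L Λ τ N : ℝ} (hL : 1 ≤ L)
    (hLκ : Real.log (Fintype.card κ) ≤ L)
    (hX : ∀ i, AEMeasurable (X i) P) (hY : ∀ i, AEMeasurable (Y i) P')
    (iX : iIndepFun X P) (iY : iIndepFun Y P')
    (mX : ∀ i k, MemLp (fun ω => X i ω k) 3 P) (mY : ∀ i k, MemLp (fun ω => Y i ω k) 3 P')
    (hmean : ∀ i k, ∫ ω, X i ω k ∂P = ∫ ω, Y i ω k ∂P')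
    (hcov : ∀ i k l, ∫ ω, X i ω k * X i ω l ∂P = ∫ ω, Y i ω k * Y i ω l ∂P')
    (hΛ : ∀ k, ∑ i, (∫ ω, |X i ω k| ^ 3 ∂P + ∫ ω, |Y i ω k| ^ 3 ∂P') ≤ Λ)
    (hτ : ∑ i, (∫ ω, sqTail (X i ω) ∂P + ∫ ω, sqTail (Y i ω) ∂P') ≤ τ)
    (hτ2 : τ ≤ 1 / 2) (hΛL : 26 * c.bound * Real.exp 4 / L * Λ ≤ 1 / 4)
    (hN : ∀ (y : κ → ℝ) (ε : ℝ), 0 < ε →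
      P'.real {ω | ∀ k, (∑ i, Y i ω) k ≤ y k + ε} - P'.real {ω | ∀ k, (∑ i, Y i ω) k ≤ y k} ≤
        N * ε) (y : κ → ℝ) :
    |P.real {ω | ∀ k, (∑ i, X i ω) k ≤ y k} - P'.real {ω | ∀ k, (∑ i, Y i ω) k ≤ y k}| ≤
      12 * L * N + 8 * c.bound * τ := by
  -- The two families live on unrelated spaces, while the exchange needs them jointly independent.
  -- Only the laws of the separate sums matter, so independent copies are taken on a product space.
  let law : ι × Bool → Measure (κ → ℝ) := fun a => cond a.2 (P.map (X a.1)) (P'.map (Y a.1))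
  have hlaw : ∀ a, IsProbabilityMeasure (law a) := by
    rintro ⟨i, b⟩
    cases b
    · exact Measure.isProbabilityMeasure_map (hY i)
    · exact Measure.isProbabilityMeasure_map (hX i)
  let π : Measure (ι × Bool → κ → ℝ) := Measure.pi law
  let ξ : ι × Bool → (ι × Bool → κ → ℝ) → κ → ℝ := fun a ω => ω a
  have hξm : ∀ a, Measurable (ξ a) := fun a => measurable_pi_apply a
  have hξ : ∀ a, HasLaw (ξ a) (law a) π := fun a =>
    ⟨(hξm a).aemeasurable, (measurePreserving_eval law a).map_eq⟩
  have hX' : ∀ i, HasLaw (X i) (law (i, true)) P := fun i => ⟨hX i, rfl⟩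
  have hY' : ∀ i, HasLaw (Y i) (law (i, false)) P' := fun i => ⟨hY i, rfl⟩
  have iξ : iIndepFun ξ π :=
    iIndepFun_pi (X := fun _ x => x) fun _ => measurable_id.aemeasurable
  have hk : ∀ k, Measurable fun x : κ → ℝ => x k := fun k => measurable_pi_apply k
  have tX : ∀ {g : (κ → ℝ) → ℝ}, Measurable g → ∀ i,
      ∫ ω, g (ξ (i, true) ω) ∂π = ∫ ω, g (X i ω) ∂P := fun hg i =>
    integral_comp_eq_of_hasLaw (hξ _) (hX' i) hg
  have tY : ∀ {g : (κ → ℝ) → ℝ}, Measurable g → ∀ i,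
      ∫ ω, g (ξ (i, false) ω) ∂π = ∫ ω, g (Y i ω) ∂P' := fun hg i =>
    integral_comp_eq_of_hasLaw (hξ _) (hY' i) hg
  have hmatch : IsMatched π ξ := by
    refine ⟨hξm, iξ, ?_, fun i k => ?_, fun i k l => ?_⟩
    · rintro ⟨i, b⟩ k
      cases b
      · exact (memLp_comp_iff_of_hasLaw (hξ (i, false)) (hY' i) (hk k) 3).2 (mY i k)
      · exact (memLp_comp_iff_of_hasLaw (hξ (i, true)) (hX' i) (hk k) 3).2 (mX i k)
    · rw [tX (hk k), tY (hk k), hmean]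
    · rw [tX (g := fun x => x k * x l) ((hk k).mul (hk l)),
        tY (g := fun x => x k * x l) ((hk k).mul (hk l)), hcov]
  have hsum : Measurable fun z : ι → κ → ℝ => ∑ i, z i :=
    Finset.measurable_fun_sum _ fun i _ => measurable_pi_apply i
  have hm : ∀ y : κ → ℝ, MeasurableSet {z : ι → κ → ℝ | ∀ k, (∑ i, z i) k ≤ y k} := fun y =>
    measurableSet_le hsum measurable_const
  have sX : ∀ y, mixedCdf π ξ Finset.univ y = P.real {ω | ∀ k, (∑ i, X i ω) k ≤ y k} := by
    intro y
    have inj : Function.Injective fun i : ι => (i, true) := fun _ _ h => (Prod.ext_iff.1 h).1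
    have h1 : HasLaw (fun ω i => ξ (i, true) ω) (Measure.pi fun i => law (i, true)) π :=
      (iξ.precomp inj).hasLaw_pi fun i => hξ (i, true)
    have h2 : HasLaw (fun ω i => X i ω) (Measure.pi fun i => law (i, true)) P :=
      iX.hasLaw_pi hX'
    simpa [mixedCdf, mixedSum] using measureReal_eq_of_hasLaw h1 h2 (hm y)
  have sY : ∀ y, mixedCdf π ξ ∅ y = P'.real {ω | ∀ k, (∑ i, Y i ω) k ≤ y k} := by
    intro y
    have inj : Function.Injective fun i : ι => (i, false) := fun _ _ h => (Prod.ext_iff.1 h).1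
    have h1 : HasLaw (fun ω i => ξ (i, false) ω) (Measure.pi fun i => law (i, false)) π :=
      (iξ.precomp inj).hasLaw_pi fun i => hξ (i, false)
    have h2 : HasLaw (fun ω i => Y i ω) (Measure.pi fun i => law (i, false)) P' :=
      iY.hasLaw_pi hY'
    simpa [mixedCdf, mixedSum] using measureReal_eq_of_hasLaw h1 h2 (hm y)
  have key := abs_mixedCdf_sub_le c hL hLκ hmatch (Λ := Λ) (τ := τ) (N := N) (fun k => by
      have := hΛ k
      have m3 : Measurable fun x : κ → ℝ => |x k| ^ 3 := (hk k).abs.pow_const 3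
      simpa only [tX m3, tY m3] using this)
    (by simpa only [tX measurable_sqTail, tY measurable_sqTail] using hτ) hτ2 hΛL
    (fun y ε hε => by
      rw [sY, sY]
      exact hN y ε hε) Finset.univ y
  rwa [sX, sY] at key

end comparison

section rectangles

/-- The vector with coordinates `± s xⱼ`. -/
def signedCoords {p : ℕ} (s : ℝ) (x : EuclideanSpace ℝ (Fin p)) (k : Fin p × Bool) : ℝ :=
  s * (if k.2 then x k.1 else -x k.1)

/-- `signedCoords` as a continuous linear map. -/
def signedCoordsL (p : ℕ) (s : ℝ) : EuclideanSpace ℝ (Fin p) →L[ℝ] (Fin p × Bool → ℝ) :=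
  ContinuousLinearMap.pi fun k => s • (if k.2 then EuclideanSpace.proj k.1
    else -EuclideanSpace.proj k.1)

theorem signedCoordsL_apply {p : ℕ} (s : ℝ) (x : EuclideanSpace ℝ (Fin p)) :
    signedCoordsL p s x = signedCoords s x := by
  funext k
  rcases k with ⟨j, b⟩
  cases b <;> simp [signedCoordsL, signedCoords]

theorem measurable_signedCoords {p : ℕ} (s : ℝ) :
    Measurable (signedCoords s : EuclideanSpace ℝ (Fin p) → _) := by
  have : (signedCoords s : EuclideanSpace ℝ (Fin p) → _) = signedCoordsL p s :=
    funext fun x => (signedCoordsL_apply s x).symm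
  rw [this]
  exact (signedCoordsL p s).measurable

/-- A rectangle with finite ends is an orthant in the signed coordinates. Infinite ends are replaced
by ±N, and the bound survives the increasing limit N → ∞. -/
theorem abs_measureReal_hyperrectangle_sub_le {p : ℕ}
    {m₁ m₂ : Measure (EuclideanSpace ℝ (Fin p))} [IsProbabilityMeasure m₁]
    [IsProbabilityMeasure m₂] {M : ℝ}
    (h : ∀ y : Fin p × Bool → ℝ, |m₁.real {x | ∀ k, signedCoords 1 x k ≤ y k} -
      m₂.real {x | ∀ k, signedCoords 1 x k ≤ y k}| ≤ M)
    {A : Set (EuclideanSpace ℝ (Fin p))} (hA : A ∈ hyperrectangles p) :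
    |m₁.real A - m₂.real A| ≤ M := by
  obtain ⟨a, b, -, rfl⟩ := hA
  -- A lower end ⊤ or an upper end ⊥ is allowed, but leaves no real point.
  by_cases hbot : ∃ j, a j = ⊤ ∨ b j = ⊥
  · have : {w : EuclideanSpace ℝ (Fin p) | ∀ j, a j ≤ ((w j : ℝ) : EReal) ∧
        ((w j : ℝ) : EReal) ≤ b j} = ∅ := by
      obtain ⟨j, hj⟩ := hbot
      refine Set.eq_empty_of_forall_notMem fun w hw => ?_
      rcases hj with hj | hj
      · have := (hw j).1
        rw [hj] at this
        exact EReal.coe_ne_top _ (top_le_iff.1 this)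
      · have := (hw j).2
        rw [hj] at this
        exact EReal.coe_ne_bot _ (le_bot_iff.1 this)
    rw [this]
    simpa using (abs_nonneg _).trans (h 0)
  push Not at hbot
  let y : ℕ → Fin p × Bool → ℝ := fun N k =>
    if k.2 then (if b k.1 = ⊤ then (N : ℝ) else (b k.1).toReal)
    else (if a k.1 = ⊥ then (N : ℝ) else -(a k.1).toReal)
  let R : ℕ → Set (EuclideanSpace ℝ (Fin p)) := fun N => {x | ∀ k, signedCoords 1 x k ≤ y N k}
  have hy : ∀ k, Monotone fun N => y N k := by
    intro k N N' hN
    have : (N : ℝ) ≤ N' := by exact_mod_cast hN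
    simp only [y]
    split_ifs <;> simp [this]
  have hmono : Monotone R := fun N N' hN x hx k => (hx k).trans (hy k hN)
  have hunion : ⋃ N, R N = {w : EuclideanSpace ℝ (Fin p) | ∀ j, a j ≤ ((w j : ℝ) : EReal) ∧
      ((w j : ℝ) : EReal) ≤ b j} := by
    ext w
    rw [Set.mem_iUnion]
    constructor
    · rintro ⟨N, hN⟩ j
      have h1 := hN (j, false)
      have h2 := hN (j, true)
      simp only [signedCoords, y, one_mul, if_true, Bool.false_eq_true, if_false] at h1 h2
      constructor
      · by_cases ha : a j = ⊥
        · rw [ha]; exact bot_le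
        · rw [if_neg ha] at h1
          rw [← EReal.coe_toReal (hbot j).1 ha, EReal.coe_le_coe_iff]
          linarith
      · by_cases hb : b j = ⊤
        · rw [hb]; exact le_top
        · rw [if_neg hb] at h2
          rwa [← EReal.coe_toReal hb (hbot j).2, EReal.coe_le_coe_iff]
    · intro hw
      obtain ⟨N, hN⟩ := exists_nat_ge (∑ j, |w j|)
      refine ⟨N, ?_⟩
      rintro ⟨j, c⟩
      have hj : |w j| ≤ N := (Finset.single_le_sum (f := fun j => |w j|)
        (fun _ _ => abs_nonneg _) (Finset.mem_univ j)).trans hN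
      cases c
      · simp only [signedCoords, y, one_mul, Bool.false_eq_true, if_false]
        split_ifs with ha
        · exact (neg_le_abs _).trans hj
        · have := (hw j).1
          rw [← EReal.coe_toReal (hbot j).1 ha, EReal.coe_le_coe_iff] at this
          linarith
      · simp only [signedCoords, y, one_mul, if_true]
        split_ifs with hb
        · exact (le_abs_self _).trans hj
        · have := (hw j).2
          rwa [← EReal.coe_toReal hb (hbot j).2, EReal.coe_le_coe_iff] at this
  rw [← hunion]
  have t : ∀ m : Measure (EuclideanSpace ℝ (Fin p)), IsProbabilityMeasure m →
      Filter.Tendsto (fun N => m.real (R N)) Filter.atTop (nhds (m.real (⋃ N, R N))) := by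
    intro m _
    exact (ENNReal.tendsto_toReal (measure_ne_top m _)).comp
      (tendsto_measure_iUnion_atTop hmono)
  exact le_of_tendsto ((t m₁ inferInstance).sub (t m₂ inferInstance)).abs
    (Filter.Eventually.of_forall fun N => h (y N))

end rectangles

end

end HDCLT

/-! ### Moments of the Gaussian analogue and tails of the scaled summands -/

namespace HDCLT

noncomputable section

section gaussianMoments

variable {Ω : Type*} [MeasurableSpace Ω] {P : Measure Ω} {U : Ω → ℝ} {v : NNReal}

/-- The third absolute moment of the standard normal distribution. -/
def stdAbsThirdMoment : ℝ := ∫ x, |x| ^ 3 ∂(gaussianReal 0 1)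

theorem stdAbsThirdMoment_nonneg : 0 ≤ stdAbsThirdMoment :=
  integral_nonneg fun x => by positivity

theorem integral_abs_pow_three_of_hasLaw_gaussianReal (h : HasLaw U (gaussianReal 0 v) P) :
    ∫ ω, |U ω| ^ 3 ∂P = stdAbsThirdMoment * Real.sqrt v ^ 3 := by
  have hm : Measurable fun x : ℝ => |x| ^ 3 := by fun_prop
  have e : gaussianReal 0 v = (gaussianReal 0 1).map (fun x => Real.sqrt v * x) := by
    rw [gaussianReal_map_const_mul, mul_zero, mul_one]
    congr 1
    exact NNReal.eq (Real.sq_sqrt v.2).symm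
  have h1 := h.integral_comp (f := fun x => |x| ^ 3) hm.aestronglyMeasurable
  simp only [Function.comp_def] at h1
  rw [h1, e, integral_map (by fun_prop) hm.aestronglyMeasurable, stdAbsThirdMoment,
    mul_comm, ← integral_const_mul]
  refine integral_congr_ae (Filter.Eventually.of_forall fun x => ?_)
  simp only [abs_mul, abs_of_nonneg (Real.sqrt_nonneg _), mul_pow]

theorem integrable_exp_mul_of_hasLaw_gaussianReal (h : HasLaw U (gaussianReal 0 v) P) (t : ℝ) :
    Integrable (fun ω => Real.exp (t * U ω)) P := by
  have := integrable_exp_mul_gaussianReal (μ := 0) (v := v) t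
  rw [← h.map_eq] at this
  exact this.comp_aemeasurable h.aemeasurable

theorem integral_exp_mul_of_hasLaw_gaussianReal (h : HasLaw U (gaussianReal 0 v) P) (t : ℝ) :
    ∫ ω, Real.exp (t * U ω) ∂P = Real.exp (v * t ^ 2 / 2) := by
  have := mgf_gaussianReal h.map_eq t
  simpa [mgf] using this

theorem exp_abs_div_le (x B : ℝ) :
    Real.exp (|x| / B) ≤ Real.exp (B⁻¹ * x) + Real.exp (-B⁻¹ * x) := by
  have h1 := Real.exp_pos (B⁻¹ * x)
  have h2 := Real.exp_pos (-B⁻¹ * x)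
  rcases abs_cases x with ⟨h, -⟩ | ⟨h, -⟩
  · rw [h, div_eq_inv_mul]; linarith
  · rw [h, div_eq_inv_mul, mul_neg, ← neg_mul]; linarith

theorem integrable_exp_abs_of_hasLaw_gaussianReal (h : HasLaw U (gaussianReal 0 v) P)
    (B : ℝ) : Integrable (fun ω => Real.exp (|U ω| / B)) P := by
  refine Integrable.mono' ((integrable_exp_mul_of_hasLaw_gaussianReal h B⁻¹).add
    (integrable_exp_mul_of_hasLaw_gaussianReal h (-B⁻¹)))
    ((by fun_prop : Measurable fun x : ℝ => Real.exp (|x| / B)).comp_aemeasurable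
      h.aemeasurable).aestronglyMeasurable (Filter.Eventually.of_forall fun ω => ?_)
  rw [Real.norm_of_nonneg (Real.exp_pos _).le]
  exact exp_abs_div_le _ _

/-- exp(|U|/B) is at most exp(U/B) + exp(-U/B), and each mean is at most exp(3/2) ≤ 5. -/
theorem integral_exp_abs_le_of_hasLaw_gaussianReal (h : HasLaw U (gaussianReal 0 v) P) {B : ℝ}
    (hB : 0 < B) (hv : (v : ℝ) ≤ 3 * B ^ 2) : ∫ ω, Real.exp (|U ω| / B) ∂P ≤ 10 := by
  have i1 := integrable_exp_mul_of_hasLaw_gaussianReal h B⁻¹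
  have i2 := integrable_exp_mul_of_hasLaw_gaussianReal h (-B⁻¹)
  have h1 := integral_mono (integrable_exp_abs_of_hasLaw_gaussianReal h B) (i1.add i2)
    fun ω => exp_abs_div_le (U ω) B
  simp only [Pi.add_apply] at h1
  rw [integral_add i1 i2, integral_exp_mul_of_hasLaw_gaussianReal h,
    integral_exp_mul_of_hasLaw_gaussianReal h, neg_sq] at h1
  have h2 : (v : ℝ) * B⁻¹ ^ 2 / 2 ≤ 3 / 2 := by
    rw [inv_pow, ← div_eq_mul_inv, div_le_div_iff_of_pos_right two_pos]
    exact (div_le_iff₀ (by positivity)).2 hv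
  have h3 : Real.exp (3 / 2) ≤ 5 := by
    have e1 := Real.exp_one_lt_d9
    have : Real.exp (3 / 2) ^ 2 = Real.exp 1 ^ 3 := by
      rw [← Real.exp_nat_mul, ← Real.exp_nat_mul]; norm_num
    have h3 : Real.exp 1 ^ 3 ≤ 2.72 ^ 3 :=
      pow_le_pow_left₀ (Real.exp_pos _).le (by linarith) 3
    nlinarith [Real.exp_pos (3 / 2)]
  linarith [Real.exp_le_exp.2 h2]

/-- Lyapunov's inequality between the second and the third moment. -/
theorem sqrt_integral_sq_pow_three_le [IsProbabilityMeasure P]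
    (h3 : MemLp U 3 P) : Real.sqrt (∫ ω, U ω ^ 2 ∂P) ^ 3 ≤ ∫ ω, |U ω| ^ 3 ∂P := by
  set σ := Real.sqrt (∫ ω, U ω ^ 2 ∂P) with hσ
  have hσ0 : 0 ≤ σ := Real.sqrt_nonneg _
  have hs : σ ^ 2 = ∫ ω, U ω ^ 2 ∂P :=
    Real.sq_sqrt (integral_nonneg fun ω => sq_nonneg (U ω))
  have i2 : Integrable (fun ω => U ω ^ 2) P := (h3.mono_exponent (by norm_num)).integrable_sq
  have i3 : Integrable (fun ω => |U ω| ^ 3) P := by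
    simpa using h3.integrable_norm_pow (p := 3) (by norm_num)
  -- Tangent line of t ↦ t^(3/2) at σ², evaluated at t = a².
  have hpt : ∀ a : ℝ, 0 ≤ a → 3 / 2 * σ * a ^ 2 - σ ^ 3 / 2 ≤ a ^ 3 := fun a ha => by
    have : 0 ≤ (a - σ) ^ 2 * (2 * a + σ) := by positivity
    nlinarith
  have := integral_mono ((i2.const_mul (3 / 2 * σ)).sub (integrable_const (σ ^ 3 / 2))) i3
    fun ω => by
      have := hpt |U ω| (abs_nonneg _)
      rw [sq_abs] at this
      simpa using this
  simp only [Pi.sub_apply] at this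
  rw [integral_sub (i2.const_mul _) (integrable_const _), integral_const_mul, ← hs,
    integral_const] at this
  simp only [probReal_univ, smul_eq_mul, one_mul] at this
  nlinarith

end gaussianMoments

section signedCoords

variable {p : ℕ}

theorem signedCoords_eq (s : ℝ) (x : EuclideanSpace ℝ (Fin p)) (k : Fin p × Bool) :
    signedCoords s x k = s * (if k.2 then 1 else -1) * x k.1 := by
  unfold signedCoords
  split_ifs <;> ring

theorem abs_signedCoords {s : ℝ} (hs : 0 ≤ s) (x : EuclideanSpace ℝ (Fin p))
    (k : Fin p × Bool) : |signedCoords s x k| = s * |x k.1| := by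
  unfold signedCoords
  split_ifs <;> simp [abs_mul, abs_of_nonneg hs]

theorem exists_norm_signedCoords_eq {s : ℝ} (hs : 0 ≤ s) {x : EuclideanSpace ℝ (Fin p)}
    (h : 1 < ‖signedCoords s x‖) : ∃ j, ‖signedCoords s x‖ = s * |x j| := by
  by_contra! hne
  have hlt : ‖signedCoords s x‖ < ‖signedCoords s x‖ :=
    (pi_norm_lt_iff (by linarith)).2 fun k => by
      refine lt_of_le_of_ne (norm_le_pi_norm _ k) ?_
      rw [Real.norm_eq_abs, abs_signedCoords hs]
      exact (hne k.1).symm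
  exact lt_irrefl _ hlt

/-- With K = (sB)⁻¹ ≥ 2 and u = ‖`signedCoords` s x‖ > 1, u² ≤ exp(2(u - 1)) ≤ exp(K(u - 1)), and Ku
= |x_j|/B for a maximal j. -/
theorem sqTail_signedCoords_le_exp {s B : ℝ} (hs : 0 < s) (hB : 0 < B) (hK : 2 ≤ (s * B)⁻¹)
    (x : EuclideanSpace ℝ (Fin p)) :
    sqTail (signedCoords s x) ≤ Real.exp (-(s * B)⁻¹) * ∑ j, Real.exp (|x j| / B) := by
  have h0 : 0 ≤ Real.exp (-(s * B)⁻¹) * ∑ j, Real.exp (|x j| / B) := by positivity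
  refine Set.indicator_apply_le' (fun hx => ?_) fun _ => h0
  obtain ⟨j, hj⟩ := exists_norm_signedCoords_eq hs.le hx
  set u := ‖signedCoords s x‖ with hu
  have hu1 : 1 < u := hx
  have e1 : u ≤ Real.exp (u - 1) := by linarith [Real.add_one_le_exp (u - 1)]
  have e2 : (s * B)⁻¹ * u = |x j| / B := by
    rw [hj]
    field_simp
  calc u ^ 2 ≤ Real.exp (u - 1) ^ 2 := pow_le_pow_left₀ (by linarith) e1 2
    _ = Real.exp (2 * (u - 1)) := by rw [← Real.exp_nat_mul]; norm_num
    _ ≤ Real.exp ((s * B)⁻¹ * (u - 1)) := Real.exp_le_exp.2 (by nlinarith)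
    _ = Real.exp (-(s * B)⁻¹) * Real.exp (|x j| / B) := by
        rw [← Real.exp_add, ← e2]
        congr 1
        ring
    _ ≤ _ := by
        gcongr
        exact Finset.single_le_sum (f := fun j => Real.exp (|x j| / B))
          (fun _ _ => (Real.exp_pos _).le) (Finset.mem_univ j)

/-- Where the norm exceeds 1, its square is at most its q-th power. -/
theorem sqTail_signedCoords_le_rpow {s B q : ℝ} (hs : 0 < s) (hB : 0 < B) (hq : 2 ≤ q)
    (x : EuclideanSpace ℝ (Fin p)) :
    sqTail (signedCoords s x) ≤ (s * B) ^ q * (⨆ j, |x j| / B) ^ q := by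
  have hsup : 0 ≤ ⨆ j, |x j| / B := Real.iSup_nonneg fun j => by positivity
  have h0 : 0 ≤ (s * B) ^ q * (⨆ j, |x j| / B) ^ q := by positivity
  refine Set.indicator_apply_le' (fun hx => ?_) fun _ => h0
  obtain ⟨j, hj⟩ := exists_norm_signedCoords_eq hs.le hx
  set u := ‖signedCoords s x‖ with hu
  have hu1 : 1 < u := hx
  rw [← Real.mul_rpow (by positivity) hsup]
  have e2 : u ≤ s * B * ⨆ j, |x j| / B := by
    have := le_ciSup (f := fun j => |x j| / B) (Set.finite_range _).bddAbove j
    calc u = s * B * (|x j| / B) := by rw [hj]; field_simp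
      _ ≤ _ := by gcongr
  calc u ^ 2 = u ^ (2 : ℝ) := by norm_num
    _ ≤ u ^ q := Real.rpow_le_rpow_of_exponent_le hu1.le hq
    _ ≤ _ := Real.rpow_le_rpow (by linarith) e2 (by linarith)

variable {Ω : Type*} [MeasurableSpace Ω] {P : Measure Ω} {Z : Ω → EuclideanSpace ℝ (Fin p)}

theorem integral_sqTail_signedCoords_le_exp {s B R : ℝ} (hs : 0 < s) (hB : 0 < B)
    (hK : 2 ≤ (s * B)⁻¹) (hZi : ∀ j, Integrable (fun ω => Real.exp (|Z ω j| / B)) P)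
    (hZ : ∀ j, ∫ ω, Real.exp (|Z ω j| / B) ∂P ≤ R) :
    ∫ ω, sqTail (signedCoords s (Z ω)) ∂P ≤ Real.exp (-(s * B)⁻¹) * (p * R) := by
  have hi := (integrable_finsetSum Finset.univ fun j _ => hZi j).const_mul
    (Real.exp (-(s * B)⁻¹))
  refine (integral_mono_of_nonneg (Filter.Eventually.of_forall fun ω => sqTail_nonneg _) hi
    (Filter.Eventually.of_forall fun ω => sqTail_signedCoords_le_exp hs hB hK (Z ω))).trans ?_
  rw [integral_const_mul, integral_finsetSum _ fun j _ => hZi j]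
  gcongr
  refine (Finset.sum_le_sum fun j _ => hZ j).trans (le_of_eq ?_)
  simp

theorem integral_sqTail_signedCoords_le_rpow {s B q R : ℝ} (hs : 0 < s) (hB : 0 < B)
    (hq : 2 ≤ q) (hZi : Integrable (fun ω => (⨆ j, |Z ω j| / B) ^ q) P)
    (hZ : ∫ ω, (⨆ j, |Z ω j| / B) ^ q ∂P ≤ R) :
    ∫ ω, sqTail (signedCoords s (Z ω)) ∂P ≤ (s * B) ^ q * R := by
  refine (integral_mono_of_nonneg (Filter.Eventually.of_forall fun ω => sqTail_nonneg _)
    (hZi.const_mul _)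
    (Filter.Eventually.of_forall fun ω => sqTail_signedCoords_le_rpow hs hB hq (Z ω))).trans ?_
  rw [integral_const_mul]
  gcongr

end signedCoords

section analogue

variable {Ω Ω' : Type*} [MeasurableSpace Ω] [MeasurableSpace Ω'] {P : Measure Ω}
  {P' : Measure Ω'} [IsProbabilityMeasure P] [IsProbabilityMeasure P'] {n p : ℕ}
  {X : Fin n → Ω → EuclideanSpace ℝ (Fin p)} {Y : Fin n → Ω' → EuclideanSpace ℝ (Fin p)}

/-- The marginal and covariance formulas for the multivariate Gaussian are applied under this
condition. -/
theorem posSemidef_secondMomentMatrix {Z : Ω → EuclideanSpace ℝ (Fin p)}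
    (hZ : ∀ j, MemLp (fun ω => Z ω j) 2 P) : (secondMomentMatrix P Z).PosSemidef := by
  have hi : ∀ j k, Integrable (fun ω => Z ω j * Z ω k) P := fun j k =>
    (hZ j).integrable_mul (hZ k)
  refine Matrix.PosSemidef.of_dotProduct_mulVec_nonneg ?_ fun x => ?_
  · ext j k
    simp [secondMomentMatrix, mul_comm]
  · have : star x ⬝ᵥ (secondMomentMatrix P Z).mulVec x = ∫ ω, (∑ j, x j * Z ω j) ^ 2 ∂P := by
      have e : ∀ ω, (∑ j, x j * Z ω j) ^ 2 = ∑ j, ∑ k, x j * x k * (Z ω j * Z ω k) := fun ω => by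
        rw [pow_two, Finset.sum_mul_sum]
        exact Finset.sum_congr rfl fun j _ => Finset.sum_congr rfl fun k _ => by ring
      simp only [e]
      rw [integral_finsetSum _ fun j _ => integrable_finsetSum _ fun k _ =>
        (hi j k).const_mul (x j * x k)]
      simp only [dotProduct, Matrix.mulVec, secondMomentMatrix, Matrix.of_apply, star_trivial,
        Finset.mul_sum]
      refine Finset.sum_congr rfl fun j _ => ?_
      rw [integral_finsetSum _ fun k _ => (hi j k).const_mul (x j * x k)]
      refine Finset.sum_congr rfl fun k _ => ?_
      rw [integral_const_mul]
      ring
    rw [this]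
    exact integral_nonneg fun ω => sq_nonneg _

theorem hasLaw_eval_gaussianAnalogue (hX : IsIndepCentered P X)
    (hY : IsGaussianAnalogue P P' X Y) (i : Fin n) (j : Fin p) :
    HasLaw (fun ω => Y i ω j) (gaussianReal 0 (∫ ω, X i ω j ^ 2 ∂P).toNNReal) P' := by
  have h := (measurePreserving_eval_multivariateGaussian (μ := 0)
    (posSemidef_secondMomentMatrix (hX.memLp_two i)) (i := j)).fun_comp_hasLaw (hY.hasLaw i)
  simpa [secondMomentMatrix, pow_two] using h

theorem memLp_eval_gaussianAnalogue (hX : IsIndepCentered P X)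
    (hY : IsGaussianAnalogue P P' X Y) (i : Fin n) (j : Fin p) (q : NNReal) :
    MemLp (fun ω => Y i ω j) q P' := by
  have h := hasLaw_eval_gaussianAnalogue hX hY i j
  exact (memLp_comp_iff_of_hasLaw h HasLaw.id measurable_id q).2 (memLp_id_gaussianReal q)

theorem integral_eval_gaussianAnalogue (hX : IsIndepCentered P X)
    (hY : IsGaussianAnalogue P P' X Y) (i : Fin n) (j : Fin p) : ∫ ω, Y i ω j ∂P' = 0 := by
  rw [(hasLaw_eval_gaussianAnalogue hX hY i j).integral_eq, integral_id_gaussianReal]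

theorem integral_mul_gaussianAnalogue (hX : IsIndepCentered P X)
    (hY : IsGaussianAnalogue P P' X Y) (i : Fin n) (j k : Fin p) :
    ∫ ω, Y i ω j * Y i ω k ∂P' = ∫ ω, X i ω j * X i ω k ∂P := by
  have m : ∀ j, MemLp (fun ω => Y i ω j) 2 P' := fun j =>
    memLp_eval_gaussianAnalogue hX hY i j 2
  have h1 := covariance_eval_multivariateGaussian (μ := 0)
    (posSemidef_secondMomentMatrix (hX.memLp_two i)) j k
  have h2 := (hY.hasLaw i).covariance_fun_comp (f := fun x => x j) (g := fun x => x k)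
    (by fun_prop) (by fun_prop)
  rw [h1, covariance_eq_sub (m j) (m k), integral_eval_gaussianAnalogue hX hY i j] at h2
  simpa [secondMomentMatrix] using h2

theorem integral_sq_gaussianAnalogue (hX : IsIndepCentered P X)
    (hY : IsGaussianAnalogue P P' X Y) (i : Fin n) (j : Fin p) :
    Var[fun ω => Y i ω j; P'] = ∫ ω, X i ω j ^ 2 ∂P := by
  rw [(hasLaw_eval_gaussianAnalogue hX hY i j).variance_eq, variance_id_gaussianReal,
    Real.coe_toNNReal _ (integral_nonneg fun ω => sq_nonneg _)]

/-- The Gaussian third moment is a constant times σ³, and Lyapunov bounds σ³ by the third moment of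
X; no separate moment assumption on Y is needed. -/
theorem integral_abs_pow_three_gaussianAnalogue_le (hX : IsIndepCentered P X)
    (hY : IsGaussianAnalogue P P' X Y) {i : Fin n} {j : Fin p}
    (h3 : MemLp (fun ω => X i ω j) 3 P) :
    ∫ ω, |Y i ω j| ^ 3 ∂P' ≤ stdAbsThirdMoment * ∫ ω, |X i ω j| ^ 3 ∂P := by
  rw [integral_abs_pow_three_of_hasLaw_gaussianReal (hasLaw_eval_gaussianAnalogue hX hY i j),
    Real.coe_toNNReal _ (integral_nonneg fun ω => sq_nonneg _)]
  exact mul_le_mul_of_nonneg_left (sqrt_integral_sq_pow_three_le h3) stdAbsThirdMoment_nonneg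

theorem hasGaussianLaw_sum_gaussianAnalogue (hY : IsGaussianAnalogue P P' X Y) :
    HasGaussianLaw (fun ω => ∑ i, Y i ω) P' :=
  hY.indep.hasGaussianLaw_fun_sum fun i => (hY.hasLaw i).hasGaussianLaw

theorem variance_sum_gaussianAnalogue (hX : IsIndepCentered P X)
    (hY : IsGaussianAnalogue P P' X Y) (j : Fin p) :
    Var[fun ω => ∑ i, Y i ω j; P'] = ∑ i, ∫ ω, X i ω j ^ 2 ∂P := by
  have h := IndepFun.variance_sum (X := fun i ω => Y i ω j) (s := Finset.univ) (μ := P')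
    (fun i _ => memLp_eval_gaussianAnalogue hX hY i j 2) (fun i _ k _ hik =>
      (hY.indep.indepFun hik).comp (φ := fun x : EuclideanSpace ℝ (Fin p) => x j)
        (ψ := fun x : EuclideanSpace ℝ (Fin p) => x j) (by fun_prop) (by fun_prop))
  simp only [integral_sq_gaussianAnalogue hX hY] at h
  rw [← h]
  congr 1
  funext ω
  simp

end analogue

end

end HDCLT

/-! ### Choice of scale and assembly -/

namespace HDCLT

noncomputable section

/-- Parameters for which the smoothing scale `1 / scale` resolves the error `D`. -/
structure IsAdmissible (n p : ℕ) (B D a : ℝ) : Prop where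
  four_le : 4 ≤ n
  three_le : 3 ≤ p
  one_le_B : 1 ≤ B
  a_pos : 0 < a
  a_le : a ≤ 1 / 4
  D_pos : 0 < D
  D_le : D ≤ 1 / 24
  le_D : B * Real.sqrt (Real.log (p * n)) ^ 7 ≤ Real.sqrt n * D ^ 3

/-- The factor by which the summands are multiplied before smoothing at unit scale. -/
def scale (n p : ℕ) (D a : ℝ) : ℝ := a * Real.sqrt (Real.log (p * n)) ^ 3 / (D * Real.sqrt n)

theorem two_le_log {n p : ℕ} (hn : 4 ≤ n) (hp : 3 ≤ p) : 2 ≤ Real.log ((p : ℝ) * n) := by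
  have hn' : (4 : ℝ) ≤ n := by exact_mod_cast hn
  have hp' : (3 : ℝ) ≤ p := by exact_mod_cast hp
  rw [Real.le_log_iff_exp_le (by positivity)]
  have h1 := Real.exp_one_lt_d9
  have h2 : Real.exp 2 = Real.exp 1 ^ 2 := by rw [← Real.exp_nat_mul]; norm_num
  have h3 : Real.exp 1 ^ 2 ≤ 2.72 ^ 2 := pow_le_pow_left₀ (Real.exp_pos _).le (by linarith) 2
  nlinarith

namespace IsAdmissible

variable {n p : ℕ} {B D a : ℝ}

theorem two_le_log (h : IsAdmissible n p B D a) :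
    2 ≤ Real.log ((p : ℝ) * n) := HDCLT.two_le_log h.four_le h.three_le

theorem one_le_sqrt_log (h : IsAdmissible n p B D a) :
    1 ≤ Real.sqrt (Real.log ((p : ℝ) * n)) :=
  Real.one_le_sqrt.2 (by linarith [h.two_le_log])

theorem sqrt_log_sq (h : IsAdmissible n p B D a) :
    Real.sqrt (Real.log ((p : ℝ) * n)) ^ 2 = Real.log ((p : ℝ) * n) :=
  Real.sq_sqrt (by linarith [h.two_le_log])

theorem sqrt_n_pos (h : IsAdmissible n p B D a) : 0 < Real.sqrt n :=
  Real.sqrt_pos.2 (by have := h.four_le; exact_mod_cast (by omega : 0 < n))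

theorem scale_pos (h : IsAdmissible n p B D a) : 0 < scale n p D a := by
  have := h.one_le_sqrt_log
  have := h.sqrt_n_pos
  have := h.a_pos
  have := h.D_pos
  unfold scale
  positivity

/-- Unfolding, the claim is 2aBu⁵ ≤ D√n with u = √log(pn), which follows from `le_D` since u ≥ 1 and
D ≤ 1. It makes the exponential tail factor at most (pn)⁻². -/
theorem two_log_le_inv_scale (h : IsAdmissible n p B D a) :
    2 * Real.log ((p : ℝ) * n) ≤ (scale n p D a * B)⁻¹ := by
  have hu := h.one_le_sqrt_log
  have hN := h.sqrt_n_pos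
  have ha := h.a_pos
  have ha4 := h.a_le
  have hD := h.D_pos
  have hB := h.one_le_B
  have hle := h.le_D
  rw [← h.sqrt_log_sq]
  set u := Real.sqrt (Real.log ((p : ℝ) * n))
  have hsB : 0 < scale n p D a * B := mul_pos h.scale_pos (by linarith)
  rw [le_inv_comm₀ (by positivity) hsB, scale, div_mul_eq_mul_div, div_le_iff₀ (by positivity),
    inv_mul_eq_div, le_div_iff₀ (by positivity)]
  have h1 : D ^ 3 ≤ D := pow_le_of_le_one hD.le (by linarith [h.D_le]) three_ne_zero
  have h2 : u ^ 5 ≤ u ^ 7 := pow_le_pow_right₀ hu (by norm_num)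
  calc a * u ^ 3 * B * (2 * u ^ 2) = 2 * a * (B * u ^ 5) := by ring
    _ ≤ 1 * (B * u ^ 7) := by gcongr; linarith
    _ ≤ Real.sqrt n * D ^ 3 := by linarith
    _ ≤ Real.sqrt n * D := by gcongr
    _ = D * Real.sqrt n := mul_comm _ _

/-- Lets an error of order 1/n be absorbed into D. -/
theorem one_le_mul_D (h : IsAdmissible n p B D a) : 1 ≤ n * D := by
  have hu := h.one_le_sqrt_log
  have hB := h.one_le_B
  have hle := h.le_D
  have hD := h.D_pos
  have hN : 1 ≤ Real.sqrt n :=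
    Real.one_le_sqrt.2 (by have := h.four_le; exact_mod_cast (by omega : 1 ≤ n))
  have h1 : D ^ 3 ≤ D := pow_le_of_le_one hD.le (by linarith [h.D_le]) three_ne_zero
  have h2 : 1 ≤ B * Real.sqrt (Real.log ((p : ℝ) * n)) ^ 7 := one_le_mul_of_one_le_of_one_le hB
    (one_le_pow₀ hu)
  have h3 : 1 ≤ Real.sqrt n * D := by
    calc 1 ≤ Real.sqrt n * D ^ 3 := h2.trans hle
      _ ≤ _ := by gcongr
  calc 1 ≤ Real.sqrt n * (Real.sqrt n * D) := one_le_mul_of_one_le_of_one_le hN h3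
    _ = n * D := by rw [← mul_assoc, Real.mul_self_sqrt (Nat.cast_nonneg n)]

theorem log_card_le (h : IsAdmissible n p B D a) :
    Real.log (Fintype.card (Fin p × Bool)) ≤ Real.log ((p : ℝ) * n) := by
  have hn : (4 : ℝ) ≤ n := by exact_mod_cast h.four_le
  have hp : (3 : ℝ) ≤ p := by exact_mod_cast h.three_le
  simp only [Fintype.card_prod, Fintype.card_fin, Fintype.card_bool, Nat.cast_mul, Nat.cast_ofNat]
  exact Real.log_le_log (by positivity) (by nlinarith)

/-- The n summands and p coordinates contribute np · R · (pn)⁻² = R/(pn) ≤ RD. -/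
theorem sum_sqTail_le (h : IsAdmissible n p B D a) {Ω : Type*} [MeasurableSpace Ω] {P : Measure Ω}
    {Z : Fin n → Ω → EuclideanSpace ℝ (Fin p)} {R : ℝ} (hR : 0 ≤ R)
    (hZi : ∀ i j, Integrable (fun ω => Real.exp (|Z i ω j| / B)) P)
    (hZ : ∀ i j, ∫ ω, Real.exp (|Z i ω j| / B) ∂P ≤ R) :
    ∑ i, ∫ ω, sqTail (signedCoords (scale n p D a) (Z i ω)) ∂P ≤ R * D := by
  have hK := h.two_log_le_inv_scale
  have hL := h.two_le_log
  have hn : (4 : ℝ) ≤ n := by exact_mod_cast h.four_le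
  have hp : (3 : ℝ) ≤ p := by exact_mod_cast h.three_le
  have hnD := h.one_le_mul_D
  have hD := h.D_pos
  calc ∑ i, ∫ ω, sqTail (signedCoords (scale n p D a) (Z i ω)) ∂P
      ≤ ∑ _i : Fin n, Real.exp (-(scale n p D a * B)⁻¹) * (p * R) :=
        Finset.sum_le_sum fun i _ => integral_sqTail_signedCoords_le_exp h.scale_pos
          (by linarith [h.one_le_B]) (by linarith) (hZi i) (hZ i)
    _ = n * (Real.exp (-(scale n p D a * B)⁻¹) * (p * R)) := by simp
    _ ≤ n * (Real.exp (-(2 * Real.log ((p : ℝ) * n))) * (p * R)) := by gcongr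
    _ = R / (p * n) := by
        rw [two_mul, neg_add, Real.exp_add, Real.exp_neg, Real.exp_log (by positivity)]
        field_simp
    _ ≤ R * D := by
        rw [div_le_iff₀ (by positivity)]
        have : 1 ≤ p * (n * D) := by nlinarith
        nlinarith [mul_le_mul_of_nonneg_left this hR]

end IsAdmissible

theorem rho_le_of_forall {Ω Ω' : Type*} [MeasurableSpace Ω] [MeasurableSpace Ω'] {P : Measure Ω}
    {P' : Measure Ω'} [IsProbabilityMeasure P] [IsProbabilityMeasure P'] {p : ℕ}
    {S : Ω → EuclideanSpace ℝ (Fin p)} {T : Ω' → EuclideanSpace ℝ (Fin p)}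
    (hS : AEMeasurable S P) (hT : AEMeasurable T P') {M : ℝ}
    (h : ∀ y : Fin p × Bool → ℝ, |P.real {ω | ∀ k, signedCoords 1 (S ω) k ≤ y k} -
      P'.real {ω | ∀ k, signedCoords 1 (T ω) k ≤ y k}| ≤ M) :
    rho P P' S T (hyperrectangles p) ≤ M := by
  have hM : 0 ≤ M := (abs_nonneg _).trans (h 0)
  have p1 : IsProbabilityMeasure (P.map S) := Measure.isProbabilityMeasure_map hS
  have p2 : IsProbabilityMeasure (P'.map T) := Measure.isProbabilityMeasure_map hT
  have l1 : HasLaw S (P.map S) P := ⟨hS, rfl⟩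
  have l2 : HasLaw T (P'.map T) P' := ⟨hT, rfl⟩
  have hm : ∀ y : Fin p × Bool → ℝ, MeasurableSet
      {x : EuclideanSpace ℝ (Fin p) | ∀ k, signedCoords 1 x k ≤ y k} := fun y =>
    measurableSet_le (measurable_signedCoords 1) measurable_const
  have h' : ∀ y : Fin p × Bool → ℝ, |(P.map S).real {x | ∀ k, signedCoords 1 x k ≤ y k} -
      (P'.map T).real {x | ∀ k, signedCoords 1 x k ≤ y k}| ≤ M := fun y => by
    have := h y
    rwa [l1.measureReal_eq (p := fun x => ∀ k, signedCoords 1 x k ≤ y k) (hm y),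
      l2.measureReal_eq (p := fun x => ∀ k, signedCoords 1 x k ≤ y k) (hm y)] at this
  refine Real.iSup_le (fun A => ?_) hM
  have key := abs_measureReal_hyperrectangle_sub_le h' A.2
  have hA : MeasurableSet A.1 := by
    obtain ⟨a, b, -, e⟩ := A.2
    rw [e]
    have : {w : EuclideanSpace ℝ (Fin p) | ∀ j, a j ≤ ((w j : ℝ) : EReal) ∧
        ((w j : ℝ) : EReal) ≤ b j} = ⋂ j, {w : EuclideanSpace ℝ (Fin p) |
          a j ≤ ((w j : ℝ) : EReal) ∧ ((w j : ℝ) : EReal) ≤ b j} := by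
      ext w; simp
    rw [this]
    refine MeasurableSet.iInter fun j => ?_
    have hc : Measurable fun w : EuclideanSpace ℝ (Fin p) => ((w j : ℝ) : EReal) :=
      measurable_coe_real_ereal.comp (by fun_prop)
    exact (measurableSet_le measurable_const hc).inter (measurableSet_le hc measurable_const)
  rwa [l1.measureReal_eq (p := fun x => x ∈ A.1) hA, l2.measureReal_eq (p := fun x => x ∈ A.1) hA]

theorem rho_le_one {Ω Ω' : Type*} [MeasurableSpace Ω] [MeasurableSpace Ω'] {P : Measure Ω}
    {P' : Measure Ω'} [IsProbabilityMeasure P] [IsProbabilityMeasure P'] {p : ℕ}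
    (S : Ω → EuclideanSpace ℝ (Fin p)) (T : Ω' → EuclideanSpace ℝ (Fin p))
    (𝒜 : Set (Set (EuclideanSpace ℝ (Fin p)))) : rho P P' S T 𝒜 ≤ 1 := by
  refine Real.iSup_le (fun A => ?_) zero_le_one
  have h1 : P.real {ω | S ω ∈ A.1} ≤ 1 := measureReal_le_one
  have h2 : P'.real {ω | T ω ∈ A.1} ≤ 1 := measureReal_le_one
  have h3 : 0 ≤ P.real {ω | S ω ∈ A.1} := measureReal_nonneg
  have h4 : 0 ≤ P'.real {ω | T ω ∈ A.1} := measureReal_nonneg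
  exact abs_sub_le_iff.2 ⟨by linarith, by linarith⟩

section main

variable {Ω Ω' : Type*} [MeasurableSpace Ω] [MeasurableSpace Ω'] {P : Measure Ω}
  {P' : Measure Ω'} [IsProbabilityMeasure P] [IsProbabilityMeasure P'] {n p : ℕ}
  {X : Fin n → Ω → EuclideanSpace ℝ (Fin p)} {Y : Fin n → Ω' → EuclideanSpace ℝ (Fin p)}

theorem memLp_three_of_condM2 (hX : IsIndepCentered P X) {B : ℝ} (h2 : CondM2 P X B) (i : Fin n)
    (j : Fin p) : MemLp (fun ω => X i ω j) 3 P := by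
  have hm : Measurable fun ω => X i ω j :=
    (by fun_prop : Measurable fun x : EuclideanSpace ℝ (Fin p) => x j).comp (hX.measurable i)
  have := ((h2 j 1 (by simp)).1 i)
  refine (integrable_norm_rpow_iff hm.aestronglyMeasurable (p := 3) (by norm_num)
    (by norm_num)).1 ?_
  simpa using this

/-- Anti-concentration of the rescaled Gaussian sum. -/
theorem anticoncentration_gaussianAnalogue (hX : IsIndepCentered P X)
    (hY : IsGaussianAnalogue P P' X Y) {b s H : ℝ} (hb : 0 < b) (h1 : CondM1 P X b) (hs : 0 < s)
    (hn : 0 < n) (hp : 0 < p) (hH : 0 ≤ H)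
    (hκ : Fintype.card (Fin p × Bool) * Real.exp (-(H ^ 2 / 2)) ≤ 1) (y : Fin p × Bool → ℝ)
    (ε : ℝ) (hε : 0 < ε) :
    P'.real {ω | ∀ k, (∑ i, signedCoords s (Y i ω)) k ≤ y k + ε} -
      P'.real {ω | ∀ k, (∑ i, signedCoords s (Y i ω)) k ≤ y k} ≤
      6 * (H + 1) / (s * Real.sqrt n * Real.sqrt b) * ε := by
  have : Nonempty (Fin p × Bool) := ⟨(⟨0, hp⟩, true)⟩
  have hn0 : (0 : ℝ) < n := by exact_mod_cast hn
  set W : Ω' → Fin p × Bool → ℝ := fun ω => ∑ i, signedCoords s (Y i ω) with hW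
  have hWeq : ∀ ω, W ω = signedCoordsL p s (∑ i, Y i ω) := fun ω => by
    rw [hW, map_sum]
    exact Finset.sum_congr rfl fun i _ => (signedCoordsL_apply s _).symm
  have hG : HasGaussianLaw W P' := by
    have := (hasGaussianLaw_sum_gaussianAnalogue hY).map_fun (signedCoordsL p s)
    rwa [show W = fun ω => signedCoordsL p s (∑ i, Y i ω) from funext hWeq]
  have hWm := hG.aemeasurable
  have hGauss := hG.isGaussian_map
  have hWk : ∀ ω k, W ω k = s * (if k.2 then 1 else -1) * ∑ i, Y i ω k.1 := fun ω k => by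
    rw [hWeq, signedCoordsL_apply, signedCoords_eq]
    simp
  have hYi : ∀ i j, Integrable (fun ω => Y i ω j) P' := fun i j =>
    (memLp_eval_gaussianAnalogue hX hY i j 1).integrable le_rfl
  have hmean : ∀ k, ∫ x, x k ∂(P'.map W) = 0 := fun k => by
    rw [integral_map hWm (measurable_pi_apply k).aestronglyMeasurable]
    simp only [hWk]
    rw [integral_const_mul, integral_finsetSum _ fun i _ => hYi i k.1]
    simp [integral_eval_gaussianAnalogue hX hY]
  have hvar : ∀ k, s ^ 2 * (n * b) ≤ Var[fun x : Fin p × Bool → ℝ => x k; P'.map W] := fun k => by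
    rw [variance_map (measurable_pi_apply k).aemeasurable hWm]
    have e : (fun x : Fin p × Bool → ℝ => x k) ∘ W =
        fun ω => s * (if k.2 then 1 else -1) * ∑ i, Y i ω k.1 := funext fun ω => hWk ω k
    rw [e, variance_const_mul, variance_sum_gaussianAnalogue hX hY, mul_pow]
    have e2 : (if k.2 then (1 : ℝ) else -1) ^ 2 = 1 := by split_ifs <;> norm_num
    rw [e2, mul_one]
    have := h1 k.1
    rw [le_inv_mul_iff₀ hn0] at this
    gcongr
  have key := nazarov hmean (by positivity) hvar hH hκ y hε
  have hm : ∀ y : Fin p × Bool → ℝ, MeasurableSet {x : Fin p × Bool → ℝ | ∀ k, x k ≤ y k} :=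
    fun y => measurableSet_le measurable_id measurable_const
  rw [map_measureReal_apply_of_aemeasurable hWm (hm _),
    map_measureReal_apply_of_aemeasurable hWm (hm _)] at key
  refine key.trans (le_of_eq ?_)
  rw [Real.sqrt_mul (by positivity), Real.sqrt_sq hs.le, Real.sqrt_mul hn0.le]
  field_simp

/-- The scale balances the two requirements: the third-moment coefficient is at most 1/4, and L
times the Gaussian concentration rate is of order D. The tail conditions on X enter only through
`hvar` and `htail`, so both cases of the theorem reduce to this bound. -/
theorem rho_le_of_isAdmissible (c : SmoothCutoff) {B b D a : ℝ} (h : IsAdmissible n p B D a)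
    (hb : 0 < b)
    (ha : 104 * c.bound * Real.exp 4 * (1 + stdAbsThirdMoment) * a ≤ 1)
    (hX : IsIndepCentered P X) (hY : IsGaussianAnalogue P P' X Y) (h1 : CondM1 P X b)
    (h2 : CondM2 P X B) (hvar : ∀ i j, ∫ ω, X i ω j ^ 2 ∂P ≤ 3 * B ^ 2)
    (htail : ∑ i, ∫ ω, sqTail (signedCoords (scale n p D a) (X i ω)) ∂P ≤ 2 * D) :
    rho P P' (normalizedSum X) (normalizedSum Y) (hyperrectangles p) ≤
      (216 / (a * Real.sqrt b) + 96 * c.bound) * D := by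
  have hp0 : 0 < p := by have := h.three_le; omega
  have hn0 : 0 < n := by have := h.four_le; omega
  have : Nonempty (Fin p × Bool) := ⟨(⟨0, hp0⟩, true)⟩
  have hL := h.two_le_log
  have hu := h.one_le_sqrt_log
  have hu2 := h.sqrt_log_sq
  have hN := h.sqrt_n_pos
  have hN2 : Real.sqrt n ^ 2 = n := Real.sq_sqrt (Nat.cast_nonneg n)
  have hD := h.D_pos
  have ha0 := h.a_pos
  have hB := h.one_le_B
  have hc := c.one_le_bound
  have hle := h.le_D
  have hsb : 0 < Real.sqrt b := Real.sqrt_pos.2 hb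
  have hm3 := stdAbsThirdMoment_nonneg
  have hnR : (0 : ℝ) < n := by exact_mod_cast hn0
  have hs := h.scale_pos
  set s := scale n p D a with hsdef
  set u := Real.sqrt (Real.log ((p : ℝ) * n)) with hudef
  set L := Real.log ((p : ℝ) * n) with hLdef
  have mX3 := memLp_three_of_condM2 hX h2
  have hXm : ∀ i, AEMeasurable (fun ω => signedCoords s (X i ω)) P := fun i =>
    ((measurable_signedCoords s).comp (hX.measurable i)).aemeasurable
  have hYm : ∀ i, AEMeasurable (fun ω => signedCoords s (Y i ω)) P' := fun i =>
    (measurable_signedCoords s).comp_aemeasurable (hY.hasLaw i).aemeasurable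
  have hΛ : ∀ k, ∑ i, (∫ ω, |signedCoords s (X i ω) k| ^ 3 ∂P +
      ∫ ω, |signedCoords s (Y i ω) k| ^ 3 ∂P') ≤ s ^ 3 * ((1 + stdAbsThirdMoment) * (n * B)) := by
    intro k
    simp only [abs_signedCoords hs.le, mul_pow, integral_const_mul]
    have hM2 := (h2 k.1 1 (by simp)).2
    rw [inv_mul_le_iff₀ hnR, pow_one] at hM2
    calc ∑ i, (s ^ 3 * ∫ ω, |X i ω k.1| ^ 3 ∂P + s ^ 3 * ∫ ω, |Y i ω k.1| ^ 3 ∂P')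
        ≤ ∑ i, s ^ 3 * ((1 + stdAbsThirdMoment) * ∫ ω, |X i ω k.1| ^ 3 ∂P) := by
          refine Finset.sum_le_sum fun i _ => ?_
          rw [← mul_add]
          gcongr
          linarith [integral_abs_pow_three_gaussianAnalogue_le hX hY (mX3 i k.1)]
      _ = s ^ 3 * ((1 + stdAbsThirdMoment) * ∑ i, ∫ ω, |X i ω k.1| ^ 3 ∂P) := by
          rw [Finset.mul_sum, Finset.mul_sum]
      _ ≤ _ := by gcongr
  have hτY : ∑ i, ∫ ω, sqTail (signedCoords s (Y i ω)) ∂P' ≤ 10 * D := by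
    refine h.sum_sqTail_le (by norm_num) (fun i j => integrable_exp_abs_of_hasLaw_gaussianReal
      (hasLaw_eval_gaussianAnalogue hX hY i j) B) fun i j =>
      integral_exp_abs_le_of_hasLaw_gaussianReal (hasLaw_eval_gaussianAnalogue hX hY i j)
        (by linarith) ?_
    rw [Real.coe_toNNReal _ (integral_nonneg fun ω => sq_nonneg _)]
    exact hvar i j
  have hτ : ∑ i, (∫ ω, sqTail (signedCoords s (X i ω)) ∂P +
      ∫ ω, sqTail (signedCoords s (Y i ω)) ∂P') ≤ 12 * D := by
    rw [Finset.sum_add_distrib]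
    linarith
  -- Since L = u², the scale turns s³nB/L into a³ · Bu⁷/(√n D³), and the last fraction is at most 1
  -- by admissibility.
  have hΛL : 26 * c.bound * Real.exp 4 / L * (s ^ 3 * ((1 + stdAbsThirdMoment) * (n * B))) ≤
      1 / 4 := by
    have e : 26 * c.bound * Real.exp 4 / L * (s ^ 3 * ((1 + stdAbsThirdMoment) * (n * B))) =
        26 * c.bound * Real.exp 4 * (1 + stdAbsThirdMoment) * a ^ 3 *
          (B * u ^ 7 / (Real.sqrt n * D ^ 3)) := by
      rw [hsdef, scale, ← hLdef, ← hudef, ← hu2, ← hN2, Real.sqrt_sq hN.le]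
      field_simp
    have h3 : B * u ^ 7 / (Real.sqrt n * D ^ 3) ≤ 1 := (div_le_one (by positivity)).2 hle
    have h4 : a ^ 3 ≤ a := pow_le_of_le_one ha0.le (by linarith [h.a_le]) three_ne_zero
    rw [e]
    calc 26 * c.bound * Real.exp 4 * (1 + stdAbsThirdMoment) * a ^ 3 *
          (B * u ^ 7 / (Real.sqrt n * D ^ 3))
        ≤ 26 * c.bound * Real.exp 4 * (1 + stdAbsThirdMoment) * a * 1 := by gcongr
      _ ≤ 1 / 4 := by linarith
  -- H = √2 u makes exp(-H²/2) equal to 1/(pn), which beats the 2p coordinates because n ≥ 2.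
  have hH : (Fintype.card (Fin p × Bool) : ℝ) * Real.exp (-((Real.sqrt 2 * u) ^ 2 / 2)) ≤ 1 := by
    have hn4 : (4 : ℝ) ≤ n := by exact_mod_cast h.four_le
    have hp3 : (3 : ℝ) ≤ p := by exact_mod_cast h.three_le
    rw [mul_pow, Real.sq_sqrt zero_le_two, mul_div_cancel_left₀ _ two_ne_zero, hu2, hLdef,
      Real.exp_neg, Real.exp_log (by positivity), mul_inv_le_iff₀ (by positivity)]
    simp only [Fintype.card_prod, Fintype.card_fin, Fintype.card_bool, Nat.cast_mul,
      Nat.cast_ofNat]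
    nlinarith
  have hN' := anticoncentration_gaussianAnalogue hX hY hb h1 hs hn0 hp0
    (H := Real.sqrt 2 * u) (by positivity) hH
  -- The truncation budget is 12D, so D ≤ 1/24 is exactly what gives τ ≤ 1/2.
  have key := abs_cdf_sum_sub_le c (L := L) (by linarith) h.log_card_le hXm hYm
    (hX.indep.comp (fun _ => signedCoords s) fun _ => measurable_signedCoords s)
    (hY.indep.comp (fun _ => signedCoords s) fun _ => measurable_signedCoords s)
    (fun i k => by
      simp only [signedCoords_eq]
      exact (mX3 i k.1).const_mul _)
    (fun i k => by
      simp only [signedCoords_eq]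
      exact (memLp_eval_gaussianAnalogue hX hY i k.1 3).const_mul _)
    (fun i k => by
      simp only [signedCoords_eq]
      rw [integral_const_mul, integral_const_mul, hX.centered,
        integral_eval_gaussianAnalogue hX hY])
    (fun i k l => by
      simp only [signedCoords_eq, mul_mul_mul_comm]
      rw [integral_const_mul, integral_const_mul, integral_mul_gaussianAnalogue hX hY])
    hΛ hτ (by linarith [h.D_le]) hΛL hN'
  -- 216 = 12 · 6 · 3, with (√2 u + 1)/u ≤ 3 because u ≥ 1; and 96 = 8 · 12.
  have hfinal : 12 * L * (6 * (Real.sqrt 2 * u + 1) / (s * Real.sqrt n * Real.sqrt b)) +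
      8 * c.bound * (12 * D) ≤ (216 / (a * Real.sqrt b) + 96 * c.bound) * D := by
    have e : 12 * L * (6 * (Real.sqrt 2 * u + 1) / (s * Real.sqrt n * Real.sqrt b)) =
        72 * ((Real.sqrt 2 * u + 1) / u) / (a * Real.sqrt b) * D := by
      rw [hsdef, scale, ← hLdef, ← hudef, ← hu2]
      field_simp
      ring
    have h2s : Real.sqrt 2 ≤ 2 := Real.sqrt_le_iff.2 ⟨by norm_num, by norm_num⟩
    have h3 : (Real.sqrt 2 * u + 1) / u ≤ 3 := by
      rw [div_le_iff₀ (by linarith)]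
      nlinarith
    rw [e, add_mul]
    have : 72 * ((Real.sqrt 2 * u + 1) / u) / (a * Real.sqrt b) * D ≤
        216 / (a * Real.sqrt b) * D := by
      gcongr
      linarith
    linarith
  refine rho_le_of_forall ?_ ?_ fun y => (le_of_eq ?_).trans
    ((key fun k => s * Real.sqrt n * y k).trans hfinal)
  · exact (Finset.aemeasurable_fun_sum Finset.univ fun i _ =>
      (hX.measurable i).aemeasurable).const_smul (Real.sqrt n)⁻¹
  · exact (Finset.aemeasurable_fun_sum Finset.univ fun i _ =>
      (hY.hasLaw i).aemeasurable).const_smul (Real.sqrt n)⁻¹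
  · have e : ∀ (x : Fin n → EuclideanSpace ℝ (Fin p)) (k : Fin p × Bool),
        signedCoords 1 ((Real.sqrt n)⁻¹ • ∑ i, x i) k ≤ y k ↔
          (∑ i, signedCoords s (x i)) k ≤ s * Real.sqrt n * y k := by
      intro x k
      have e1 : (∑ i, signedCoords s (x i)) k =
          s * Real.sqrt n * signedCoords 1 ((Real.sqrt n)⁻¹ • ∑ i, x i) k := by
        simp only [Finset.sum_apply, signedCoords_eq]
        rw [← Finset.mul_sum]
        simp
        field_simp
      rw [e1]
      exact (mul_le_mul_iff_right₀ (mul_pos hs hN)).symm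
    simp only [normalizedSum, e]

theorem rpow_third_pow_three {x : ℝ} (hx : 0 ≤ x) : (x ^ (1 / 3 : ℝ)) ^ 3 = x := by
  rw [← Real.rpow_natCast, ← Real.rpow_mul hx]
  norm_num

theorem D1_pow_three {B : ℝ} (hn : 4 ≤ n) (hp : 3 ≤ p) (hB : 0 ≤ B) :
    Real.sqrt n * D1 n p B ^ 3 = B * Real.sqrt (Real.log ((p : ℝ) * n)) ^ 7 := by
  have hL := two_le_log hn hp
  have hL0 : 0 ≤ Real.log ((p : ℝ) * n) := by linarith
  have hn0 : (0 : ℝ) < n := by exact_mod_cast (by omega : 0 < n)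
  have hx : 0 ≤ B ^ 2 * Real.log ((p : ℝ) * n) ^ 7 / n := by positivity
  have h1 : D1 n p B ^ 3 = Real.sqrt (B ^ 2 * Real.log ((p : ℝ) * n) ^ 7 / n) := by
    rw [D1, ← Real.rpow_natCast, ← Real.rpow_mul hx, Real.sqrt_eq_rpow]
    norm_num
  have h2 : B ^ 2 * Real.log ((p : ℝ) * n) ^ 7 =
      (B * Real.sqrt (Real.log ((p : ℝ) * n)) ^ 7) ^ 2 := by
    rw [mul_pow, ← pow_mul, mul_comm 7 2, pow_mul, Real.sq_sqrt hL0]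
  rw [h1, Real.sqrt_div' _ hn0.le, h2, Real.sqrt_sq (by positivity)]
  exact mul_div_cancel₀ _ (Real.sqrt_pos.2 hn0).ne'

theorem D1_pos {B : ℝ} (hn : 4 ≤ n) (hp : 3 ≤ p) (hB : 0 < B) : 0 < D1 n p B := by
  have hL := two_le_log hn hp
  have hL0 : 0 < Real.log ((p : ℝ) * n) := by linarith
  have hn0 : (0 : ℝ) < n := by exact_mod_cast (by omega : 0 < n)
  exact Real.rpow_pos_of_pos (by positivity) _

theorem D2_nonneg {B q : ℝ} (hn : 4 ≤ n) (hp : 3 ≤ p) : 0 ≤ D2 n p B q := by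
  have hL := two_le_log hn hp
  have hL0 : 0 < Real.log ((p : ℝ) * n) := by linarith
  exact Real.rpow_nonneg (by positivity) _

/-- For q ≤ 2 the exponent 1 - 2/q is not positive, so the claimed bound is trivial in that range.
-/
theorem one_le_D2 {B q : ℝ} (hn : 4 ≤ n) (hp : 3 ≤ p) (hB : 1 ≤ B) (hq0 : 0 < q) (hq : q ≤ 2) :
    1 ≤ D2 n p B q := by
  have hL := two_le_log hn hp
  have hn1 : (1 : ℝ) ≤ n := by exact_mod_cast (by omega : 1 ≤ n)
  refine Real.one_le_rpow ?_ (by norm_num)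
  have h1 : (n : ℝ) ^ (1 - 2 / q) ≤ 1 := Real.rpow_le_one_of_one_le_of_nonpos hn1 (by
    have := (one_le_div hq0).2 hq
    linarith)
  rw [one_le_div (Real.rpow_pos_of_pos (by linarith) _)]
  exact h1.trans (one_le_mul_of_one_le_of_one_le (one_le_pow₀ hB) (one_le_pow₀ (by linarith)))

theorem sq_le_three_mul_of_condE1 (hX : IsIndepCentered P X) {B : ℝ} (hB : 0 < B)
    (hE : CondE1 P X B) (i : Fin n) (j : Fin p) : ∫ ω, X i ω j ^ 2 ∂P ≤ 3 * B ^ 2 := by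
  obtain ⟨hi, hle⟩ := hE i j
  have hpt : ∀ x : ℝ, x ^ 2 ≤ 2 * B ^ 2 * (Real.exp (|x| / B) - 1) := fun x => by
    have h0 : 0 ≤ |x| / B := by positivity
    have h1 := Real.quadratic_le_exp_of_nonneg h0
    have h2 : (|x| / B) ^ 2 / 2 ≤ Real.exp (|x| / B) - 1 := by linarith
    rw [div_pow, sq_abs, div_div, div_le_iff₀ (by positivity)] at h2
    linarith
  have := integral_mono (hX.memLp_two i j).integrable_sq
    ((hi.sub (integrable_const 1)).const_mul (2 * B ^ 2)) fun ω => hpt (X i ω j)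
  simp only [Pi.sub_apply] at this
  rw [integral_const_mul, integral_sub hi (integrable_const 1)] at this
  simp only [integral_const, probReal_univ, smul_eq_mul, mul_one] at this
  nlinarith [sq_nonneg B]

theorem sq_le_three_mul_of_condE2 (hX : IsIndepCentered P X) {B q : ℝ} (hB : 0 < B) (hq : 2 ≤ q)
    (hE : CondE2 P X B q) (i : Fin n) (j : Fin p) : ∫ ω, X i ω j ^ 2 ∂P ≤ 3 * B ^ 2 := by
  obtain ⟨hi, hle⟩ := hE i
  have hpt : ∀ x : EuclideanSpace ℝ (Fin p), x j ^ 2 ≤ B ^ 2 * (1 + (⨆ j, |x j| / B) ^ q) :=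
    fun x => by
      have hsup := le_ciSup (f := fun j => |x j| / B) (Set.finite_range _).bddAbove j
      have h0 : 0 ≤ |x j| / B := by positivity
      have h1 : (|x j| / B) ^ 2 ≤ 1 + (⨆ j, |x j| / B) ^ q := by
        have hq0 : 0 ≤ (⨆ j, |x j| / B) ^ q := Real.rpow_nonneg (h0.trans hsup) _
        rcases le_or_gt (|x j| / B) 1 with h | h
        · have := pow_le_one₀ h0 h (n := 2)
          linarith
        · have h2 : (|x j| / B) ^ 2 ≤ (|x j| / B) ^ q := by
            rw [← Real.rpow_natCast]
            exact Real.rpow_le_rpow_of_exponent_le h.le (by exact_mod_cast hq)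
          have h3 := Real.rpow_le_rpow h0 hsup (by linarith : (0 : ℝ) ≤ q)
          linarith
      rw [div_pow, sq_abs, div_le_iff₀ (by positivity)] at h1
      linarith
  have := integral_mono (hX.memLp_two i j).integrable_sq
    (((integrable_const 1).add hi).const_mul (B ^ 2)) fun ω => hpt (X i ω)
  simp only [Pi.add_apply] at this
  rw [integral_const_mul, integral_add (integrable_const 1) hi] at this
  simp only [integral_const, probReal_univ, smul_eq_mul, mul_one] at this
  nlinarith [sq_nonneg B]

/-- The sum is at most 2n(sB)^q = 2((sB)² n^(2/q))^(q/2). The inner quantity is a² (D⁽²⁾)³/D² ≤ D,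
and D^(q/2) ≤ D because q ≥ 2 and D ≤ 1. -/
theorem sum_sqTail_le_of_condE2 {B D a q : ℝ} (h : IsAdmissible n p B D a) (hq : 2 ≤ q)
    (hD : D2 n p B q ≤ D) (hE : CondE2 P X B q) :
    ∑ i, ∫ ω, sqTail (signedCoords (scale n p D a) (X i ω)) ∂P ≤ 2 * D := by
  have hs := h.scale_pos
  have hB := h.one_le_B
  have hB0 : 0 < B := by linarith
  have hD0 := h.D_pos
  have ha := h.a_pos
  have hn0 : (0 : ℝ) < n := by have := h.four_le; exact_mod_cast (by omega : 0 < n)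
  have hL := h.two_le_log
  have hq0 : 0 < q := by linarith
  set s := scale n p D a with hsdef
  have hsB : 0 < s * B := mul_pos hs hB0
  have h1 : ∑ i, ∫ ω, sqTail (signedCoords s (X i ω)) ∂P ≤ n * ((s * B) ^ q * 2) := by
    refine (Finset.sum_le_sum fun i _ => integral_sqTail_signedCoords_le_rpow hs hB0 hq
      (hE i).1 (hE i).2).trans (le_of_eq ?_)
    simp
  have hnq : (n : ℝ) ^ (1 - 2 / q) * (n : ℝ) ^ (2 / q) = n := by
    rw [← Real.rpow_add hn0, sub_add_cancel, Real.rpow_one]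
  have hnq0 : 0 < (n : ℝ) ^ (1 - 2 / q) := Real.rpow_pos_of_pos hn0 _
  have h2 : (s * B) ^ 2 * (n : ℝ) ^ (2 / q) ≤ D := by
    have e3 : D2 n p B q ^ 3 = B ^ 2 * Real.log ((p : ℝ) * n) ^ 3 / (n : ℝ) ^ (1 - 2 / q) :=
      rpow_third_pow_three (by have : 0 ≤ Real.log ((p : ℝ) * n) := by linarith
                               positivity)
    have e4 : D2 n p B q ^ 3 ≤ D ^ 3 :=
      pow_le_pow_left₀ (D2_nonneg h.four_le h.three_le) hD 3
    rw [e3] at e4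
    have e5 : (s * B) ^ 2 * (n : ℝ) ^ (2 / q) = a ^ 2 * (B ^ 2 * Real.log ((p : ℝ) * n) ^ 3 /
        (n : ℝ) ^ (1 - 2 / q)) / D ^ 2 := by
      have e6 : s ^ 2 = a ^ 2 * Real.log ((p : ℝ) * n) ^ 3 / (D ^ 2 * n) := by
        rw [hsdef, scale, div_pow, mul_pow, mul_pow, Real.sq_sqrt hn0.le, ← pow_mul,
          mul_comm 3 2, pow_mul, Real.sq_sqrt (by linarith)]
      have e7 : (n : ℝ) ^ (2 / q) = n / (n : ℝ) ^ (1 - 2 / q) := by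
        rw [eq_div_iff hnq0.ne', mul_comm, hnq]
      rw [mul_pow, e6, e7]
      field_simp
    have ha2 : a ^ 2 ≤ 1 := pow_le_one₀ ha.le (by linarith [h.a_le])
    rw [e5, div_le_iff₀ (by positivity)]
    calc a ^ 2 * (B ^ 2 * Real.log ((p : ℝ) * n) ^ 3 / (n : ℝ) ^ (1 - 2 / q))
        ≤ 1 * D ^ 3 := by gcongr
      _ = D * D ^ 2 := by ring
  have h3 : n * (s * B) ^ q = ((s * B) ^ 2 * (n : ℝ) ^ (2 / q)) ^ (q / 2) := by
    rw [Real.mul_rpow (sq_nonneg (s * B)) (by positivity), ← Real.rpow_mul hn0.le,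
      ← Real.rpow_natCast, ← Real.rpow_mul hsB.le]
    rw [div_mul_div_cancel₀ hq0.ne', div_self two_ne_zero, Real.rpow_one, mul_comm]
    congr 2
    push_cast
    ring
  have h4 : n * (s * B) ^ q ≤ D := by
    rw [h3]
    calc ((s * B) ^ 2 * (n : ℝ) ^ (2 / q)) ^ (q / 2) ≤ D ^ (q / 2) :=
          Real.rpow_le_rpow (by positivity) h2 (by positivity)
      _ ≤ D ^ (1 : ℝ) := Real.rpow_le_rpow_of_exponent_ge hD0 (by linarith [h.D_le])
          (by linarith)
      _ = D := Real.rpow_one D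
  linarith

end main

end

end HDCLT

theorem mainTheorem2 :
    (∀ b : ℝ, 0 < b → ∃ C : ℝ, 0 < C ∧
      ∀ (n p : ℕ), 4 ≤ n → 3 ≤ p → ∀ B : ℝ, 1 ≤ B →
      ∀ (Ω Ω' : Type*) [MeasurableSpace Ω] [MeasurableSpace Ω']
        (P : Measure Ω) (P' : Measure Ω') [IsProbabilityMeasure P] [IsProbabilityMeasure P']
        (X : Fin n → Ω → EuclideanSpace ℝ (Fin p)) (Y : Fin n → Ω' → EuclideanSpace ℝ (Fin p)),
        HDCLT.IsIndepCentered P X → HDCLT.IsGaussianAnalogue P P' X Y →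
        HDCLT.CondM1 P X b → HDCLT.CondM2 P X B → HDCLT.CondE1 P X B →
        HDCLT.rho P P' (HDCLT.normalizedSum X) (HDCLT.normalizedSum Y) (HDCLT.hyperrectangles p)
          ≤ C * HDCLT.D1 n p B) ∧
    (∀ b q : ℝ, 0 < b → 0 < q → ∃ C : ℝ, 0 < C ∧
      ∀ (n p : ℕ), 4 ≤ n → 3 ≤ p → ∀ B : ℝ, 1 ≤ B →
      ∀ (Ω Ω' : Type*) [MeasurableSpace Ω] [MeasurableSpace Ω']
        (P : Measure Ω) (P' : Measure Ω') [IsProbabilityMeasure P] [IsProbabilityMeasure P']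
        (X : Fin n → Ω → EuclideanSpace ℝ (Fin p)) (Y : Fin n → Ω' → EuclideanSpace ℝ (Fin p)),
        HDCLT.IsIndepCentered P X → HDCLT.IsGaussianAnalogue P P' X Y →
        HDCLT.CondM1 P X b → HDCLT.CondM2 P X B → HDCLT.CondE2 P X B q →
        HDCLT.rho P P' (HDCLT.normalizedSum X) (HDCLT.normalizedSum Y) (HDCLT.hyperrectangles p)
          ≤ C * (HDCLT.D1 n p B + HDCLT.D2 n p B q)) := by
  obtain ⟨c⟩ := HDCLT.nonempty_smoothCutoff
  have hc := c.one_le_bound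
  have hm3 := HDCLT.stdAbsThirdMoment_nonneg
  have hM : 0 < 104 * c.bound * Real.exp 4 * (1 + HDCLT.stdAbsThirdMoment) := by positivity
  -- a depends only on the fixed cutoff and on the Gaussian third moment, so the final constant
  -- depends on b alone.
  set a := min (1 / 4) (104 * c.bound * Real.exp 4 * (1 + HDCLT.stdAbsThirdMoment))⁻¹ with ha
  have ha0 : 0 < a := lt_min (by norm_num) (inv_pos.2 hM)
  have ha4 : a ≤ 1 / 4 := min_le_left _ _
  have ha1 : 104 * c.bound * Real.exp 4 * (1 + HDCLT.stdAbsThirdMoment) * a ≤ 1 :=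
    (mul_le_mul_of_nonneg_left (min_le_right _ _) hM.le).trans (mul_inv_cancel₀ hM.ne').le
  constructor
  · intro b hb
    have hsb : 0 < Real.sqrt b := Real.sqrt_pos.2 hb
    -- The summand 24 covers the case D > 1/24, where ρ ≤ 1 suffices.
    refine ⟨24 + (216 / (a * Real.sqrt b) + 96 * c.bound), by positivity, ?_⟩
    intro n p hn hp B hB Ω Ω' _ _ P P' _ _ X Y hX hY h1 h2 hE
    have hD0 := HDCLT.D1_pos hn hp (by linarith : 0 < B)
    have hC0 : 0 ≤ 216 / (a * Real.sqrt b) + 96 * c.bound := by positivity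
    rcases le_or_gt (HDCLT.D1 n p B) (1 / 24) with hD | hD
    · have hadm : HDCLT.IsAdmissible n p B (HDCLT.D1 n p B) a :=
        ⟨hn, hp, hB, ha0, ha4, hD0, hD, (HDCLT.D1_pow_three hn hp (by linarith)).ge⟩
      have := HDCLT.rho_le_of_isAdmissible c hadm hb ha1 hX hY h1 h2
        (HDCLT.sq_le_three_mul_of_condE1 hX (by linarith) hE)
        (hadm.sum_sqTail_le zero_le_two (fun i j => (hE i j).1) fun i j => (hE i j).2)
      linarith
    · have := HDCLT.rho_le_one (P := P) (P' := P') (HDCLT.normalizedSum X)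
        (HDCLT.normalizedSum Y) (HDCLT.hyperrectangles p)
      nlinarith
  · intro b q hb hq
    have hsb : 0 < Real.sqrt b := Real.sqrt_pos.2 hb
    refine ⟨24 + (216 / (a * Real.sqrt b) + 96 * c.bound), by positivity, ?_⟩
    intro n p hn hp B hB Ω Ω' _ _ P P' _ _ X Y hX hY h1 h2 hE
    have hD1 := HDCLT.D1_pos hn hp (by linarith : 0 < B)
    have hD2 : 0 ≤ HDCLT.D2 n p B q := HDCLT.D2_nonneg hn hp
    have hC0 : 0 ≤ 216 / (a * Real.sqrt b) + 96 * c.bound := by positivity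
    set D := HDCLT.D1 n p B + HDCLT.D2 n p B q with hDdef
    rcases le_or_gt D (1 / 24) with hD | hD
    -- For q < 2 already D⁽²⁾ ≥ 1, contradicting D ≤ 1/24.
    · have hq2 : 2 ≤ q := by
        by_contra! hlt
        have := HDCLT.one_le_D2 hn hp hB hq hlt.le
        linarith
      have hadm : HDCLT.IsAdmissible n p B D a := by
        refine ⟨hn, hp, hB, ha0, ha4, by linarith, hD, ?_⟩
        rw [← HDCLT.D1_pow_three hn hp (by linarith)]
        gcongr
        linarith
      have := HDCLT.rho_le_of_isAdmissible c hadm hb ha1 hX hY h1 h2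
        (HDCLT.sq_le_three_mul_of_condE2 hX (by linarith) hq2 hE)
        (HDCLT.sum_sqTail_le_of_condE2 hadm hq2 (by linarith) hE)
      linarith
    · have := HDCLT.rho_le_one (P := P) (P' := P') (HDCLT.normalizedSum X)
        (HDCLT.normalizedSum Y) (HDCLT.hyperrectangles p)
      nlinarith
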